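/- Notation. Let $\bar A\in\{0,1\}^{n\times n}$ be the structural pattern of $x[t+1]=Ax[t]$; its state digraph has an edge $x_i\to x_j$ when $\bar A_{ji}=1$. A \emph{design} consists of finite collections $\mathcal I_B=(\iota_1,\dots,\iota_P)$ and $\mathcal I_C=(\gamma_1,\dots,\gamma_Q)$ of state indices (repetitions allowed; actuator $u$ acts on $x_{\iota_u}$ only, sensor $y$ measures $x_{\gamma_y}$ only) and a set $\mathcal K$ of links (sensor, actuator). The patterns $\bar B(\mathcal I_B)\in\{0,1\}^{n\times P}$ and $\bar C(\mathcal I_C)\in\{0,1\}^{Q\times n}$ have one free entry per actuator and per sensor. For real $A,B,C$ with given patterns and a set $\mathcal J\subseteq\mathcal K$ of failed links, the resilient fixed modes are the elements of $\bigcap_K\sigma(A+BKC)\subset\mathbb C$, over all real $K$ with $K_{uy}=0$ unless $(y,u)\in\mathcal K\setminus\mathcal J$. The structural system \emph{has structurally unstable resilient fixed modes} if for almost all values of the free entries of $A,B,C$ there is a nonzero resilient fixed mode. Problem $\mathcal P_2^s$. Given $\bar A$ and $k\ge 0$, minimize $|\mathcal I_B|+|\mathcal I_C|+|\mathcal K|$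 over all designs such that, for all $\mathcal J\subseteq\mathcal K$, $\mathcal J_B\subseteq\mathcal I_B$, $\mathcal J_C\subseteq\mathcal I_C$ with $|\mathcal J|+|\mathcal J_B|+|\mathcal J_C|\le k$, the structural system that remains when the actuators $\mathcal J_B$ and the sensors $\mathcal J_C$ are removed and the links $\mathcal J$ fail has no structurally unstable resilient fixed modes. Pairing patterns. Given $p$ actuators and $m$ sensors, let $M=\{(u_1,y_1),\dots,(u_r,y_r)\}$ be a maximum matching of the bipartite graph joining an actuator to the sensors that it reaches by a directed path in the system digraph. A pairing pattern consists of the links $(y_l,u_{l+1})$, $l<r$, and $(y_r,u_1)$, together with the following links: if $p\le m$, exactly one link from every unmatched sensor to an actuator, chosen so that every unmatched actuator gets a link; if $p>m$, exactly one link to every unmatched actuator from a sensor, chosen so that every unmatched sensor gets a link. Corollary. Let $\mathcal I_B^*$ and $\mathcal I_C^*$ consist of $k+1$ consecutive blocks $\mathcal I_B^{(i)}$ of length $p$ and $\mathcal I_C^{(i)}$ of length $m$, $i=1,\dots,k+1$, where each $\mathcal I_B^{(i)}$ is a collection of dedicated actuators of minimum size such that $(\bar A,\bar B(\mathcal I_B^{(i)}))$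 is structurally controllable, and each $\mathcal I_C^{(i)}$ is a collection of dedicated sensors of minimum size such that $(\bar A,\bar C(\mathcal I_C^{(i)}))$ is structurally observable. Let $\mathcal K^{(i)}$ be a pairing pattern of $(\mathcal I_B^{(i)},\mathcal I_C^{(i)})$ and $\mathcal K^*=\bigcup_{i=1}^{k+1}\mathcal K^{(i)}$. (1) For every failure of at most $k$ actuators, sensors and links in total, almost all realizations of what remains of $(\mathcal I_B^*,\mathcal I_C^*,\mathcal K^*)$ have no nonzero resilient fixed modes. (2) If the bipartite graph with the edges $(i,j)$, $\bar A_{ji}=1$, between two copies of the set of states has a perfect matching, then $(\mathcal I_B^*,\mathcal I_C^*,\mathcal K^*)$ is a solution to $\mathcal P_2^s$. (3) A solution to $\mathcal P_2^s$ can be computed, for all $n\ge 1$, all $k\ge 0$ and all $\bar A$ as in (2), given by a list of the edges of the state digraph, by a unit-cost random access machine in $$\mathcal O\bigl((k+1)\max\{|\mathcal V|+|\mathcal E|,\ (|\mathcal I_B|+|\mathcal I_C|)^{5/2}\}\bigr)$$ steps, where $\mathcal I_B,\mathcal I_C$ are the collections of the computed solution and $|\mathcal V|,|\mathcal E|$ are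 the numbers of vertices and edges of the system digraph of $(\bar A,\bar B(\mathcal I_B),\bar C(\mathcal I_C))$. -/

import Mathlib

open MeasureTheory

/-! ## Structural patterns, realizations and closed loops

A structural matrix is a `Bool`-valued matrix: `true` marks a free parameter, `false` a fixed zero.
Throughout, `X`, `U`, `Y` index the states, the actuators and the sensors. A feedback link from the
sensor `y` to the actuator `u` is the pair `(y, u)`. -/

namespace ResilientDesign

/-- The free parameters of a structural matrix, one real number for every position marked `true`;
this is Euclidean space of dimension the number of free positions, with Lebesgue measure. -/
abbrev Params {R S : Type} (P : Matrix R S Bool) : Type :=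
  {e : R × S // P e.1 e.2 = true} → ℝ

/-- The numerical matrix with sparsity pattern `P` and the given values of the free parameters. -/
def realize {R S : Type} (P : Matrix R S Bool) (q : Params P) : Matrix R S ℝ :=
  Matrix.of fun r s => if h : P r s = true then q ⟨(r, s), h⟩ else 0

/-- The gains compatible with the links `L`, when the links in `F` have failed. -/
def gains {U Y : Type} (L F : Set (Y × U)) : Set (Matrix U Y ℝ) :=
  {K | ∀ u y, ((y, u) ∉ L ∨ (y, u) ∈ F) → K u y = 0}

/-- The resilient fixed modes of `(A, B, C)` with respect to the links `L` and the collection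
`F` of possible communication failures: the complex numbers which, for some failure in the
collection, are eigenvalues of `A + B K C` for every compatible real gain `K`. -/
def resilientFixedModes {X U Y Δ : Type} [Fintype X] [DecidableEq X] [Fintype U] [Fintype Y]
    (A : Matrix X X ℝ) (B : Matrix X U ℝ) (C : Matrix Y X ℝ)
    (L : Set (Y × U)) (F : Δ → Set (Y × U)) : Set ℂ :=
  ⋃ i, ⋂ K ∈ gains L (F i), spectrum ℂ ((A + B * K * C).map (algebraMap ℝ ℂ))

/-- The structural system has structurally unstable resilient fixed modes: almost every numerical
realization has a resilient fixed mode different from zero. -/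
def HasStructurallyUnstableResilientFixedModes {X U Y Δ : Type} [Fintype X] [DecidableEq X]
    [Fintype U] [Fintype Y]
    (PA : Matrix X X Bool) (PB : Matrix X U Bool) (PC : Matrix Y X Bool)
    (L : Set (Y × U)) (F : Δ → Set (Y × U)) : Prop :=
  ∀ᵐ q : Params PA × Params PB × Params PC,
    ∃ z ∈ resilientFixedModes (realize PA q.1) (realize PB q.2.1) (realize PC q.2.2) L F, z ≠ 0

/-- Almost no numerical realization has a resilient fixed mode different from zero. -/
def AlmostNeverHasUnstableResilientFixedModes {X U Y Δ : Type} [Fintype X] [DecidableEq X]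
    [Fintype U] [Fintype Y]
    (PA : Matrix X X Bool) (PB : Matrix X U Bool) (PC : Matrix Y X Bool)
    (L : Set (Y × U)) (F : Δ → Set (Y × U)) : Prop :=
  ∀ᵐ q : Params PA × Params PB × Params PC,
    ∀ z ∈ resilientFixedModes (realize PA q.1) (realize PB q.2.1) (realize PC q.2.2) L F, z = 0

/-! ## Structural controllability and observability -/

/-- `[B, AB, …, A^(n-1) B]` has full row rank. -/
def Controllable {X U : Type} [Fintype X] [DecidableEq X] [Fintype U]
    (A : Matrix X X ℝ) (B : Matrix X U ℝ) : Prop :=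
  (Matrix.of fun (x : X) (ju : Fin (Fintype.card X) × U) =>
    (A ^ (ju.1 : ℕ) * B) x ju.2).rank = Fintype.card X

/-- `[C; CA; …; C A^(n-1)]` has full column rank. -/
def Observable {X Y : Type} [Fintype X] [DecidableEq X]
    (A : Matrix X X ℝ) (C : Matrix Y X ℝ) : Prop :=
  (Matrix.of fun (jy : Fin (Fintype.card X) × Y) (x : X) =>
    (C * A ^ (jy.1 : ℕ)) jy.2 x).rank = Fintype.card X

def StructurallyControllable {X U : Type} [Fintype X] [DecidableEq X] [Fintype U]
    (PA : Matrix X X Bool) (PB : Matrix X U Bool) : Prop :=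
  ∃ (a : Params PA) (b : Params PB), Controllable (realize PA a) (realize PB b)

def StructurallyObservable {X Y : Type} [Fintype X] [DecidableEq X]
    (PA : Matrix X X Bool) (PC : Matrix Y X Bool) : Prop :=
  ∃ (a : Params PA) (c : Params PC), Observable (realize PA a) (realize PC c)

/-- The input pattern of dedicated actuators: actuator `u` acts on the state `act u` only. The
same state may be listed several times. -/
def inputPattern {X U : Type} [DecidableEq X] (act : U → X) : Matrix X U Bool :=
  Matrix.of fun x u => decide (act u = x)

/-- The output pattern of dedicated sensors: sensor `y` measures the state `sens y` only. -/
def outputPattern {X Y : Type} [DecidableEq X] (sens : Y → X) : Matrix Y X Bool :=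
  Matrix.of fun y x => decide (sens y = x)

/-- A smallest collection of dedicated actuators that ensures structural controllability. -/
def IsMinimumActuation {n p : ℕ} (PA : Matrix (Fin n) (Fin n) Bool) (act : Fin p → Fin n) : Prop :=
  StructurallyControllable PA (inputPattern act) ∧
    ∀ (p' : ℕ) (act' : Fin p' → Fin n),
      StructurallyControllable PA (inputPattern act') → p ≤ p'

/-- A smallest collection of dedicated sensors that ensures structural observability. -/
def IsMinimumSensing {n m : ℕ} (PA : Matrix (Fin n) (Fin n) Bool) (sens : Fin m → Fin n) : Prop :=
  StructurallyObservable PA (outputPattern sens) ∧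
    ∀ (m' : ℕ) (sens' : Fin m' → Fin n),
      StructurallyObservable PA (outputPattern sens') → m ≤ m'

/-! ## Digraphs and matchings -/

/-- The system digraph, on the states, the actuators and the sensors. -/
def systemDigraph {X U Y : Type} (PA : Matrix X X Bool) (PB : Matrix X U Bool)
    (PC : Matrix Y X Bool) : Digraph (X ⊕ U ⊕ Y) where
  Adj v w := match v, w with
    | .inl i, .inl j => PA j i = true
    | .inr (.inl u), .inl i => PB i u = true
    | .inl i, .inr (.inr y) => PC y i = true
    | _, _ => False

/-- The number of vertices plus the number of edges of a digraph. -/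
noncomputable def digraphSize {V : Type} [Fintype V] (G : Digraph V) : ℕ :=
  Fintype.card V + {e : V × V | G.Adj e.1 e.2}.ncard

/-- There is a directed path from `v` to `w`. -/
def Reaches {V : Type} (G : Digraph V) (v w : V) : Prop := Relation.ReflTransGen G.Adj v w

/-- A matching of the bipartite graph with the given edges: no two of its edges share a vertex. -/
def IsMatching {S T : Type} (edge : S → T → Prop) (M : Finset (S × T)) : Prop :=
  (∀ e ∈ M, edge e.1 e.2) ∧
    ∀ e ∈ M, ∀ f ∈ M, (e.1 = f.1 ∨ e.2 = f.2) → e = f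

/-- A matching with the largest number of edges. -/
def IsMaximumMatching {S T : Type} (edge : S → T → Prop) (M : Finset (S × T)) : Prop :=
  IsMatching edge M ∧ ∀ M', IsMatching edge M' → M'.card ≤ M.card

/-- The left vertex `s` belongs to an edge of `M`. -/
def LeftMatched {S T : Type} (M : Finset (S × T)) (s : S) : Prop := ∃ t, (s, t) ∈ M

/-- The right vertex `t` belongs to an edge of `M`. -/
def RightMatched {S T : Type} (M : Finset (S × T)) (t : T) : Prop := ∃ s, (s, t) ∈ M

/-- The state bipartite graph, with an edge from the left copy of the state `i` to the right copy
of the state `j` when `i` acts on `j`, has a perfect matching. -/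
def HasPerfectMatching {n : ℕ} (PA : Matrix (Fin n) (Fin n) Bool) : Prop :=
  ∃ M : Finset (Fin n × Fin n), IsMatching (fun i j => PA j i = true) M ∧
    (∀ i, LeftMatched M i) ∧ ∀ j, RightMatched M j

/-! ## The information pattern of minimum collections of actuators and sensors -/

/-- The dedicated actuator `u` reaches the dedicated sensor `y` in the system digraph. -/
def ActuatorReachesSensor {n p m : ℕ} (PA : Matrix (Fin n) (Fin n) Bool)
    (act : Fin p → Fin n) (sens : Fin m → Fin n) (u : Fin p) (y : Fin m) : Prop :=
  Reaches (systemDigraph PA (inputPattern act) (outputPattern sens))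
    (.inr (.inl u)) (.inr (.inr y))

/-- `K` is a sequential pairing of the matching `M`: for some enumeration
`(u 0, y 0), …, (u (r-1), y (r-1))` of `M`, the links of `K` lead from every sensor `y l` to the
actuator `u (l+1)`, and from `y (r-1)` to `u 0`. -/
def IsSequentialPairing {p m : ℕ} (M : Finset (Fin p × Fin m)) (K : Finset (Fin m × Fin p)) :
    Prop :=
  ∃ (r : ℕ) (u : Fin r → Fin p) (y : Fin r → Fin m),
    Function.Injective (fun l => (u l, y l)) ∧
    M = Finset.univ.image (fun l => (u l, y l)) ∧
    K = Finset.univ.image (fun l => (y l, u (finRotate r l)))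

/-- `K'` links what the matching `M` leaves unmatched. If there are at least as many sensors as
actuators, then every unmatched sensor gets one link, ending in one of the actuators, in such a way
that no actuator is left without a link; otherwise the same with the two roles exchanged. -/
def IsCompletion {p m : ℕ} (M : Finset (Fin p × Fin m)) (K' : Finset (Fin m × Fin p)) : Prop :=
  (p ≤ m →
    (∀ e ∈ K', ¬ RightMatched M e.1) ∧
    (∀ y, ¬ RightMatched M y → ∃! u, (y, u) ∈ K') ∧
    (∀ u, ¬ LeftMatched M u → ∃ y, (y, u) ∈ K')) ∧
  (m < p →
    (∀ e ∈ K', ¬ LeftMatched M e.2) ∧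
    (∀ u, ¬ LeftMatched M u → ∃! y, (y, u) ∈ K') ∧
    (∀ y, ¬ RightMatched M y → ∃ u, (y, u) ∈ K'))

/-- `K` is an information pattern obtained from the dedicated actuators `act` and sensors `sens`:
a sequential pairing of a maximum matching of the bipartite graph in which an actuator is joined to
the sensors that it reaches, together with links for what this matching leaves unmatched. -/
def IsPairingPattern {n p m : ℕ} (PA : Matrix (Fin n) (Fin n) Bool)
    (act : Fin p → Fin n) (sens : Fin m → Fin n) (K : Finset (Fin m × Fin p)) : Prop :=
  ∃ (M : Finset (Fin p × Fin m)) (K₀ K' : Finset (Fin m × Fin p)),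
    IsMaximumMatching (ActuatorReachesSensor PA act sens) M ∧
    IsSequentialPairing M K₀ ∧ IsCompletion M K' ∧ K = K₀ ∪ K'

/-! ## The co-design problem for stabilization -/

/-- Finite collections of dedicated actuators and sensors (of a system with `n` states), and a set
of links from the sensors to the actuators. -/
structure Design (n : ℕ) where
  numAct : ℕ
  numSens : ℕ
  act : Fin numAct → Fin n
  sens : Fin numSens → Fin n
  links : Finset (Fin numSens × Fin numAct)

namespace Design

variable {n : ℕ}

/-- The objective: the number of actuators, sensors and links. -/
def cost (D : Design n) : ℕ := D.numAct + D.numSens + D.links.card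

/-- Under any failure of at most `k` links `J`, actuators `JB` and sensors `JC` in total, what
remains has no structurally unstable resilient fixed modes. -/
def Feasible (PA : Matrix (Fin n) (Fin n) Bool) (k : ℕ) (D : Design n) : Prop :=
  ∀ J ⊆ D.links, ∀ (JB : Finset (Fin D.numAct)) (JC : Finset (Fin D.numSens)),
    J.card + JB.card + JC.card ≤ k →
      ¬ HasStructurallyUnstableResilientFixedModes PA
        (inputPattern fun u : {u // u ∉ JB} => D.act u)
        (outputPattern fun y : {y // y ∉ JC} => D.sens y)
        {e | (e.1.1, e.2.1) ∈ D.links} (fun _ : Unit => {e | (e.1.1, e.2.1) ∈ J})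

/-- Under any failure of at most `k` links `J`, actuators `JB` and sensors `JC` in total, almost no
numerical realization of what remains has a resilient fixed mode different from zero. -/
def GenericallyFeasible (PA : Matrix (Fin n) (Fin n) Bool) (k : ℕ) (D : Design n) : Prop :=
  ∀ J ⊆ D.links, ∀ (JB : Finset (Fin D.numAct)) (JC : Finset (Fin D.numSens)),
    J.card + JB.card + JC.card ≤ k →
      AlmostNeverHasUnstableResilientFixedModes PA
        (inputPattern fun u : {u // u ∉ JB} => D.act u)
        (outputPattern fun y : {y // y ∉ JC} => D.sens y)
        {e | (e.1.1, e.2.1) ∈ D.links} (fun _ : Unit => {e | (e.1.1, e.2.1) ∈ J})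

/-- The design is feasible and has the least number of actuators, sensors and links in total. -/
def IsSolution (PA : Matrix (Fin n) (Fin n) Bool) (k : ℕ) (D : Design n) : Prop :=
  D.Feasible PA k ∧ ∀ D' : Design n, D'.Feasible PA k → D.cost ≤ D'.cost

/-- The system digraph of the design. -/
def digraph (PA : Matrix (Fin n) (Fin n) Bool) (D : Design n) :
    Digraph (Fin n ⊕ Fin D.numAct ⊕ Fin D.numSens) :=
  systemDigraph PA (inputPattern D.act) (outputPattern D.sens)

end Design

/-- The `i`-th of `k + 1` consecutive blocks of length `p`. -/
def block {k p n : ℕ} (c : Fin ((k + 1) * p) → Fin n) (i : Fin (k + 1)) : Fin p → Fin n :=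
  fun j => c (finProdFinEquiv (i, j))

/-- The design with all the actuators and sensors, and with the union of the information patterns
`K i`, where `K i` links the `i`-th block of sensors to the `i`-th block of actuators. -/
def unionDesign {k p m n : ℕ} (act : Fin ((k + 1) * p) → Fin n) (sens : Fin ((k + 1) * m) → Fin n)
    (K : Fin (k + 1) → Finset (Fin m × Fin p)) : Design n where
  numAct := (k + 1) * p
  numSens := (k + 1) * m
  act := act
  sens := sens
  links := Finset.univ.biUnion fun i =>
    (K i).image fun e => (finProdFinEquiv (i, e.1), finProdFinEquiv (i, e.2))

/-! ## Random access machines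

The unit-cost random access machine with addition and truncated subtraction, programmed by
structured commands. A program names finitely many registers; the memory is accessed through
addresses held in registers. -/

namespace RAM

structure State where
  reg : ℕ → ℕ
  mem : ℕ → ℕ

inductive Cmd where
  | skip : Cmd
  /-- register `d` becomes the constant `c` -/
  | const (d c : ℕ) : Cmd
  /-- register `d` becomes the sum of the registers `a` and `b` -/
  | add (d a b : ℕ) : Cmd
  /-- register `d` becomes the truncated difference of the registers `a` and `b` -/
  | sub (d a b : ℕ) : Cmd
  /-- register `d` becomes the memory cell whose address is in register `a` -/
  | load (d a : ℕ) : Cmd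
  /-- the memory cell whose address is in register `a` becomes register `s` -/
  | store (a s : ℕ) : Cmd
  | seq (c₁ c₂ : Cmd) : Cmd
  /-- run `c₁` if register `r` is nonzero, and `c₂` otherwise -/
  | ifNonzero (r : ℕ) (c₁ c₂ : Cmd) : Cmd
  /-- repeat `c` as long as register `r` is nonzero -/
  | whileNonzero (r : ℕ) (c : Cmd) : Cmd

/-- `Exec c s s' t`: started in the state `s`, the command `c` stops after exactly `t` steps in the
state `s'`. Every elementary instruction and every test is one step. -/
inductive Exec : Cmd → State → State → ℕ → Prop where
  | skip (s : State) : Exec .skip s s 1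
  | const (s : State) (d c : ℕ) :
      Exec (.const d c) s { s with reg := Function.update s.reg d c } 1
  | add (s : State) (d a b : ℕ) :
      Exec (.add d a b) s { s with reg := Function.update s.reg d (s.reg a + s.reg b) } 1
  | sub (s : State) (d a b : ℕ) :
      Exec (.sub d a b) s { s with reg := Function.update s.reg d (s.reg a - s.reg b) } 1
  | load (s : State) (d a : ℕ) :
      Exec (.load d a) s { s with reg := Function.update s.reg d (s.mem (s.reg a)) } 1
  | store (s : State) (a r : ℕ) :
      Exec (.store a r) s { s with mem := Function.update s.mem (s.reg a) (s.reg r) } 1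
  | seq {c₁ c₂ : Cmd} {s s' s'' : State} {t t' : ℕ} :
      Exec c₁ s s' t → Exec c₂ s' s'' t' → Exec (.seq c₁ c₂) s s'' (t + t')
  | ifTrue {r : ℕ} {c₁ c₂ : Cmd} {s s' : State} {t : ℕ} :
      s.reg r ≠ 0 → Exec c₁ s s' t → Exec (.ifNonzero r c₁ c₂) s s' (t + 1)
  | ifFalse {r : ℕ} {c₁ c₂ : Cmd} {s s' : State} {t : ℕ} :
      s.reg r = 0 → Exec c₂ s s' t → Exec (.ifNonzero r c₁ c₂) s s' (t + 1)
  | whileTrue {r : ℕ} {c : Cmd} {s s' s'' : State} {t t' : ℕ} :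
      s.reg r ≠ 0 → Exec c s s' t → Exec (.whileNonzero r c) s' s'' t' →
      Exec (.whileNonzero r c) s s'' (t + t' + 1)
  | whileFalse {r : ℕ} {c : Cmd} {s : State} :
      s.reg r = 0 → Exec (.whileNonzero r c) s s 1

/-- All registers are zero, and the memory holds the input, followed by zeros. -/
def initial (input : List ℕ) : State where
  reg := fun _ => 0
  mem := fun a => input.getD a 0

/-- The memory begins with the given output. -/
def Holds (s : State) (output : List ℕ) : Prop :=
  ∀ a < output.length, s.mem a = output.getD a 0

end RAM

/-- `E` lists every edge of the state digraph once, as the pair of its source and its target. -/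
def ListsEdges {n : ℕ} (PA : Matrix (Fin n) (Fin n) Bool) (E : List (Fin n × Fin n)) : Prop :=
  E.Nodup ∧ ∀ i j, (i, j) ∈ E ↔ PA j i = true

/-- The number of states, the number of edges, the bound on the number of failures, and the
edges. -/
def encodeInstance {n : ℕ} (E : List (Fin n × Fin n)) (k : ℕ) : List ℕ :=
  [n, E.length, k] ++ E.flatMap fun e => [(e.1 : ℕ), (e.2 : ℕ)]

/-- The number of actuators, of sensors and of links, followed by the states that the actuators
act on, the states that the sensors measure, and the links. -/
def EncodesDesign {n : ℕ} (D : Design n) (w : List ℕ) : Prop :=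
  ∃ L : List (Fin D.numSens × Fin D.numAct), L.Nodup ∧ (∀ e, e ∈ L ↔ e ∈ D.links) ∧
    w = [D.numAct, D.numSens, L.length] ++
      (List.ofFn fun u => (D.act u : ℕ)) ++ (List.ofFn fun y => (D.sens y : ℕ)) ++
      L.flatMap fun e => [(e.1 : ℕ), (e.2 : ℕ)]

/-- The program `c` computes the design `D` for the pattern `PA` (given by any list `E` of its
edges) and the bound `k`, in `t` steps. -/
def ComputesDesign {n : ℕ} (c : RAM.Cmd) (E : List (Fin n × Fin n)) (k : ℕ) (D : Design n)
    (t : ℕ) : Prop :=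
  ∃ (s : RAM.State) (w : List ℕ), RAM.Exec c (RAM.initial (encodeInstance E k)) s t ∧
    EncodesDesign D w ∧ RAM.Holds s w

end ResilientDesign

/-!
Feasibility. With `B K C` for all gains `K`, feedback through dedicated actuators and sensors
produces all perturbations of `A` that are supported on the edges from a measured state to an
actuated state along a link, provided that the weights in `B` and `C` do not vanish. The nonzero
resilient fixed modes are therefore the nonzero eigenvalues common to `A + H` for all these
perturbations `H`. If the closed loop is strongly connected, almost no `A` has such an eigenvalue
(`ae_noCommonEigenvalue`): the free parameters of `A` are switched on one by one, from the zero
matrix, and for each of them all but finitely many values are harmless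
(`finite_not_noCommonEigenvalue`). Indeed, the characteristic polynomial is affine in the new
weight, so that infinitely many bad values give infinitely many numbers at which an entry of the
resolvents of `A` and of `A + H` agrees. Then the entries are equal as rational functions, and by
expansion at infinity the corresponding entries of all powers are equal
(`pow_apply_eq_of_resolvent_eq`), which fails as soon as the new edge lies on a closed walk through
a feedback edge. The edges into vertices that the feedback edge does not reach yet come first, when
the entry in question of the resolvent of `A` is zero. Pairing patterns make the closed loop
strongly connected (`closedLoopConnected_of_isPairingPattern`), and `k` failures leave one of `k +
1` blocks intact (`unionDesign_genericallyFeasible`).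

Optimality. With a perfect matching, `A` is almost always invertible. Hence the diagonal block of
every strong component without predecessors, or without successors, has only nonzero eigenvalues,
and feedback cannot move them unless a link ends, or starts, in the component
(`exists_fixed_eigenvalue`). So each of the `p` sources needs `k + 1` actuators and `k + 1` links of
its own, each of the `m` sinks needs `k + 1` sensors and `k + 1` links of its own, and every design
has at least the cost `(k + 1) * (p + m + max p m)` (`Design.Feasible.le_cost`). Conversely, `p`
actuators that reach all states make the system structurally controllable
(`structurallyControllable_of_reach`), again by `ae_noCommonEigenvalue`. Thus the blocks of minimum
collections attain the bound.

Complexity. The proof of strong connectedness uses only that every source reaches, and every sink is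
reached from, a member of a pair. A maximum matching is not needed for this: if every sink is
labelled with a source that reaches it, and every source with a sink that it reaches, then a greedy
matching along these linearly many pairs suffices (`RAM.runs_matchPairs`). The labels come from
graph searches: the roots of a first search are the starting points of a second one in the opposite
order, whose roots represent the sources, and likewise for the sinks in the reversed digraph
(`RAM.runs_findBasis`). The whole computation is linear in the digraph plus the output. The program
is written in a loop-free code (`RAM.Code`) on named registers and tables, combined by loops, and
its correctness and running time are proved on these abstract states (`RAM.Runs`); its compilation
stores the tables interleaved in the memory above the input and the output.
-/

namespace ResilientDesign

/-! ### Resolvents and common eigenvalues -/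

section Eigenvalues

open Polynomial Matrix

variable {V : Type} [Fintype V] [DecidableEq V]

/-- The entries of the adjugate of `X - M` have degree less than the size of `M`: after a row is
replaced by a unit vector, the coefficient matrix of `X` is singular. -/
theorem adjugate_charmatrix_mem_degreeLT (M : Matrix V V ℂ) (x y : V) :
    (charmatrix M).adjugate x y ∈ degreeLT ℂ (Fintype.card V) := by
  have key : (charmatrix M).updateRow y (Pi.single x 1) =
      (X : ℂ[X]) • ((1 : Matrix V V ℂ).updateRow y 0).map C +
        ((-M).updateRow y (Pi.single x 1)).map C := by
    ext1 i j
    by_cases hi : i = y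
    · subst hi
      by_cases hj : j = x
      · subst hj; simp
      · simp [hj]
    · by_cases hij : i = j
      · subst hij; simp [hi, sub_eq_add_neg]
      · simp [hi, hij]
  have h1 := natDegree_det_X_add_C_le ((1 : Matrix V V ℂ).updateRow y 0)
    ((-M).updateRow y (Pi.single x 1))
  have h2 := coeff_det_X_add_C_card ((1 : Matrix V V ℂ).updateRow y 0)
    ((-M).updateRow y (Pi.single x 1))
  rw [det_eq_zero_of_row_eq_zero (A := (1 : Matrix V V ℂ).updateRow y 0) y (by simp)] at h2
  rw [adjugate_apply, key, mem_degreeLT, degree_lt_iff_coeff_zero]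
  intro k hk
  rcases hk.eq_or_lt with rfl | hk
  · exact h2
  · exact coeff_eq_zero_of_natDegree_lt (h1.trans_lt hk)

/-- The numerators of the expansion at infinity of the entry `(x, y)` of the resolvent
`(z - M)⁻¹`: the `i`-th remainder of the division by the characteristic polynomial. -/
noncomputable def resolventNumerator (M : Matrix V V ℂ) (x y : V) (i : ℕ) : ℂ[X] :=
  ((charmatrix M).adjugate * (M ^ i).map C) x y

theorem resolventNumerator_zero (M : Matrix V V ℂ) (x y : V) :
    resolventNumerator M x y 0 = (charmatrix M).adjugate x y := by
  simp [resolventNumerator]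

theorem resolventNumerator_succ (M : Matrix V V ℂ) (x y : V) (i : ℕ) :
    X * resolventNumerator M x y i =
      M.charpoly * C ((M ^ i) x y) + resolventNumerator M x y (i + 1) := by
  have h : (charmatrix M).adjugate * charmatrix M = M.charpoly • 1 := adjugate_mul _
  have h' : (X : ℂ[X]) • (charmatrix M).adjugate =
      M.charpoly • 1 + (charmatrix M).adjugate * M.map C := by
    rw [← h, charmatrix, mul_sub, RingHom.mapMatrix_apply, sub_add_cancel, ← scalar_commute
      (X : ℂ[X]) (fun _ => mul_comm _ _), scalar_apply, smul_eq_diagonal_mul]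
  have h'' : (X : ℂ[X]) • ((charmatrix M).adjugate * (M ^ i).map C) =
      M.charpoly • (M ^ i).map C + (charmatrix M).adjugate * (M ^ (i + 1)).map C := by
    rw [← smul_mul, h', add_mul, smul_mul, one_mul, Matrix.mul_assoc, ← Matrix.map_mul, pow_succ']
  have h3 := congrFun (congrFun h'' x) y
  simpa [resolventNumerator] using h3

theorem resolventNumerator_degree_lt (M : Matrix V V ℂ) (x y : V) (i : ℕ) :
    (resolventNumerator M x y i).degree < Fintype.card V := by
  rw [← mem_degreeLT, resolventNumerator, mul_apply]
  refine Submodule.sum_mem _ fun k _ => ?_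
  rw [map_apply, mul_comm, ← smul_eq_C_mul]
  exact Submodule.smul_mem _ _ (adjugate_charmatrix_mem_degreeLT M x k)

/-- If an entry of two resolvents is the same rational function, then the corresponding entries of
all powers agree. -/
theorem pow_apply_eq_of_resolvent_eq {M N : Matrix V V ℂ} {x y : V}
    (h : M.charpoly * (charmatrix N).adjugate x y = N.charpoly * (charmatrix M).adjugate x y)
    (i : ℕ) : (M ^ i) x y = (N ^ i) x y := by
  suffices H : ∀ i, M.charpoly * resolventNumerator N x y i =
      N.charpoly * resolventNumerator M x y i → (M ^ i) x y = (N ^ i) x y ∧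
      M.charpoly * resolventNumerator N x y (i + 1) =
      N.charpoly * resolventNumerator M x y (i + 1) by
    have H' : ∀ i, M.charpoly * resolventNumerator N x y i =
        N.charpoly * resolventNumerator M x y i := by
      intro i
      induction i with
      | zero => simpa only [resolventNumerator_zero] using h
      | succ i ih => exact (H i ih).2
    exact (H i (H' i)).1
  intro i hi
  have e1 := resolventNumerator_succ M x y i
  have e2 := resolventNumerator_succ N x y i
  set P := M.charpoly
  set Q := N.charpoly
  have hP : P.degree = Fintype.card V := charpoly_degree_eq_dim M
  have hQ : Q.degree = Fintype.card V := charpoly_degree_eq_dim N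
  have key : P * Q * C ((M ^ i) x y - (N ^ i) x y) =
      P * resolventNumerator N x y (i + 1) - Q * resolventNumerator M x y (i + 1) := by
    rw [C_sub]
    linear_combination P * e2 - Q * e1 - (X : ℂ[X]) * hi
  have hc : (M ^ i) x y - (N ^ i) x y = 0 := by
    by_contra hne
    have hd : (P * Q * C ((M ^ i) x y - (N ^ i) x y)).degree =
        (Fintype.card V : WithBot ℕ) + Fintype.card V := by
      rw [degree_mul, degree_mul, hP, hQ, degree_C hne, add_zero]
    have hlt : (P * resolventNumerator N x y (i + 1) -
        Q * resolventNumerator M x y (i + 1)).degree <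
        (Fintype.card V : WithBot ℕ) + Fintype.card V := by
      refine (degree_sub_le _ _).trans_lt (max_lt ?_ ?_)
      · rw [degree_mul, hP]
        exact WithBot.add_lt_add_left (by simp) (resolventNumerator_degree_lt N x y _)
      · rw [degree_mul, hQ]
        exact WithBot.add_lt_add_left (by simp) (resolventNumerator_degree_lt M x y _)
    rw [← key, hd] at hlt
    exact lt_irrefl _ hlt
  refine ⟨sub_eq_zero.1 hc, ?_⟩
  rw [hc, C_0, mul_zero] at key
  exact (sub_eq_zero.1 key.symm)

theorem adjugate_charmatrix_eq_zero {M : Matrix V V ℂ} {x y : V}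
    (h : ∀ i, (M ^ i) x y = 0) : (charmatrix M).adjugate x y = 0 := by
  have H : ∀ i, X ^ i * (charmatrix M).adjugate x y = resolventNumerator M x y i := by
    intro i
    induction i with
    | zero => simp [resolventNumerator_zero]
    | succ i ih =>
      have := resolventNumerator_succ M x y i
      rw [h i, C_0, mul_zero, zero_add] at this
      rw [← this, ← ih]; ring
  by_contra hne
  have h1 := resolventNumerator_degree_lt M x y (Fintype.card V)
  rw [← H, degree_mul, degree_X_pow] at h1
  have h2 : (0 : WithBot ℕ) ≤ ((charmatrix M).adjugate x y).degree := zero_le_degree_iff.2 hne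
  exact absurd h1 (not_lt.2 (le_add_of_nonneg_right h2))

/-- The characteristic polynomial is affine in the weight of a single edge. -/
theorem charpoly_add_single (M : Matrix V V ℂ) (x y : V) (t : ℂ) :
    (M + t • single y x 1).charpoly = M.charpoly - C t * (charmatrix M).adjugate x y := by
  have h : charmatrix (M + t • single y x 1) =
      (charmatrix M).updateRow y (charmatrix M y + (-C t) • Pi.single x 1) := by
    ext1 i j
    by_cases hi : i = y
    · subst hi
      by_cases hj : j = x
      · subst hj; simp [charmatrix_apply]; ring
      · simp [charmatrix_apply, hj, Ne.symm hj]
    · simp [charmatrix_apply, hi, Ne.symm hi]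
  rw [Matrix.charpoly, h, det_updateRow_add, det_updateRow_smul, ← adjugate_apply]
  simp [Matrix.charpoly, sub_eq_add_neg]

/-- The complexification of a real matrix. -/
noncomputable abbrev complexify (A : Matrix V V ℝ) : Matrix V V ℂ := A.map (algebraMap ℝ ℂ)

theorem complexify_pow_apply (A : Matrix V V ℝ) (i : ℕ) (x y : V) :
    (complexify A ^ i) x y = ((A ^ i) x y : ℂ) := by
  rw [complexify, ← RingHom.mapMatrix_apply, ← map_pow]; rfl

/-- The matrix `H` is supported on the edges `F`; the edge from `i` to `j` is the entry `(j, i)`. -/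
def SupportedOn (F : V → V → Prop) (H : Matrix V V ℝ) : Prop := ∀ i j, ¬ F i j → H j i = 0

/-- No nonzero complex number is an eigenvalue of `A + H` for all real perturbations `H` supported
on the edges `F`. -/
def NoCommonEigenvalue (F : V → V → Prop) (A : Matrix V V ℝ) : Prop :=
  ∀ z : ℂ, z ≠ 0 → ∃ H, SupportedOn F H ∧ (complexify (A + H)).charpoly.eval z ≠ 0

omit [Fintype V] [DecidableEq V] in
theorem SupportedOn.zero (F : V → V → Prop) : SupportedOn F 0 := fun _ _ _ => rfl

/-- Adding an edge from `x` to `y` with almost any weight preserves the absence of a common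
nonzero eigenvalue, provided that either there are no walks from `y` to `x` in `A`, or some
perturbation changes the total weight of the walks of some length from `y` to `x`. -/
theorem finite_not_noCommonEigenvalue {F : V → V → Prop} {A : Matrix V V ℝ} {x y : V}
    (hA : NoCommonEigenvalue F A)
    (h : (∀ i, (A ^ i) x y = 0) ∨ ∃ H i, SupportedOn F H ∧ ((A + H) ^ i) x y ≠ (A ^ i) x y) :
    {t : ℝ | ¬ NoCommonEigenvalue F (A + t • single y x 1)}.Finite := by
  by_contra hinf
  set T := {t : ℝ | ¬ NoCommonEigenvalue F (A + t • single y x 1)} with hT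
  have hinf : T.Infinite := hinf
  have hex : ∀ t ∈ T, ∃ z : ℂ, z ≠ 0 ∧ ∀ H, SupportedOn F H →
      (complexify (A + H)).charpoly.eval z =
        t * ((charmatrix (complexify (A + H))).adjugate x y).eval z := by
    intro t ht
    simp only [hT, Set.mem_ofPred_eq, NoCommonEigenvalue, not_forall, not_exists, not_and,
      not_not] at ht
    obtain ⟨z, hz, hzH⟩ := ht
    refine ⟨z, hz, fun H hH => ?_⟩
    have h1 := hzH H hH
    have h2 : complexify (A + t • single y x 1 + H) =
        complexify (A + H) + (t : ℂ) • single y x 1 := by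
      ext i j
      by_cases hij : y = i ∧ x = j
      · obtain ⟨rfl, rfl⟩ := hij; simp; ring
      · simp [hij]
    rw [h2, charpoly_add_single, eval_sub, eval_mul, eval_C] at h1
    exact sub_eq_zero.1 h1
  choose! ζ hζ0 hζ using hex
  -- A root determines the weight, so that there are infinitely many roots.
  have hinj : Set.InjOn ζ T := by
    intro t ht t' ht' htt
    by_contra hne
    obtain ⟨H, hH, hHne⟩ := hA (ζ t) (hζ0 t ht)
    have e1 := hζ t ht H hH
    have e2 := hζ t' ht' H hH
    rw [← htt] at e2
    have e3 : ((t : ℂ) - t') * ((charmatrix (complexify (A + H))).adjugate x y).eval (ζ t) = 0 := by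
      linear_combination e2 - e1
    rcases mul_eq_zero.1 e3 with e | e
    · exact hne (by exact_mod_cast sub_eq_zero.1 e)
    · rw [e, mul_zero] at e1; exact hHne e1
  have hinf' : (ζ '' T).Infinite := hinf.image hinj
  have hid : ∀ H, SupportedOn F H → ∀ i, ((A + H) ^ i) x y = (A ^ i) x y := by
    intro H hH i
    have hpoly : (complexify (A + H)).charpoly * (charmatrix (complexify A)).adjugate x y =
        (complexify A).charpoly * (charmatrix (complexify (A + H))).adjugate x y := by
      refine eq_of_infinite_eval_eq _ _ (hinf'.mono ?_)
      rintro _ ⟨t, ht, rfl⟩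
      have e1 := hζ t ht H hH
      have e2 := hζ t ht 0 (SupportedOn.zero F)
      rw [add_zero] at e2
      simp only [Set.mem_ofPred_eq, eval_mul, e1, e2]
      ring
    have := pow_apply_eq_of_resolvent_eq hpoly i
    rw [complexify_pow_apply, complexify_pow_apply] at this
    exact_mod_cast this
  rcases h with h | ⟨H, i, hH, hne⟩
  -- Without walks from `y` to `x` the root does not depend on the weight, and is one of `A`.
  · obtain ⟨t, ht⟩ := hinf.nonempty
    obtain ⟨H, hH, hHne⟩ := hA (ζ t) (hζ0 t ht)
    apply hHne
    rw [hζ t ht H hH, adjugate_charmatrix_eq_zero, eval_zero, mul_zero]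
    intro i
    rw [complexify_pow_apply, hid H hH, h, Complex.ofReal_zero]
  · exact hne (hid H hH i)

end Eigenvalues

/-! ### Generic absence of common eigenvalues -/

section GenericEigenvalues

open Polynomial Matrix Relation

variable {V : Type} [Fintype V] [DecidableEq V]

/-- The absence of a common nonzero eigenvalue depends measurably on the matrix, so that a
result for almost all parameters can be obtained along lines. -/
theorem measurableSet_noCommonEigenvalue {P : Type} [TopologicalSpace P] [MeasurableSpace P]
    [OpensMeasurableSpace P] (F : V → V → Prop) {A : P → Matrix V V ℝ} (hA : Continuous A) :
    MeasurableSet {a | NoCommonEigenvalue F (A a)} := by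
  -- The complement is the union of the projections of closed sets along the compact annuli `K j`.
  let K : ℕ → Set ℂ := fun j => Metric.closedBall 0 j ∩ {z | 1 / ((j : ℝ) + 1) ≤ ‖z‖}
  have hK : ∀ j, IsCompact (K j) := fun j =>
    (isCompact_closedBall _ _).inter_right (isClosed_le continuous_const continuous_norm)
  let S : ∀ j, Set (P × K j) := fun j =>
    {q | ∀ H, SupportedOn F H → (complexify (A q.1 + H)).charpoly.eval (q.2 : ℂ) = 0}
  have hS : ∀ j, IsClosed (S j) := by
    intro j
    simp only [S, Set.ofPred_forall]
    refine isClosed_iInter fun H => isClosed_iInter fun _ => ?_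
    simp only [eval_charpoly]
    refine isClosed_eq (Continuous.matrix_det ?_) continuous_const
    refine Continuous.sub ?_ ?_
    · refine continuous_matrix fun i k => ?_
      simp only [scalar_apply, diagonal_apply]
      split_ifs
      · fun_prop
      · fun_prop
    · exact ((hA.comp continuous_fst).add continuous_const).matrix_map (by fun_prop)
  have hunion : {a | NoCommonEigenvalue F (A a)}ᶜ = ⋃ j, Prod.fst '' S j := by
    ext a
    simp only [Set.mem_compl_iff, Set.mem_ofPred_eq, NoCommonEigenvalue, not_forall, not_exists,
      not_and, not_not, Set.mem_iUnion, Set.mem_image, Prod.exists, exists_and_right,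
      exists_eq_right, S]
    constructor
    · rintro ⟨z, hz, h⟩
      obtain ⟨j, hj⟩ := exists_nat_ge (max ‖z‖ (1 / ‖z‖))
      have hz' : 0 < ‖z‖ := norm_pos_iff.2 hz
      refine ⟨j, ⟨z, ⟨by simpa using (le_max_left _ _).trans hj, ?_⟩⟩, h⟩
      have h2 : 1 / ‖z‖ ≤ (j : ℝ) + 1 := ((le_max_right _ _).trans hj).trans (by linarith)
      exact (one_div_le hz' (by positivity)).1 h2
    · rintro ⟨j, ⟨z, hz⟩, h⟩
      refine ⟨z, ?_, h⟩
      rintro rfl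
      have h1 : 1 / ((j : ℝ) + 1) ≤ ‖(0 : ℂ)‖ := hz.2
      rw [norm_zero] at h1
      exact absurd h1 (not_le.2 (by positivity))
  rw [← MeasurableSet.compl_iff, hunion]
  refine MeasurableSet.iUnion fun j => IsClosed.measurableSet ?_
  have : CompactSpace (K j) := isCompact_iff_compactSpace.1 (hK j)
  exact isClosedMap_fst_of_compactSpace _ (hS j)

/-- The realization of the pattern `PA` in which only the free parameters in `E` are used. -/
noncomputable def maskedRealize (PA : Matrix V V Bool) (E : Set {e : V × V // PA e.1 e.2 = true})
    (a : Params PA) : Matrix V V ℝ := by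
  classical exact realize PA fun e => if e ∈ E then a e else 0

omit [Fintype V] [DecidableEq V] in
theorem maskedRealize_univ (PA : Matrix V V Bool) (a : Params PA) :
    maskedRealize PA Set.univ a = realize PA a := by
  simp [maskedRealize]

omit [Fintype V] [DecidableEq V] in
theorem maskedRealize_apply (PA : Matrix V V Bool) (E : Set {e : V × V // PA e.1 e.2 = true})
    (a : Params PA) (i j : V) [Decidable (∃ h : PA i j = true, ⟨(i, j), h⟩ ∈ E)] :
    maskedRealize PA E a i j =
      if h : ∃ h : PA i j = true, ⟨(i, j), h⟩ ∈ E then a ⟨(i, j), h.1⟩ else 0 := by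
  by_cases h : PA i j = true
  · by_cases h' : (⟨(i, j), h⟩ : {e : V × V // PA e.1 e.2 = true}) ∈ E
    · simp [maskedRealize, realize, h, h']
    · simp [maskedRealize, realize, h, h']
  · simp [maskedRealize, realize, h]

omit [Fintype V] [DecidableEq V] in
theorem maskedRealize_add_smul (PA : Matrix V V Bool) (E : Set {e : V × V // PA e.1 e.2 = true})
    (a b : Params PA) (t : ℝ) :
    maskedRealize PA E (a + t • b) = maskedRealize PA E a + t • maskedRealize PA E b := by
  classical
  ext i j
  simp only [maskedRealize_apply, Matrix.add_apply, Matrix.smul_apply]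
  split_ifs <;> simp

omit [Fintype V] [DecidableEq V] in
theorem continuous_maskedRealize (PA : Matrix V V Bool)
    (E : Set {e : V × V // PA e.1 e.2 = true}) : Continuous (maskedRealize PA E) := by
  classical
  refine continuous_matrix fun i j => ?_
  simp only [maskedRealize_apply]
  split_ifs <;> fun_prop

omit [Fintype V] in
theorem maskedRealize_insert (PA : Matrix V V Bool) {E : Set {e : V × V // PA e.1 e.2 = true}}
    {e : {e : V × V // PA e.1 e.2 = true}} (he : e ∉ E) (a : Params PA) :
    maskedRealize PA (insert e E) a = maskedRealize PA E a + a e • single e.1.1 e.1.2 1 := by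
  classical
  ext i j
  obtain ⟨⟨y, x⟩, hyx⟩ := e
  by_cases h : y = i ∧ x = j
  · obtain ⟨rfl, rfl⟩ := h
    have h1 : PA y x = true := hyx
    simp [maskedRealize_apply, he, h1]
  · have h2 : ¬ (i = y ∧ j = x) := fun h' => h ⟨h'.1.symm, h'.2.symm⟩
    simp [maskedRealize_apply, h, h2]

/-- Almost all realizations of the free parameters in `E` have no common nonzero eigenvalue. -/
def GenericallyNoCommonEigenvalue (F : V → V → Prop) (PA : Matrix V V Bool)
    (E : Set {e : V × V // PA e.1 e.2 = true}) : Prop :=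
  ∀ᵐ a : Params PA, NoCommonEigenvalue F (maskedRealize PA E a)

theorem genericallyNoCommonEigenvalue_empty (F : V → V → Prop) (PA : Matrix V V Bool) :
    GenericallyNoCommonEigenvalue F PA ∅ := by
  classical
  refine Filter.Eventually.of_forall fun a z hz => ⟨0, SupportedOn.zero F, ?_⟩
  have : maskedRealize PA ∅ a = 0 := by ext i j; simp [maskedRealize_apply]
  simp [this, hz]

/-- A free parameter `e` can be switched on if almost always the walks through its edge behave as in
`finite_not_noCommonEigenvalue`: by Fubini's theorem it is enough to look at the lines along the
coordinate `e`. -/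
theorem GenericallyNoCommonEigenvalue.insert {F : V → V → Prop} {PA : Matrix V V Bool}
    {E : Set {e : V × V // PA e.1 e.2 = true}} (hE : GenericallyNoCommonEigenvalue F PA E)
    {e : {e : V × V // PA e.1 e.2 = true}} (he : e ∉ E)
    (h : ∀ᵐ a : Params PA, (∀ i, (maskedRealize PA E a ^ i) e.1.2 e.1.1 = 0) ∨
      ∃ H i, SupportedOn F H ∧ ((maskedRealize PA E a + H) ^ i) e.1.2 e.1.1 ≠
        (maskedRealize PA E a ^ i) e.1.2 e.1.1) :
    GenericallyNoCommonEigenvalue F PA (insert e E) := by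
  classical
  have hm := measurableSet_noCommonEigenvalue F (continuous_maskedRealize PA (Insert.insert e E))
  refine (ae_ae_add_linearMap_mem_iff
    (LinearMap.toSpanSingleton ℝ (Params PA) (Pi.single e 1)) volume volume hm).1 ?_
  filter_upwards [hE, h] with a ha ha'
  have hfin := finite_not_noCommonEigenvalue ha ha'
  rw [ae_iff]
  refine ((hfin.preimage (f := fun t => a e + t)
    (fun _ _ _ _ h => add_left_cancel h)).subset ?_).measure_zero _
  intro t ht
  have key : maskedRealize PA (Insert.insert e E) (a + t • Pi.single e 1) =
      maskedRealize PA E a + (a e + t) • single e.1.1 e.1.2 1 := by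
    rw [maskedRealize_insert PA he, maskedRealize_add_smul]
    have : maskedRealize PA E (Pi.single e 1) = 0 := by
      ext i j
      rw [maskedRealize_apply]
      split_ifs with h'
      · obtain ⟨h1, h2⟩ := h'
        rw [Pi.single_eq_of_ne (fun h3 => he (by rw [← h3]; exact h2))]; rfl
      · rfl
    simp [this]
  simpa [key] using ht

theorem exists_pow_pos_of_reflTransGen {R : V → V → Prop} {i j : V} (h : ReflTransGen R i j) :
    ∃ l, ∀ M : Matrix V V ℝ, (∀ i j, 0 ≤ M i j) → (∀ i j, R i j → 0 < M j i) →
      0 < (M ^ l) j i := by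
  have hpow : ∀ M : Matrix V V ℝ, (∀ i j, 0 ≤ M i j) → ∀ l i j, 0 ≤ (M ^ l) i j := by
    intro M hM l
    induction l with
    | zero => intro i j; rw [pow_zero, one_apply]; split_ifs <;> simp
    | succ l ih =>
      intro i j
      rw [pow_succ, mul_apply]
      exact Finset.sum_nonneg fun k _ => mul_nonneg (ih _ _) (hM _ _)
  induction h with
  | refl => exact ⟨0, by simp⟩
  | @tail j k _ hjk ih =>
    obtain ⟨l, hl⟩ := ih
    refine ⟨l + 1, fun M hM hR => ?_⟩
    rw [pow_succ', mul_apply]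
    exact (mul_pos (hR _ _ hjk) (hl M hM hR)).trans_le (Finset.single_le_sum
      (f := fun x => M k x * (M ^ l) x i) (fun x _ => mul_nonneg (hM _ _) (hpow M hM _ _ _))
      (Finset.mem_univ j))

/-- For nonnegative matrices, a walk through an edge of `H` makes the total weight of the walks of
its length strictly larger in `A + H` than in `A`. -/
theorem exists_pow_lt_add_pow {R : V → V → Prop} {s d x y : V} (hys : ReflTransGen R y s)
    (hdx : ReflTransGen R d x) :
    ∃ l, ∀ A H : Matrix V V ℝ, (∀ i j, 0 ≤ A i j) → (∀ i j, 0 ≤ H i j) → 0 < H d s →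
      (∀ i j, R i j → 0 < (A + H) j i) → (A ^ l) x y < ((A + H) ^ l) x y := by
  obtain ⟨l₁, h₁⟩ := exists_pow_pos_of_reflTransGen hys
  obtain ⟨l₂, h₂⟩ := exists_pow_pos_of_reflTransGen hdx
  refine ⟨l₂ + 1 + l₁, fun A H hA hH hsd hR => ?_⟩
  have hAH : ∀ i j, A i j ≤ (A + H) i j := fun i j => le_add_of_nonneg_right (hH i j)
  have hM : ∀ i j, 0 ≤ (A + H) i j := fun i j => (hA i j).trans (hAH i j)
  have mul_nn : ∀ {P Q : Matrix V V ℝ}, (∀ i j, 0 ≤ P i j) → (∀ i j, 0 ≤ Q i j) →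
      ∀ i j, 0 ≤ (P * Q) i j := fun hP hQ i j => by
    rw [mul_apply]; exact Finset.sum_nonneg fun k _ => mul_nonneg (hP _ _) (hQ _ _)
  have mul_mono : ∀ {P P' Q Q' : Matrix V V ℝ}, (∀ i j, P i j ≤ P' i j) →
      (∀ i j, Q i j ≤ Q' i j) → (∀ i j, 0 ≤ Q i j) → (∀ i j, 0 ≤ P' i j) →
      ∀ i j, (P * Q) i j ≤ (P' * Q') i j := fun h1 h2 h3 h4 i j => by
    rw [mul_apply, mul_apply]
    exact Finset.sum_le_sum fun k _ => mul_le_mul (h1 _ _) (h2 _ _) (h3 _ _) (h4 _ _)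
  have pow_nn : ∀ {P : Matrix V V ℝ}, (∀ i j, 0 ≤ P i j) → ∀ l i j, 0 ≤ (P ^ l) i j := by
    intro P hP l
    induction l with
    | zero => intro i j; rw [pow_zero, one_apply]; split_ifs <;> simp
    | succ l ih => rw [pow_succ]; exact mul_nn ih hP
  have pow_mono : ∀ l i j, (A ^ l) i j ≤ ((A + H) ^ l) i j := by
    intro l
    induction l with
    | zero => intro i j; simp
    | succ l ih => rw [pow_succ, pow_succ]; exact mul_mono ih hAH hA (pow_nn hM l)
  replace h₁ := h₁ _ hM hR
  replace h₂ := h₂ _ hM hR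
  rw [pow_add, pow_add (A + H), pow_succ, pow_succ (A + H), mul_add, add_mul, Matrix.add_apply]
  have e1 := mul_mono (mul_mono (pow_mono l₂) (fun i j => le_refl (A i j)) hA (pow_nn hM l₂))
    (pow_mono l₁) (pow_nn hA l₁) (mul_nn (pow_nn hM l₂) hA) x y
  have e2 : 0 < ((A + H) ^ l₂ * H * (A + H) ^ l₁) x y := by
    have e3 : 0 < ((A + H) ^ l₂ * H) x s := by
      rw [mul_apply]
      exact (mul_pos h₂ hsd).trans_le (Finset.single_le_sum
        (f := fun k => ((A + H) ^ l₂) x k * H k s)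
        (fun k _ => mul_nonneg (pow_nn hM _ _ _) (hH _ _)) (Finset.mem_univ d))
    rw [mul_apply]
    exact (mul_pos e3 h₁).trans_le (Finset.single_le_sum
      (f := fun k => ((A + H) ^ l₂ * H) x k * ((A + H) ^ l₁) k y)
      (fun k _ => mul_nonneg (mul_nn (pow_nn hM _) hH _ _) (pow_nn hM _ _ _))
      (Finset.mem_univ s))
  linarith

theorem exists_polynomial_pow_apply (A B : Matrix V V ℝ) (l : ℕ) (x y : V) :
    ∃ q : ℝ[X], ∀ t : ℝ, q.eval t = ((A + t • B) ^ l) x y := by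
  refine ⟨((A.map C + (X : ℝ[X]) • B.map C) ^ l) x y, fun t => ?_⟩
  have h : (evalRingHom t).mapMatrix (A.map C + (X : ℝ[X]) • B.map C) = A + t • B := by
    ext i j
    simp only [RingHom.mapMatrix_apply, Matrix.map_apply, Matrix.add_apply, Matrix.smul_apply,
      smul_eq_mul, coe_evalRingHom, eval_add, eval_C, eval_mul, eval_X]
  rw [← h, ← map_pow]; rfl

/-- A continuous function that is polynomial along the lines in the direction `1`, and nonzero on
the positive orthant, vanishes almost nowhere: every such line meets the positive orthant. -/
theorem ae_ne_zero_of_pos {ι : Type} [Fintype ι] {p : (ι → ℝ) → ℝ} (hp : Continuous p)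
    (hpoly : ∀ a, ∃ q : ℝ[X], ∀ t : ℝ, q.eval t = p (a + t • 1))
    (hpos : ∀ a, (∀ e, 0 < a e) → p a ≠ 0) : ∀ᵐ a, p a ≠ 0 := by
  refine ae_mem_of_ae_add_linearMap_mem (s := {a | p a ≠ 0})
    (LinearMap.toSpanSingleton ℝ (ι → ℝ) 1) volume volume
    (isOpen_ne_fun hp continuous_const).measurableSet fun a => ?_
  obtain ⟨q, hq⟩ := hpoly a
  have hq0 : q ≠ 0 := by
    rintro rfl
    refine hpos (a + (1 + ∑ e, |a e|) • 1) (fun e => ?_) (by rw [← hq, eval_zero])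
    have h1 := Finset.single_le_sum (f := fun e => |a e|) (fun e _ => abs_nonneg _)
      (Finset.mem_univ e)
    have h2 := neg_abs_le (a e)
    simp only [Pi.add_apply, Pi.smul_apply, Pi.one_apply, smul_eq_mul, mul_one]
    linarith
  rw [ae_iff]
  refine (q.rootSet_finite ℝ).subset (fun t ht => ?_) |>.measure_zero _
  rw [mem_rootSet]
  refine ⟨hq0, ?_⟩
  simpa [hq] using ht

/-- The edges available to walks: the edges of the free parameters in `E` and those of `F`. -/
def loopEdge (F : V → V → Prop) (PA : Matrix V V Bool)
    (E : Set {e : V × V // PA e.1 e.2 = true}) (i j : V) : Prop :=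
  (∃ h, (⟨(j, i), h⟩ : {e : V × V // PA e.1 e.2 = true}) ∈ E) ∨ F i j

/-- If a closed walk through the edge from `x` to `y` can use the edge from `s` to `d` in `F`, then
almost always some perturbation changes the total weight of the walks of some length from `y` to
`x`: for positive parameters, a positive perturbation increases it. -/
theorem ae_exists_pow_ne {F : V → V → Prop} {PA : Matrix V V Bool}
    {E : Set {e : V × V // PA e.1 e.2 = true}} {s d x y : V} (hsd : F s d)
    (hys : ReflTransGen (loopEdge F PA E) y s) (hdx : ReflTransGen (loopEdge F PA E) d x) :
    ∀ᵐ a : Params PA, ∃ H i, SupportedOn F H ∧ ((maskedRealize PA E a + H) ^ i) x y ≠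
        (maskedRealize PA E a ^ i) x y := by
  classical
  let H : Matrix V V ℝ := of fun j i => if F i j then 1 else 0
  have hHF : SupportedOn F H := fun i j h => by simp [H, h]
  have hH0 : ∀ i j, 0 ≤ H i j := fun i j => by simp only [H, of_apply]; split_ifs <;> simp
  have hpos : ∀ a : Params PA, (∀ e, 0 < a e) → ∀ i j,
      0 ≤ maskedRealize PA E a i j := fun a ha i j => by
    rw [maskedRealize_apply]; split_ifs; exacts [(ha _).le, le_rfl]
  have hedge : ∀ a : Params PA, (∀ e, 0 < a e) → ∀ i j, loopEdge F PA E i j →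
      0 < (maskedRealize PA E a + H) j i := by
    intro a ha i j hij
    rcases hij with hij | hij
    · refine add_pos_of_pos_of_nonneg ?_ (hH0 _ _)
      rw [maskedRealize_apply, dif_pos hij]; exact ha _
    · exact add_pos_of_nonneg_of_pos (hpos a ha _ _) (by simp [H, hij])
  obtain ⟨l, hl⟩ := exists_pow_lt_add_pow hys hdx
  have hcont : Continuous fun a : Params PA =>
      ((maskedRealize PA E a + H) ^ l) x y - (maskedRealize PA E a ^ l) x y := by
    have h1 := continuous_maskedRealize PA E
    exact (((h1.add continuous_const).pow l).matrix_elem x y).sub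
      ((h1.pow l).matrix_elem x y)
  refine (ae_ne_zero_of_pos hcont (fun a => ?_) fun a ha => ?_).mono fun a ha =>
    ⟨H, l, hHF, sub_ne_zero.1 ha⟩
  · obtain ⟨q, hq⟩ := exists_polynomial_pow_apply (maskedRealize PA E a + H)
      (maskedRealize PA E 1) l x y
    obtain ⟨q', hq'⟩ := exists_polynomial_pow_apply (maskedRealize PA E a)
      (maskedRealize PA E 1) l x y
    refine ⟨q - q', fun t => ?_⟩
    rw [eval_sub, hq, hq', maskedRealize_add_smul, add_right_comm]
  · exact (sub_pos.2 (hl _ H (hpos a ha) hH0 (by simp [H, hsd]) (hedge a ha))).ne'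

omit [Fintype V] [DecidableEq V] in
theorem exists_edge_leaving {R : V → V → Prop} {S : V → Prop} {i j : V} (h : ReflTransGen R i j)
    (hi : S i) (hj : ¬ S j) : ∃ a b, S a ∧ ¬ S b ∧ R a b := by
  induction h with
  | refl => exact absurd hi hj
  | @tail b c _ hbc ih =>
    by_cases hb : S b
    · exact ⟨b, c, hb, hj, hbc⟩
    · exact ih hb

omit [Fintype V] [DecidableEq V] in
theorem loopEdge_mono (F : V → V → Prop) (PA : Matrix V V Bool)
    {E E' : Set {e : V × V // PA e.1 e.2 = true}} (h : E ⊆ E') {i j : V}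
    (hij : ReflTransGen (loopEdge F PA E) i j) : ReflTransGen (loopEdge F PA E') i j :=
  ReflTransGen.mono (fun _ _ h' => Or.imp_left (fun ⟨p, hp⟩ => ⟨p, h hp⟩) h') _ _ hij

theorem pow_apply_eq_zero_of_col {A : Matrix V V ℝ} {x y : V} (hxy : x ≠ y)
    (h : ∀ i, A i y = 0) (l : ℕ) : (A ^ l) x y = 0 := by
  cases l with
  | zero => simp [hxy]
  | succ l => rw [pow_succ, mul_apply]; simp [h]

/-- If the edges of `PA` and `F` form a strongly connected digraph that uses some edge of `F`, then
almost no realization of `PA` has a nonzero eigenvalue that all perturbations supported on `F`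
preserve. -/
theorem ae_noCommonEigenvalue {F : V → V → Prop} {PA : Matrix V V Bool} {s d : V} (hsd : F s d)
    (hd : ∀ x, ReflTransGen (fun i j => PA j i = true ∨ F i j) d x)
    (hs : ∀ x, ReflTransGen (fun i j => PA j i = true ∨ F i j) x s) :
    ∀ᵐ a : Params PA, NoCommonEigenvalue F (realize PA a) := by
  classical
  let V₀ := fun E : Set {e : V × V // PA e.1 e.2 = true} =>
    fun x => ReflTransGen (loopEdge F PA E) d x
  -- The free parameters are switched on one by one, beginning with edges that enter a vertex which
  -- `d` does not reach yet: such a vertex has no outgoing edges in `E₁`, hence no walk of positive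
  -- length starts there.
  obtain ⟨E₁, ⟨hE₁, hout⟩, hmax₁⟩ := (Set.toFinite {E : Set {e : V × V // PA e.1 e.2 = true} |
      GenericallyNoCommonEigenvalue F PA E ∧ ∀ e ∈ E, V₀ E e.1.2}).exists_maximal
    ⟨∅, genericallyNoCommonEigenvalue_empty F PA, by simp⟩
  have hreach : ∀ x, V₀ E₁ x := by
    by_contra! hx
    obtain ⟨x, hx⟩ := hx
    obtain ⟨a, b, ha, hb, hab⟩ := exists_edge_leaving (S := V₀ E₁) (hd x) .refl hx
    have hF : ¬ F a b := fun h => hb (ha.tail (Or.inr h))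
    have hPA : PA b a = true := hab.resolve_right hF
    let e : {e : V × V // PA e.1 e.2 = true} := ⟨(b, a), hPA⟩
    have he : e ∉ E₁ := fun h => hb (ha.tail (Or.inl ⟨hPA, h⟩))
    have hab' : a ≠ b := by rintro rfl; exact hb ha
    have hnew : GenericallyNoCommonEigenvalue F PA (insert e E₁) := by
      refine hE₁.insert he (Filter.Eventually.of_forall fun p => Or.inl fun l => ?_)
      refine pow_apply_eq_zero_of_col hab' (fun i => ?_) l
      rw [maskedRealize_apply, dif_neg]
      rintro ⟨h, h'⟩
      exact hb (hout _ h')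
    refine he (hmax₁ ⟨hnew, ?_⟩ (Set.subset_insert e E₁) (Set.mem_insert e E₁))
    rintro e' (rfl | he')
    · exact loopEdge_mono F PA (Set.subset_insert _ _) ha
    · exact loopEdge_mono F PA (Set.subset_insert _ _) (hout _ he')
  -- As soon as `d` reaches all vertices, every edge into a vertex that reaches `s` lies on a closed
  -- walk through the edge from `s` to `d`, and can be added too.
  obtain ⟨E₂, ⟨hE₂, hreach₂⟩, hmax₂⟩ := (Set.toFinite
      {E : Set {e : V × V // PA e.1 e.2 = true} |
      GenericallyNoCommonEigenvalue F PA E ∧ ∀ x, V₀ E x}).exists_maximal ⟨E₁, hE₁, hreach⟩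
  have hadd : ∀ e ∉ E₂, ¬ ReflTransGen (loopEdge F PA E₂) e.1.1 s := by
    intro e he hes
    exact he (hmax₂ ⟨hE₂.insert he ((ae_exists_pow_ne hsd hes (hreach₂ _)).mono fun _ => Or.inr),
      fun x => loopEdge_mono F PA (Set.subset_insert _ _) (hreach₂ x)⟩
      (Set.subset_insert e E₂) (Set.mem_insert e E₂))
  have hall : ∀ x, ReflTransGen (loopEdge F PA E₂) x s := by
    by_contra! hx
    obtain ⟨x, hx⟩ := hx
    obtain ⟨a, b, ha, hb, hab⟩ := exists_edge_leaving
      (S := fun v => ¬ ReflTransGen (loopEdge F PA E₂) v s) (hs x) hx (fun h => h .refl)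
    rw [not_not] at hb
    have hF : ¬ F a b := fun h => ha (.head (Or.inr h) hb)
    have hPA : PA b a = true := hab.resolve_right hF
    by_cases he : (⟨(b, a), hPA⟩ : {e : V × V // PA e.1 e.2 = true}) ∈ E₂
    · exact ha (.head (Or.inl ⟨hPA, he⟩) hb)
    · exact hadd _ he hb
  have huniv : E₂ = Set.univ := Set.eq_univ_of_forall fun e => by
    by_contra he
    exact hadd e he (hall _)
  rw [huniv] at hE₂
  simpa only [GenericallyNoCommonEigenvalue, maskedRealize_univ] using hE₂

end GenericEigenvalues

/-! ### Closed loops -/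

section ClosedLoop

open Matrix Relation

theorem realize_apply_of_ne {R S : Type} {P : Matrix R S Bool} (q : Params P) {r : R} {s : S}
    (h : P r s ≠ true) : realize P q r s = 0 := by
  simp [realize, h]

theorem realize_apply_of_eq {R S : Type} {P : Matrix R S Bool} (q : Params P) {r : R} {s : S}
    (h : P r s = true) : realize P q r s = q ⟨(r, s), h⟩ := by
  simp [realize, h]

theorem exists_realize_eq {R S : Type} {P : Matrix R S Bool} {M : Matrix R S ℝ}
    (h : ∀ r s, P r s ≠ true → M r s = 0) : ∃ q : Params P, realize P q = M := by
  refine ⟨fun e => M e.1.1 e.1.2, ?_⟩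
  ext r s
  by_cases hrs : P r s = true
  · rw [realize_apply_of_eq _ hrs]
  · rw [realize_apply_of_ne _ hrs, h r s hrs]

/-- A path from `i` to `j` in the state digraph. -/
abbrev StateReaches {X : Type} (PA : Matrix X X Bool) : X → X → Prop :=
  ReflTransGen fun i j => PA j i = true

/-- The edges between states that feedback through the links `L` creates when the links `F` have
failed. -/
def linkEdge {X U Y : Type} (act : U → X) (sens : Y → X) (L F : Set (Y × U)) (i j : X) : Prop :=
  ∃ y u, (y, u) ∈ L ∧ (y, u) ∉ F ∧ sens y = i ∧ act u = j

theorem ae_forall_ne_zero {R S : Type} [Fintype R] [Fintype S] (P : Matrix R S Bool) :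
    ∀ᵐ q : Params P, ∀ e, q e ≠ 0 := by
  rw [ae_all_iff]
  refine fun e => ae_ne_zero_of_pos (by fun_prop) (fun a => ⟨.C (a e) + .X, fun t => ?_⟩)
    fun a ha => (ha e).ne'
  simp

/-- If all dedicated actuators and sensors have nonzero weights, then the matrices `B K C` for
compatible gains `K` are all the matrices supported on the feedback edges. -/
theorem exists_gain_eq {X U Y : Type} [Fintype X] [DecidableEq X] [Fintype U] [Fintype Y]
    {act : U → X} {sens : Y → X} {L F : Set (Y × U)}
    {b : Params (inputPattern act)} {c : Params (outputPattern sens)}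
    (hb : ∀ e, b e ≠ 0) (hc : ∀ e, c e ≠ 0) {H : Matrix X X ℝ}
    (hH : SupportedOn (linkEdge act sens L F) H) :
    ∃ K ∈ gains L F, realize _ b * K * realize _ c = H := by
  classical
  have hbu : ∀ u, realize _ b (act u) u ≠ 0 := fun u => by
    rw [realize_apply_of_eq _ (by simp [inputPattern])]; exact hb _
  have hcy : ∀ y, realize _ c y (sens y) ≠ 0 := fun y => by
    rw [realize_apply_of_eq _ (by simp [outputPattern])]; exact hc _
  have hB : ∀ j u, act u ≠ j → realize _ b j u = 0 := fun j u h =>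
    realize_apply_of_ne _ (by simp [inputPattern, h])
  have hC : ∀ y i, sens y ≠ i → realize _ c y i = 0 := fun y i h =>
    realize_apply_of_ne _ (by simp [outputPattern, h])
  -- One link is chosen for every feedback edge.
  have hsel : ∀ i j, ∃ o : Option (Y × U), (¬ linkEdge act sens L F i j ∧ o = none) ∨
      ∃ y u, o = some (y, u) ∧ (y, u) ∈ L ∧ (y, u) ∉ F ∧ sens y = i ∧ act u = j := by
    intro i j
    by_cases h : linkEdge act sens L F i j
    · obtain ⟨y, u, h'⟩ := h
      exact ⟨some (y, u), Or.inr ⟨y, u, rfl, h'⟩⟩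
    · exact ⟨none, Or.inl ⟨h, rfl⟩⟩
  choose o ho using hsel
  let K : Matrix U Y ℝ := of fun u' y' =>
    if o (sens y') (act u') = some (y', u')
    then H (act u') (sens y') / (realize _ b (act u') u' * realize _ c y' (sens y')) else 0
  refine ⟨K, fun u' y' h => ?_, ?_⟩
  · simp only [K, of_apply]
    refine if_neg fun h1 => ?_
    rcases ho (sens y') (act u') with ⟨_, h2⟩ | ⟨y, u, h2, hL, hF, _⟩
    · simp [h2] at h1
    · rw [h1, Option.some.injEq, Prod.mk.injEq] at h2
      rw [← h2.1, ← h2.2] at hL hF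
      exact h.elim (fun h => h hL) hF
  · ext j i
    simp only [mul_apply]
    rcases ho i j with ⟨hij, h2⟩ | ⟨y, u, h2, -, -, rfl, rfl⟩
    · rw [hH _ _ hij]
      refine Finset.sum_eq_zero fun y' _ => ?_
      by_cases hy' : sens y' = i
      · refine mul_eq_zero_of_left (Finset.sum_eq_zero fun u' _ => ?_) _
        by_cases hu' : act u' = j
        · simp [K, hy', hu', h2]
        · simp [hB _ _ hu']
      · simp [hC _ _ hy']
    · rw [Finset.sum_eq_single y, Finset.sum_eq_single u]
      · have e3 := hbu u
        have e4 := hcy y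
        simp only [K, of_apply, h2, if_true]
        field_simp
      · intro u' _ hne
        by_cases hu' : act u' = act u
        · simp [K, hu', h2, hne.symm]
        · simp [hB _ _ hu']
      · simp
      · intro y' _ hne
        by_cases hy' : sens y' = sens y
        · refine mul_eq_zero_of_left (Finset.sum_eq_zero fun u' _ => ?_) _
          by_cases hu' : act u' = act u
          · simp [K, hy', hu', h2, hne.symm]
          · simp [hB _ _ hu']
        · simp [hC _ _ hy']
      · simp

/-- Resilient fixed modes are the eigenvalues common to all perturbations `B K C`, and these are all
the perturbations supported on the edges that the surviving links create. -/
theorem almostNever_of_ae_noCommonEigenvalue {X U Y : Type} [Fintype X] [DecidableEq X]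
    [Fintype U] [Fintype Y] {PA : Matrix X X Bool} {act : U → X} {sens : Y → X}
    {L F : Set (Y × U)}
    (h : ∀ᵐ a : Params PA, NoCommonEigenvalue (linkEdge act sens L F) (realize PA a)) :
    AlmostNeverHasUnstableResilientFixedModes PA (inputPattern act) (outputPattern sens) L
      (fun _ : Unit => F) := by
  have h1 : ∀ᵐ q : Params PA × Params (inputPattern act) × Params (outputPattern sens),
      NoCommonEigenvalue (linkEdge act sens L F) (realize PA q.1) :=
    Measure.quasiMeasurePreserving_fst.ae h
  have h2 : ∀ᵐ q : Params PA × Params (inputPattern act) × Params (outputPattern sens),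
      ∀ e, q.2.1 e ≠ 0 := Measure.quasiMeasurePreserving_snd.ae
        (Measure.quasiMeasurePreserving_fst.ae (ae_forall_ne_zero _))
  have h3 : ∀ᵐ q : Params PA × Params (inputPattern act) × Params (outputPattern sens),
      ∀ e, q.2.2 e ≠ 0 := Measure.quasiMeasurePreserving_snd.ae
        (Measure.quasiMeasurePreserving_snd.ae (ae_forall_ne_zero _))
  filter_upwards [h1, h2, h3] with q hq1 hq2 hq3 z hz
  by_contra hz0
  obtain ⟨H, hH, hne⟩ := hq1 z hz0
  obtain ⟨K, hK, hKH⟩ := exists_gain_eq hq2 hq3 hH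
  simp only [resilientFixedModes, Set.mem_iUnion, Set.mem_iInter] at hz
  obtain ⟨_, hz⟩ := hz
  have := hz K hK
  rw [hKH, mem_spectrum_iff_isRoot_charpoly] at this
  exact hne this

/-- The edges of the closed loop between the states. -/
def closedLoopEdge {X U Y : Type} (PA : Matrix X X Bool) (act : U → X) (sens : Y → X)
    (K : Finset (Y × U)) (i j : X) : Prop :=
  PA j i = true ∨ ∃ e ∈ K, sens e.1 = i ∧ act e.2 = j

/-- There is a feedback link, and the closed loop is strongly connected. -/
def ClosedLoopConnected {X U Y : Type} (PA : Matrix X X Bool) (act : U → X) (sens : Y → X)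
    (K : Finset (Y × U)) : Prop :=
  (∃ e, e ∈ K) ∧ ∀ x y, ReflTransGen (closedLoopEdge PA act sens K) x y

/-- The links along a cyclic sequence of pairs of an actuator and a sensor that it reaches make the
closed loop strongly connected, if every other actuator receives some link and reaches a sensor of
the sequence, and every other sensor sends some link and is reached by an actuator of the
sequence. -/
theorem closedLoopConnected_of_cycle {X U Y : Type} {PA : Matrix X X Bool} {act : U → X}
    {sens : Y → X} {K : Finset (Y × U)} {r : ℕ} (u : Fin (r + 1) → U) (y : Fin (r + 1) → Y)
    (hact : ∀ x, ∃ u, StateReaches PA (act u) x) (hsens : ∀ x, ∃ y, StateReaches PA x (sens y))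
    (huy : ∀ l, StateReaches PA (act (u l)) (sens (y l)))
    (hlink : ∀ l, (y l, u (l + 1)) ∈ K)
    (hu : ∀ v, v ∉ Set.range u → (∃ l, StateReaches PA (act v) (sens (y l))) ∧ ∃ w, (w, v) ∈ K)
    (hy : ∀ w, w ∉ Set.range y → (∃ l, StateReaches PA (act (u l)) (sens w)) ∧ ∃ v, (w, v) ∈ K) :
    ClosedLoopConnected PA act sens K := by
  refine ⟨⟨_, hlink 0⟩, ?_⟩
  set G := ReflTransGen (closedLoopEdge PA act sens K) with hG
  have lift : ∀ {a b}, StateReaches PA a b → G a b := fun h =>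
    ReflTransGen.mono (fun _ _ h' => Or.inl h') _ _ h
  have link : ∀ {w v}, (w, v) ∈ K → G (sens w) (act v) := fun h =>
    .single (Or.inr ⟨_, h, rfl, rfl⟩)
  have hstep : ∀ l, G (act (u l)) (act (u (l + 1))) := fun l =>
    (lift (huy l)).trans (link (hlink l))
  have hfrom : ∀ l, G (act (u 0)) (act (u l)) := by
    intro l
    induction l using Fin.induction with
    | zero => exact .refl
    | succ l ih => rw [← Fin.coeSucc_eq_succ]; exact ih.trans (hstep _)
  have hto : ∀ l, G (act (u l)) (act (u 0)) := by
    intro l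
    induction l using Fin.reverseInduction with
    | last => have := hstep (Fin.last r); rwa [Fin.last_add_one] at this
    | cast l ih => have := hstep l.castSucc; rw [Fin.coeSucc_eq_succ] at this; exact this.trans ih
  have hyto : ∀ l, G (sens (y l)) (act (u 0)) := fun l => (link (hlink l)).trans (hto _)
  have huto : ∀ v, G (act v) (act (u 0)) := by
    intro v
    by_cases hv : v ∈ Set.range u
    · obtain ⟨l, rfl⟩ := hv; exact hto l
    · obtain ⟨l, hl⟩ := (hu v hv).1
      exact (lift hl).trans (hyto l)
  have hsto : ∀ w, G (sens w) (act (u 0)) := by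
    intro w
    by_cases hw : w ∈ Set.range y
    · obtain ⟨l, rfl⟩ := hw; exact hyto l
    · obtain ⟨v, hv⟩ := (hy w hw).2
      exact (link hv).trans (huto v)
  have hfroms : ∀ w, G (act (u 0)) (sens w) := by
    intro w
    by_cases hw : w ∈ Set.range y
    · obtain ⟨l, rfl⟩ := hw; exact (hfrom l).trans (lift (huy l))
    · obtain ⟨l, hl⟩ := (hy w hw).1
      exact (hfrom l).trans (lift hl)
  have hfromu : ∀ v, G (act (u 0)) (act v) := by
    intro v
    by_cases hv : v ∈ Set.range u
    · obtain ⟨l, rfl⟩ := hv; exact hfrom l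
    · obtain ⟨w, hw⟩ := (hu v hv).2
      exact (hfroms w).trans (link hw)
  intro a b
  obtain ⟨w, hw⟩ := hsens a
  obtain ⟨v, hv⟩ := hact b
  exact (lift hw).trans ((hsto w).trans ((hfromu v).trans (lift hv)))

/-- At most `k` failures leave one of the `k + 1` blocks intact, and the links of that block alone
make the closed loop strongly connected. -/
theorem unionDesign_genericallyFeasible {n k p m : ℕ} {PA : Matrix (Fin n) (Fin n) Bool}
    {act : Fin ((k + 1) * p) → Fin n} {sens : Fin ((k + 1) * m) → Fin n}
    {K : Fin (k + 1) → Finset (Fin m × Fin p)}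
    (h : 0 < n → ∀ i, ClosedLoopConnected PA (block act i) (block sens i) (K i)) :
    (unionDesign act sens K).GenericallyFeasible PA k := by
  intro J hJ JB JC hcard
  rcases Nat.eq_zero_or_pos n with rfl | hn
  -- Without states there are no eigenvalues.
  · refine Filter.Eventually.of_forall fun q z hz => ?_
    simp only [resilientFixedModes, Set.mem_iUnion, Set.mem_iInter] at hz
    obtain ⟨_, hz⟩ := hz
    have := hz 0 (fun _ _ _ => rfl)
    rw [mem_spectrum_iff_isRoot_charpoly] at this
    simp [Matrix.charpoly] at this
  change J.card + Finset.card (α := Fin ((k + 1) * p)) JB +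
    Finset.card (α := Fin ((k + 1) * m)) JC ≤ k at hcard
  obtain ⟨i, hi⟩ : ∃ i : Fin (k + 1), i ∉
      (J.image fun e => (finProdFinEquiv.symm (e.1 : Fin ((k + 1) * m))).1) ∪
      (Finset.image (α := Fin ((k + 1) * p)) (fun u => (finProdFinEquiv.symm u).1) JB) ∪
      (Finset.image (α := Fin ((k + 1) * m)) (fun y => (finProdFinEquiv.symm y).1) JC) := by
    by_contra! hall
    have h1 := Finset.card_le_card (fun i (_ : i ∈ Finset.univ) => hall i)
    have h2 := (Finset.card_union_le _ _).trans (Nat.add_le_add_right (Finset.card_union_le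
      (J.image fun e => (finProdFinEquiv.symm (e.1 : Fin ((k + 1) * m))).1)
      (Finset.image (α := Fin ((k + 1) * p)) (fun u => (finProdFinEquiv.symm u).1) JB))
      (Finset.image (α := Fin ((k + 1) * m)) (fun y => (finProdFinEquiv.symm y).1) JC).card)
    have h3 := Finset.card_image_le (s := J)
      (f := fun e => (finProdFinEquiv.symm (e.1 : Fin ((k + 1) * m))).1)
    have h4 := Finset.card_image_le (α := Fin ((k + 1) * p)) (s := JB)
      (f := fun u => (finProdFinEquiv.symm u).1)
    have h5 := Finset.card_image_le (α := Fin ((k + 1) * m)) (s := JC)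
      (f := fun y => (finProdFinEquiv.symm y).1)
    rw [Finset.card_univ, Fintype.card_fin] at h1
    omega
  simp only [Finset.mem_union, not_or, Finset.mem_image] at hi
  obtain ⟨⟨hiJ, hiB⟩, hiC⟩ := hi
  obtain ⟨⟨e₀, he₀⟩, hconn⟩ := h hn i
  have hlink : ∀ e ∈ K i, linkEdge
      (fun u : {u // u ∉ JB} => (unionDesign act sens K).act u)
      (fun y : {y // y ∉ JC} => (unionDesign act sens K).sens y)
      {e | (e.1.1, e.2.1) ∈ (unionDesign act sens K).links} {e | (e.1.1, e.2.1) ∈ J}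
      (block sens i e.1) (block act i e.2) := by
    intro e he
    refine ⟨⟨finProdFinEquiv (i, e.1), fun h' => hiC (Finset.mem_image.2 ⟨_, h', by simp⟩)⟩,
      ⟨finProdFinEquiv (i, e.2), fun h' => hiB (Finset.mem_image.2 ⟨_, h', by simp⟩)⟩, ?_,
      fun h' => hiJ ⟨_, h', by simp⟩, rfl, rfl⟩
    exact Finset.mem_biUnion.2 ⟨i, Finset.mem_univ _, Finset.mem_image.2 ⟨e, he, rfl⟩⟩
  refine almostNever_of_ae_noCommonEigenvalue
    (ae_noCommonEigenvalue (hlink e₀ he₀) (fun x => ?_) fun x => ?_)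
  all_goals
    refine ReflTransGen.mono (fun a b hab => ?_) _ _ (hconn _ _)
    rcases hab with hab | ⟨e, he, rfl, rfl⟩
    · exact Or.inl hab
    · exact Or.inr (hlink e he)

end ClosedLoop

/-! ### Reachability and pairing patterns -/

section Pairing

open Matrix Relation

/-- The rank condition says that only the zero covector annihilates the controllability matrix. -/
theorem controllable_iff {X U : Type} [Fintype X] [DecidableEq X] [Fintype U]
    (A : Matrix X X ℝ) (B : Matrix X U ℝ) :
    Controllable A B ↔ ∀ w : X → ℝ, (∀ l < Fintype.card X, w ᵥ* (A ^ l * B) = 0) → w = 0 := by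
  let M : Matrix X (Fin (Fintype.card X) × U) ℝ := of fun x ju => (A ^ (ju.1 : ℕ) * B) x ju.2
  have h1 : Controllable A B ↔ LinearIndependent ℝ M.row := by
    constructor
    · intro h
      rw [linearIndependent_iff_card_eq_finrank_span, Set.finrank, ← rank_eq_finrank_span_row]
      exact h.symm
    · exact fun h => h.rank_matrix
  have h2 : ∀ w : X → ℝ, w ᵥ* M = 0 ↔ ∀ l < Fintype.card X, w ᵥ* (A ^ l * B) = 0 := by
    intro w
    constructor
    · intro h l hl
      ext u
      exact congrFun h (⟨l, hl⟩, u)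
    · intro h
      ext ⟨l, u⟩
      exact congrFun (h l l.2) u
  rw [h1, ← vecMul_injective_iff]
  constructor
  · intro h w hw
    exact h (by simpa using (h2 w).2 hw)
  · intro h
    exact (injective_iff_map_eq_zero (vecMulLinear M)).2 fun w hw => h w ((h2 w).1 hw)

theorem observable_iff_controllable_transpose {X Y : Type} [Fintype X] [DecidableEq X] [Fintype Y]
    (A : Matrix X X ℝ) (C : Matrix Y X ℝ) : Observable A C ↔ Controllable Aᵀ Cᵀ := by
  have : (of fun (x : X) (ju : Fin (Fintype.card X) × Y) => (Aᵀ ^ (ju.1 : ℕ) * Cᵀ) x ju.2) =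
      (of fun (jy : Fin (Fintype.card X) × Y) (x : X) => (C * A ^ (jy.1 : ℕ)) jy.2 x)ᵀ := by
    ext x ⟨j, y⟩
    simp [← transpose_pow, ← transpose_mul]
  rw [Observable, Controllable, this, rank_transpose]

theorem exists_realize_transpose {R S : Type} {P : Matrix R S Bool} (q : Params P) :
    ∃ q' : Params Pᵀ, realize Pᵀ q' = (realize P q)ᵀ :=
  exists_realize_eq fun _ _ h => realize_apply_of_ne q h

/-- Sensors become actuators when all edges are reversed. -/
theorem structurallyObservable_iff {X Y : Type} [Fintype X] [DecidableEq X] [Fintype Y]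
    (PA : Matrix X X Bool) (sens : Y → X) :
    StructurallyObservable PA (outputPattern sens) ↔
      StructurallyControllable PAᵀ (inputPattern sens) := by
  have hT : (outputPattern sens)ᵀ = inputPattern sens := rfl
  constructor
  · rintro ⟨a, c, h⟩
    obtain ⟨a', ha'⟩ := exists_realize_transpose a
    obtain ⟨c', hc'⟩ := exists_realize_transpose c
    refine ⟨a', c', ?_⟩
    change Controllable (realize PAᵀ a') (realize (outputPattern sens)ᵀ c')
    rwa [ha', hc', ← observable_iff_controllable_transpose]
  · rintro ⟨a, c, h⟩
    obtain ⟨a', ha'⟩ := exists_realize_transpose a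
    obtain ⟨c', hc'⟩ := exists_realize_transpose c
    refine ⟨a', c', ?_⟩
    rw [observable_iff_controllable_transpose]
    change Controllable (realize PAᵀᵀ a')ᵀ (realize (inputPattern sens)ᵀ c')ᵀ
    rwa [ha', hc', transpose_transpose, transpose_transpose]

theorem stateReaches_transpose {X : Type} (PA : Matrix X X Bool) (i j : X) :
    StateReaches PAᵀ i j ↔ StateReaches PA j i :=
  reflTransGen_swap (r := fun i j => PA j i = true)

/-- Structural controllability requires that every state is reached from some actuator: the rows
of the controllability matrix that belong to other states vanish. -/
theorem exists_stateReaches_of_structurallyControllable {X U : Type} [Fintype X] [DecidableEq X]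
    [Fintype U] {PA : Matrix X X Bool} {act : U → X}
    (h : StructurallyControllable PA (inputPattern act)) (x : X) :
    ∃ u, StateReaches PA (act u) x := by
  by_contra! hx
  obtain ⟨a, b, hab⟩ := h
  rw [controllable_iff] at hab
  have hzero : ∀ (l : ℕ) (x : X), (∀ u, ¬ StateReaches PA (act u) x) → ∀ u,
      (realize PA a ^ l * realize (inputPattern act) b) x u = 0 := by
    intro l
    induction l with
    | zero =>
      intro x hx u
      rw [pow_zero, Matrix.one_mul]
      refine realize_apply_of_ne _ fun h => hx u ?_
      rw [show act u = x by simpa [inputPattern] using h]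
    | succ l ih =>
      intro x hx u
      rw [pow_succ', Matrix.mul_assoc, mul_apply]
      refine Finset.sum_eq_zero fun k _ => ?_
      by_cases hk : PA x k = true
      · rw [ih k (fun v hv => hx v (hv.tail hk)), mul_zero]
      · rw [realize_apply_of_ne _ hk, zero_mul]
  have := hab (Pi.single x 1) fun l _ => by
    ext u
    rw [single_one_vecMul]
    exact hzero l x hx u
  simpa using congrFun this x

theorem actuatorReachesSensor_iff {n p m : ℕ} {PA : Matrix (Fin n) (Fin n) Bool}
    {act : Fin p → Fin n} {sens : Fin m → Fin n} {u : Fin p} {y : Fin m} :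
    ActuatorReachesSensor PA act sens u y ↔ StateReaches PA (act u) (sens y) := by
  constructor
  · intro h
    have key : ∀ v, Reaches (systemDigraph PA (inputPattern act) (outputPattern sens))
        (.inr (.inl u)) v → match v with
          | .inl x => StateReaches PA (act u) x
          | .inr (.inl u') => u' = u
          | .inr (.inr y) => StateReaches PA (act u) (sens y) := by
      intro v hv
      induction hv with
      | refl => rfl
      | @tail b c _ hbc ih =>
        rcases b with i | u' | y'
        · rcases c with j | u'' | y''
          · exact ih.tail hbc
          · exact hbc.elim
          · have : sens y'' = i := by simpa [systemDigraph, outputPattern] using hbc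
            change StateReaches PA (act u) (sens y'')
            rw [this]; exact ih
        · rcases c with j | u'' | y''
          · have : act u' = j := by simpa [systemDigraph, inputPattern] using hbc
            rw [← this, ← show u' = u from ih]
          · exact hbc.elim
          · exact hbc.elim
        · rcases c with j | u'' | y'' <;> exact hbc.elim
    exact key _ h
  · intro h
    refine ReflTransGen.head (b := .inl (act u)) (by simp [systemDigraph, inputPattern]) ?_
    refine ReflTransGen.tail (b := .inl (sens y)) ?_ (by simp [systemDigraph, outputPattern])
    exact ReflTransGen.lift (fun x => Sum.inl x) (fun _ _ h => h) _ _ h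

/-- A pairing pattern makes the closed loop strongly connected. Since a maximum matching meets every
edge, an unmatched actuator reaches only matched sensors, and unmatched sensors are reached only
from matched actuators. -/
theorem closedLoopConnected_of_isPairingPattern {n p m : ℕ} {PA : Matrix (Fin n) (Fin n) Bool}
    {act : Fin p → Fin n} {sens : Fin m → Fin n} {K : Finset (Fin m × Fin p)} (hn : 0 < n)
    (hact : ∀ x, ∃ u, StateReaches PA (act u) x) (hsens : ∀ x, ∃ y, StateReaches PA x (sens y))
    (h : IsPairingPattern PA act sens K) : ClosedLoopConnected PA act sens K := by
  obtain ⟨M, K₀, K', ⟨⟨hMe, hMi⟩, hMax⟩, ⟨r, u, y, hinj, rfl, rfl⟩, ⟨hle, hlt⟩, rfl⟩ := h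
  set M := Finset.univ.image fun l => (u l, y l) with hM
  -- A maximum matching meets every edge.
  have hmeet : ∀ v w, StateReaches PA (act v) (sens w) → LeftMatched M v ∨ RightMatched M w := by
    intro v w hvw
    by_contra! hno
    have hnot : (v, w) ∉ M := fun h => hno.1 ⟨w, h⟩
    have := hMax (insert (v, w) M) ⟨?_, ?_⟩
    · rw [Finset.card_insert_of_notMem hnot] at this; omega
    · intro e he
      rcases Finset.mem_insert.1 he with rfl | he
      · exact actuatorReachesSensor_iff.2 hvw
      · exact hMe e he
    · intro e he f hf hef
      rcases Finset.mem_insert.1 he with rfl | he <;> rcases Finset.mem_insert.1 hf with rfl | hf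
      · rfl
      · rcases hef with hef | hef
        · exact absurd ⟨f.2, by rwa [show v = f.1 from hef]⟩ hno.1
        · exact absurd ⟨f.1, by rwa [show w = f.2 from hef]⟩ hno.2
      · rcases hef with hef | hef
        · exact absurd ⟨e.2, by rwa [show v = e.1 from hef.symm]⟩ hno.1
        · exact absurd ⟨e.1, by rwa [show w = e.2 from hef.symm]⟩ hno.2
      · exact hMi e he f hf hef
  have hleft : ∀ v, LeftMatched M v ↔ v ∈ Set.range u := fun v => by
    simp only [LeftMatched, hM, Finset.mem_image, Finset.mem_univ, true_and, Prod.mk.injEq,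
      Set.mem_range]
    exact ⟨fun ⟨_, l, hl, _⟩ => ⟨l, hl⟩, fun ⟨l, hl⟩ => ⟨_, l, hl, rfl⟩⟩
  have hright : ∀ w, RightMatched M w ↔ w ∈ Set.range y := fun w => by
    simp only [RightMatched, hM, Finset.mem_image, Finset.mem_univ, true_and, Prod.mk.injEq,
      Set.mem_range]
    exact ⟨fun ⟨_, l, _, hl⟩ => ⟨l, hl⟩, fun ⟨l, hl⟩ => ⟨_, l, rfl, hl⟩⟩
  simp only [hleft, hright] at hmeet hle hlt
  have huy : ∀ l, StateReaches PA (act (u l)) (sens (y l)) := fun l =>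
    actuatorReachesSensor_iff.1 (hMe (u l, y l) (Finset.mem_image_of_mem _ (Finset.mem_univ l)))
  cases r with
  | zero =>
    exfalso
    obtain ⟨v, hv⟩ := hact ⟨0, hn⟩
    obtain ⟨w, hw⟩ := hsens ⟨0, hn⟩
    rcases hmeet v w (hv.trans hw) with ⟨l, _⟩ | ⟨l, _⟩ <;> exact l.elim0
  | succ r =>
    refine closedLoopConnected_of_cycle u y hact hsens huy (fun l => ?_) (fun v hv => ⟨?_, ?_⟩)
      fun w hw => ⟨?_, ?_⟩
    · refine Finset.mem_union_left _ (Finset.mem_image.2 ⟨l, Finset.mem_univ l, ?_⟩)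
      rw [finRotate_apply]
    · obtain ⟨w, hw⟩ := hsens (act v)
      obtain ⟨l, rfl⟩ := (hmeet v w hw).resolve_left hv
      exact ⟨l, hw⟩
    · rcases le_or_gt p m with hpm | hpm
      · obtain ⟨w, hw⟩ := (hle hpm).2.2 v hv
        exact ⟨w, Finset.mem_union_right _ hw⟩
      · obtain ⟨w, hw, _⟩ := (hlt hpm).2.1 v hv
        exact ⟨w, Finset.mem_union_right _ hw⟩
    · obtain ⟨v, hv⟩ := hact (sens w)
      obtain ⟨l, rfl⟩ := (hmeet v w hv).resolve_right hw
      exact ⟨l, hv⟩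
    · rcases le_or_gt p m with hpm | hpm
      · obtain ⟨v, hv, _⟩ := (hle hpm).2.1 w hw
        exact ⟨v, Finset.mem_union_right _ hv⟩
      · obtain ⟨v, hv⟩ := (hlt hpm).2.2 w hw
        exact ⟨v, Finset.mem_union_right _ hv⟩

/-- A cycle of `r` links is completed by one link for every unmatched member of the larger one of
the two collections. -/
theorem card_le_of_isPairingPattern {n p m : ℕ} {PA : Matrix (Fin n) (Fin n) Bool}
    {act : Fin p → Fin n} {sens : Fin m → Fin n} {K : Finset (Fin m × Fin p)}
    (h : IsPairingPattern PA act sens K) : K.card ≤ max p m := by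
  obtain ⟨M, K₀, K', ⟨⟨hMe, hMi⟩, -⟩, ⟨r, u, y, hinj, rfl, rfl⟩, ⟨hle, hlt⟩, rfl⟩ := h
  set M := Finset.univ.image fun l => (u l, y l) with hM
  have hmem : ∀ l, (u l, y l) ∈ M := fun l => Finset.mem_image_of_mem _ (Finset.mem_univ l)
  have hu : Function.Injective u := fun l l' h =>
    hinj (hMi _ (hmem l) _ (hmem l') (Or.inl h))
  have hy : Function.Injective y := fun l l' h =>
    hinj (hMi _ (hmem l) _ (hmem l') (Or.inr h))
  have hK₀ : (Finset.univ.image fun l => (y l, u (finRotate r l))).card ≤ r :=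
    Finset.card_image_le.trans (by simp)
  have hcard := Finset.card_union_le (Finset.univ.image fun l => (y l, u (finRotate r l))) K'
  rcases le_or_gt p m with hpm | hpm
  · obtain ⟨h1, h2, -⟩ := hle hpm
    have h3 : K'.card ≤ ((Finset.univ.image y)ᶜ).card := by
      refine Finset.card_le_card_of_injOn Prod.fst (fun e he => ?_) fun e he f hf hef => ?_
      · have := h1 e he
        simp only [Finset.coe_compl, Set.mem_compl_iff, Finset.mem_coe, Finset.mem_image,
          Finset.mem_univ, true_and, not_exists]
        exact fun l hl => this ⟨u l, hl ▸ hmem l⟩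
      · have h4 := (h2 e.1 (h1 e he)).unique (y₁ := e.2) (y₂ := f.2) he
          (by simpa [show e.1 = f.1 from hef] using hf)
        exact Prod.ext hef h4
    rw [Finset.card_compl, Finset.card_image_of_injective _ hy] at h3
    have h5 := Fintype.card_le_of_injective y hy
    simp only [Fintype.card_fin, Finset.card_univ] at h3 h5
    omega
  · obtain ⟨h1, h2, -⟩ := hlt hpm
    have h3 : K'.card ≤ ((Finset.univ.image u)ᶜ).card := by
      refine Finset.card_le_card_of_injOn Prod.snd (fun e he => ?_) fun e he f hf hef => ?_
      · have := h1 e he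
        simp only [Finset.coe_compl, Set.mem_compl_iff, Finset.mem_coe, Finset.mem_image,
          Finset.mem_univ, true_and, not_exists]
        exact fun l hl => this ⟨y l, hl ▸ hmem l⟩
      · have h4 := (h2 e.2 (h1 e he)).unique (y₁ := e.1) (y₂ := f.1) he
          (by simpa [show e.2 = f.2 from hef] using hf)
        exact Prod.ext h4 hef
    rw [Finset.card_compl, Finset.card_image_of_injective _ hu] at h3
    have h5 := Fintype.card_le_of_injective u hu
    simp only [Fintype.card_fin, Finset.card_univ] at h3 h5
    omega

end Pairing

/-! ### Fixed eigenvalues, and controllability from reachability -/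

section LowerBound

open Matrix Relation Polynomial

variable {V : Type} [Fintype V] [DecidableEq V]

omit [DecidableEq V] in
/-- A nonzero subspace that is invariant under a matrix contains a left eigenvector. -/
theorem exists_left_eigenvector {M : Matrix V V ℂ} (W : Submodule ℂ (V → ℂ)) (hW : W ≠ ⊥)
    (hinv : ∀ w ∈ W, w ᵥ* M ∈ W) : ∃ w ∈ W, w ≠ 0 ∧ ∃ z : ℂ, w ᵥ* M = z • w := by
  have : Nontrivial W := Submodule.nontrivial_iff_ne_bot.2 hW
  let f : Module.End ℂ W := (vecMulLinear M).restrict hinv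
  obtain ⟨z, hz⟩ := Module.End.exists_eigenvalue f
  obtain ⟨w, hw, hw0⟩ := hz.exists_hasEigenvector
  refine ⟨w, w.2, fun h => hw0 (Subtype.ext h), z, ?_⟩
  exact congrArg Subtype.val (Module.End.mem_eigenspace_iff.1 hw)

theorem charpoly_eval_eq_zero_of_vecMul {M : Matrix V V ℂ} {w : V → ℂ} {z : ℂ} (hw : w ≠ 0)
    (h : w ᵥ* M = z • w) : M.charpoly.eval z = 0 := by
  rw [eval_charpoly]
  refine exists_vecMul_eq_zero_iff.1 ⟨w, hw, ?_⟩
  rw [vecMul_sub, h, sub_eq_zero, scalar_apply, ← smul_one_eq_diagonal, vecMul_smul, vecMul_one]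

theorem eq_zero_of_vecMul_eq_zero {A : Matrix V V ℝ} (hA : A.det ≠ 0) {w : V → ℂ}
    (h : w ᵥ* complexify A = 0) : w = 0 := by
  by_contra hw
  have := exists_vecMul_eq_zero_iff.1 ⟨w, hw, h⟩
  rw [complexify, ← RingHom.mapMatrix_apply, ← RingHom.map_det] at this
  exact hA (by simpa using this)

omit [Fintype V] [DecidableEq V] in
theorem complexify_add (A H : Matrix V V ℝ) :
    complexify (A + H) = complexify A + complexify H := by
  ext; simp

/-- If no edge enters the states `S`, then an invertible matrix has a nonzero eigenvalue that no
perturbation outside the rows of `S` can move. -/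
theorem exists_fixed_eigenvalue {A : Matrix V V ℝ} (hA : A.det ≠ 0) {S : Set V} (hS : S.Nonempty)
    (hAS : ∀ i ∈ S, ∀ j ∉ S, A i j = 0) :
    ∃ z : ℂ, z ≠ 0 ∧ ∀ H : Matrix V V ℝ, (∀ i ∈ S, ∀ j, H i j = 0) →
      (complexify (A + H)).charpoly.eval z = 0 := by
  let W : Submodule ℂ (V → ℂ) :=
    { carrier := {w | ∀ i ∉ S, w i = 0}
      add_mem' := fun ha hb i hi => by simp [ha i hi, hb i hi]
      zero_mem' := fun _ _ => rfl
      smul_mem' := fun c w hw i hi => by simp [hw i hi] }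
  obtain ⟨i₀, hi₀⟩ := hS
  obtain ⟨w, hw, hw0, z, hz⟩ := exists_left_eigenvector (M := complexify A) W
    ((Submodule.ne_bot_iff _).2 ⟨Pi.single i₀ 1, fun i hi =>
      Pi.single_eq_of_ne (fun h => hi (by rwa [h])) _, fun h => by simpa using congrFun h i₀⟩)
    fun w hw j hj => Finset.sum_eq_zero fun i _ => by
      by_cases hi : i ∈ S
      · simp [hAS i hi j hj]
      · simp [hw i hi]
  refine ⟨z, ?_, fun H hH => charpoly_eval_eq_zero_of_vecMul hw0 ?_⟩
  · rintro rfl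
    exact hw0 (eq_zero_of_vecMul_eq_zero hA (by rw [hz, zero_smul]))
  · rw [complexify_add, vecMul_add, hz, add_eq_left]
    ext j
    refine Finset.sum_eq_zero fun i _ => ?_
    by_cases hi : i ∈ S
    · simp [hH i hi j]
    · simp [hw i hi]

theorem exists_perm_of_hasPerfectMatching {n : ℕ} {PA : Matrix (Fin n) (Fin n) Bool}
    (h : HasPerfectMatching PA) : ∃ σ : Equiv.Perm (Fin n), ∀ i, PA i (σ i) = true := by
  obtain ⟨M, ⟨hMe, hMi⟩, -, hright⟩ := h
  choose f hf using hright
  have hinj : Function.Injective f := fun i j hij =>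
    congrArg Prod.snd (hMi _ (hf i) _ (hf j) (Or.inl hij))
  exact ⟨Equiv.ofBijective f (Finite.injective_iff_bijective.1 hinj), fun i => hMe _ (hf i)⟩

theorem hasPerfectMatching_transpose {n : ℕ} {PA : Matrix (Fin n) (Fin n) Bool}
    (h : HasPerfectMatching PA) : HasPerfectMatching PAᵀ := by
  obtain ⟨σ, hσ⟩ := exists_perm_of_hasPerfectMatching h
  refine ⟨Finset.univ.image fun i => (i, σ i), ⟨?_, ?_⟩, fun i => ⟨σ i, ?_⟩,
    fun j => ⟨σ.symm j, ?_⟩⟩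
  · simpa using hσ
  · simp only [Finset.mem_image, Finset.mem_univ, true_and, forall_exists_index]
    rintro _ i rfl _ j rfl hij
    have : i = j := by simpa using hij
    rw [this]
  · simp
  · simp

/-- A perfect matching is a permutation supported on the pattern, hence the determinant is not
identically zero. -/
theorem ae_det_ne_zero {n : ℕ} {PA : Matrix (Fin n) (Fin n) Bool} (h : HasPerfectMatching PA) :
    ∀ᵐ a : Params PA, (realize PA a).det ≠ 0 := by
  obtain ⟨σ, hσ⟩ := exists_perm_of_hasPerfectMatching h
  obtain ⟨b, hb⟩ : ∃ b : Params PA, realize PA b = σ.permMatrix ℝ := by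
    refine exists_realize_eq fun i j hij => ?_
    rw [Equiv.Perm.permMatrix, PEquiv.toMatrix_apply, if_neg]
    simp only [Equiv.toPEquiv_apply, Option.mem_def, Option.some.injEq]
    rintro rfl
    exact hij (hσ i)
  have hcont : Continuous fun a : Params PA => (realize PA a).det := by
    have := continuous_maskedRealize PA Set.univ
    rw [show maskedRealize PA Set.univ = realize PA from funext (maskedRealize_univ PA)] at this
    exact Continuous.matrix_det this
  refine ae_mem_of_ae_add_linearMap_mem (s := {a | (realize PA a).det ≠ 0})
    (LinearMap.toSpanSingleton ℝ (Params PA) b) volume volume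
    (isOpen_ne_fun hcont continuous_const).measurableSet fun a => ?_
  -- Along the direction of the permutation matrix, the determinant is a polynomial of degree `n`.
  let q : ℝ[X] := det ((X : ℝ[X]) • (realize PA b).map C + (realize PA a).map C)
  have hq : ∀ t, q.eval t = (realize PA (a + t • b)).det := by
    intro t
    have h1 : realize PA (a + t • b) = realize PA a + t • realize PA b := by
      simpa only [maskedRealize_univ] using maskedRealize_add_smul PA Set.univ a b t
    rw [h1, ← coe_evalRingHom, RingHom.map_det]
    congr 1
    ext i j
    simp only [RingHom.mapMatrix_apply, Matrix.map_apply, Matrix.add_apply, Matrix.smul_apply,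
      smul_eq_mul, coe_evalRingHom, eval_add, eval_C, eval_mul, eval_X]
    rw [add_comm]
  have hq0 : q ≠ 0 := by
    intro h0
    have := coeff_det_X_add_C_card (realize PA b) (realize PA a)
    rw [show det ((X : ℝ[X]) • (realize PA b).map C + (realize PA a).map C) = 0 from h0, hb,
      det_permutation, coeff_zero] at this
    rcases Int.units_eq_one_or (Equiv.Perm.sign σ) with h | h <;> simp [h] at this
  rw [ae_iff]
  refine (q.rootSet_finite ℝ).subset (fun t ht => ?_) |>.measure_zero _
  rw [mem_rootSet]
  refine ⟨hq0, ?_⟩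
  simpa [hq] using ht

/-- A perfect matching and the reachability of all states from the actuators suffice for structural
controllability: a left eigenvector orthogonal to the inputs would belong to a nonzero eigenvalue
that no state feedback can move. -/
theorem structurallyControllable_of_reach {n : ℕ} {U : Type} [Fintype U]
    {PA : Matrix (Fin n) (Fin n) Bool} {act : U → Fin n} (hPA : HasPerfectMatching PA)
    (hact : ∀ x, ∃ u, StateReaches PA (act u) x) :
    StructurallyControllable PA (inputPattern act) := by
  rcases Nat.eq_zero_or_pos n with rfl | hn
  · refine ⟨0, 0, (controllable_iff _ _).2 fun w _ => ?_⟩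
    exact Subsingleton.elim _ _
  let F : Fin n → Fin n → Prop := fun _ j => ∃ u, act u = j
  obtain ⟨u₀, -⟩ := hact ⟨0, hn⟩
  have hgood : ∀ᵐ a : Params PA, NoCommonEigenvalue F (realize PA a) := by
    refine ae_noCommonEigenvalue (s := act u₀) (d := act u₀) ⟨u₀, rfl⟩ (fun x => ?_)
      fun x => .single (Or.inr ⟨u₀, rfl⟩)
    obtain ⟨u, hu⟩ := hact x
    exact .head (Or.inr ⟨u, rfl⟩) (ReflTransGen.mono (fun _ _ h => Or.inl h) _ _ hu)
  obtain ⟨a, ha, hdet⟩ := (hgood.and (ae_det_ne_zero hPA)).exists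
  refine ⟨a, fun _ => 1, (controllable_iff _ _).2 fun w₀ hw₀ => ?_⟩
  set A := realize PA a
  set B := realize (inputPattern act) fun _ => 1
  by_contra hne
  rw [Fintype.card_fin] at hw₀
  have hall : ∀ l, w₀ ᵥ* (A ^ l * B) = 0 := by
    intro l
    have : Nonempty (Fin n) := ⟨⟨0, hn⟩⟩
    have hdeg : (X ^ l %ₘ A.charpoly).natDegree < n := by
      have h1 := natDegree_modByMonic_lt (X ^ l) (charpoly_monic A) (fun h => by
        have := charpoly_natDegree_eq_dim A
        rw [h, natDegree_one, Fintype.card_fin] at this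
        omega)
      rwa [charpoly_natDegree_eq_dim, Fintype.card_fin] at h1
    rw [pow_eq_aeval_mod_charpoly, aeval_eq_sum_range' hdeg, Matrix.sum_mul, vecMul_sum]
    refine Finset.sum_eq_zero fun i hi => ?_
    rw [smul_mul, vecMul_smul, hw₀ i (Finset.mem_range.1 hi), smul_zero]
  let Bc : Matrix (Fin n) U ℂ := B.map (algebraMap ℝ ℂ)
  let W : Submodule ℂ (Fin n → ℂ) := ⨅ l : ℕ, (vecMulLinear (complexify A ^ l * Bc)).ker
  have hW : ∀ w, w ∈ W ↔ ∀ l, w ᵥ* (complexify A ^ l * Bc) = 0 := fun w => by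
    simp [W, Submodule.mem_iInf]
  have hbot : W ≠ ⊥ := by
    refine (Submodule.ne_bot_iff _).2 ⟨fun i => (w₀ i : ℂ), (hW _).2 fun l => ?_, fun h => hne ?_⟩
    · ext u
      have h1 := congrFun (hall l) u
      have h2 : complexify A ^ l * Bc = (A ^ l * B).map (algebraMap ℝ ℂ) := by
        rw [Matrix.map_mul, complexify, ← RingHom.mapMatrix_apply, ← map_pow]; rfl
      rw [h2]
      have h3 : ((w₀ ᵥ* (A ^ l * B)) u : ℂ) = 0 := by rw [h1]; simp
      rw [Pi.zero_apply, ← h3]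
      simp only [vecMul, dotProduct, Matrix.map_apply, Complex.coe_algebraMap]
      push_cast
      rfl
    · ext i
      simpa using congrFun h i
  obtain ⟨w, hw, hw0, z, hz⟩ := exists_left_eigenvector (M := complexify A) W hbot
    fun w hw => (hW _).2 fun l => by
      rw [vecMul_vecMul, ← Matrix.mul_assoc, ← pow_succ']
      exact (hW w).1 hw (l + 1)
  have hz0 : z ≠ 0 := by
    rintro rfl
    exact hw0 (eq_zero_of_vecMul_eq_zero hdet (by rw [hz, zero_smul]))
  obtain ⟨H, hH, hHne⟩ := ha z hz0
  refine hHne (charpoly_eval_eq_zero_of_vecMul hw0 ?_)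
  rw [complexify_add, vecMul_add, hz, add_eq_left]
  ext i
  change ∑ j, w j * complexify H j i = 0
  refine Finset.sum_eq_zero fun j _ => ?_
  by_cases hj : ∃ u, act u = j
  · obtain ⟨u, rfl⟩ := hj
    have h1 := congrFun ((hW w).1 hw 0) u
    rw [pow_zero, Matrix.one_mul] at h1
    have h2 : w (act u) = 0 := by
      rw [Pi.zero_apply] at h1
      rw [← h1]
      refine ((Finset.sum_eq_single (act u) (fun j _ hj => ?_)
        (fun h => absurd (Finset.mem_univ _) h)).trans ?_).symm
      · simp [Bc, B, realize, inputPattern, hj.symm]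
      · simp [Bc, B, realize, inputPattern]
    simp [h2]
  · simp [hH i j hj]

end LowerBound

/-! ### Optimality -/

section Optimality

open Matrix Relation

/-- A property of almost all parameters holds for some parameters, hence its negation does not hold
for almost all of them. -/
instance ae_params_neBot {R S R' S' R'' S'' : Type} [Fintype R] [Fintype S] [Fintype R']
    [Fintype S'] [Fintype R''] [Fintype S''] (P : Matrix R S Bool) (P' : Matrix R' S' Bool)
    (P'' : Matrix R'' S'' Bool) :
    (ae (volume : Measure (Params P × Params P' × Params P''))).NeBot := by
  have : (volume : Measure (Params P' × Params P'')).IsOpenPosMeasure :=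
    Measure.prod.instIsOpenPosMeasure
  have : (volume : Measure (Params P × Params P' × Params P'')).IsOpenPosMeasure :=
    Measure.prod.instIsOpenPosMeasure
  infer_instance

theorem Design.GenericallyFeasible.feasible {n k : ℕ} {PA : Matrix (Fin n) (Fin n) Bool}
    {D : Design n} (h : D.GenericallyFeasible PA k) : D.Feasible PA k := by
  intro J hJ JB JC hcard hbad
  obtain ⟨q, hq, z, hz, hz0⟩ := ((h J hJ JB JC hcard).and hbad).exists
  exact hz0 (hq z hz)

/-- If no edge enters the states `S` and no link that survives leads to an actuator in `S`, then
there are structurally unstable resilient fixed modes. -/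
theorem hasStructurallyUnstable_of_source {n : ℕ} {U Y : Type} [Fintype U] [Fintype Y]
    {PA : Matrix (Fin n) (Fin n) Bool} (hPA : HasPerfectMatching PA) {act : U → Fin n}
    {sens : Y → Fin n} {L F : Set (Y × U)} {S : Set (Fin n)} (hS : S.Nonempty)
    (hAS : ∀ i j, PA j i = true → j ∈ S → i ∈ S)
    (hL : ∀ y u, (y, u) ∈ L → (y, u) ∉ F → act u ∉ S) :
    HasStructurallyUnstableResilientFixedModes PA (inputPattern act) (outputPattern sens) L
      (fun _ : Unit => F) := by
  have h1 : ∀ᵐ q : Params PA × Params (inputPattern act) × Params (outputPattern sens),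
      (realize PA q.1).det ≠ 0 := Measure.quasiMeasurePreserving_fst.ae (ae_det_ne_zero hPA)
  filter_upwards [h1] with q hq
  obtain ⟨z, hz0, hz⟩ := exists_fixed_eigenvalue hq hS fun i hi j hj =>
    realize_apply_of_ne q.1 fun h => hj (hAS j i h hi)
  refine ⟨z, ?_, hz0⟩
  simp only [resilientFixedModes, Set.mem_iUnion, Set.mem_iInter]
  refine ⟨(), fun K hK => ?_⟩
  rw [mem_spectrum_iff_isRoot_charpoly]
  refine hz _ fun i hi j => ?_
  simp only [mul_apply]
  refine Finset.sum_eq_zero fun y _ => mul_eq_zero_of_left (Finset.sum_eq_zero fun u _ => ?_) _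
  by_cases hu : act u = i
  · rw [hK u y, mul_zero]
    by_contra! h
    exact hL y u h.1 h.2 (by rwa [hu])
  · rw [realize_apply_of_ne _ (by simp [inputPattern, hu]), zero_mul]

/-- The dual statement for sensors: no edge leaves `S`, and no link that survives starts in `S`. -/
theorem hasStructurallyUnstable_of_sink {n : ℕ} {U Y : Type} [Fintype U] [Fintype Y]
    {PA : Matrix (Fin n) (Fin n) Bool} (hPA : HasPerfectMatching PA) {act : U → Fin n}
    {sens : Y → Fin n} {L F : Set (Y × U)} {S : Set (Fin n)} (hS : S.Nonempty)
    (hAS : ∀ i j, PA j i = true → i ∈ S → j ∈ S)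
    (hL : ∀ y u, (y, u) ∈ L → (y, u) ∉ F → sens y ∉ S) :
    HasStructurallyUnstableResilientFixedModes PA (inputPattern act) (outputPattern sens) L
      (fun _ : Unit => F) := by
  have h1 : ∀ᵐ q : Params PA × Params (inputPattern act) × Params (outputPattern sens),
      (realize PA q.1).det ≠ 0 := Measure.quasiMeasurePreserving_fst.ae (ae_det_ne_zero hPA)
  filter_upwards [h1] with q hq
  obtain ⟨z, hz0, hz⟩ := exists_fixed_eigenvalue (A := (realize PA q.1)ᵀ)
    (by rwa [det_transpose]) hS fun i hi j hj =>
    realize_apply_of_ne q.1 fun h => hj (hAS i j h hi)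
  refine ⟨z, ?_, hz0⟩
  simp only [resilientFixedModes, Set.mem_iUnion, Set.mem_iInter]
  refine ⟨(), fun K hK => ?_⟩
  rw [mem_spectrum_iff_isRoot_charpoly, ← charpoly_transpose, ← transpose_map, transpose_add]
  refine hz _ fun i hi j => ?_
  simp only [transpose_apply, mul_apply]
  refine Finset.sum_eq_zero fun y _ => ?_
  by_cases hy : sens y = i
  · refine mul_eq_zero_of_left (Finset.sum_eq_zero fun u _ => ?_) _
    rw [hK u y, mul_zero]
    by_contra! h
    exact hL y u h.1 h.2 (by rwa [hy])
  · rw [realize_apply_of_ne _ (by simp [outputPattern, hy]), mul_zero]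

/-- A set of states without incoming edges needs `k + 1` actuators, and `k + 1` links to them: if
there were fewer, they could all fail. -/
theorem Design.Feasible.card_source {n k : ℕ} {PA : Matrix (Fin n) (Fin n) Bool} {D : Design n}
    (hD : D.Feasible PA k) (hPA : HasPerfectMatching PA) {S : Set (Fin n)} [DecidablePred (· ∈ S)]
    (hS : S.Nonempty) (hAS : ∀ i j, PA j i = true → j ∈ S → i ∈ S) :
    k + 1 ≤ (Finset.univ.filter fun u => D.act u ∈ S).card ∧
      k + 1 ≤ (D.links.filter fun e => D.act e.2 ∈ S).card := by
  constructor <;> by_contra! h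
  · exact hD ∅ (Finset.empty_subset _) (Finset.univ.filter fun u => D.act u ∈ S) ∅
      (by simpa using by omega) (hasStructurallyUnstable_of_source hPA hS hAS
        fun y u _ _ hu => u.2 (by simpa using hu))
  · exact hD (D.links.filter fun e => D.act e.2 ∈ S) (Finset.filter_subset _ _) ∅ ∅
      (by simpa using by omega) (hasStructurallyUnstable_of_source hPA hS hAS
        fun y u hl hf hu => hf (Finset.mem_filter.2 ⟨hl, hu⟩))

/-- The dual of `Design.Feasible.card_source`. -/
theorem Design.Feasible.card_sink {n k : ℕ} {PA : Matrix (Fin n) (Fin n) Bool} {D : Design n}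
    (hD : D.Feasible PA k) (hPA : HasPerfectMatching PA) {S : Set (Fin n)} [DecidablePred (· ∈ S)]
    (hS : S.Nonempty) (hAS : ∀ i j, PA j i = true → i ∈ S → j ∈ S) :
    k + 1 ≤ (Finset.univ.filter fun y => D.sens y ∈ S).card ∧
      k + 1 ≤ (D.links.filter fun e => D.sens e.1 ∈ S).card := by
  constructor <;> by_contra! h
  · exact hD ∅ (Finset.empty_subset _) ∅ (Finset.univ.filter fun y => D.sens y ∈ S)
      (by simpa using by omega) (hasStructurallyUnstable_of_sink hPA hS hAS
        fun y u _ _ hu => y.2 (by simpa using hu))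
  · exact hD (D.links.filter fun e => D.sens e.1 ∈ S) (Finset.filter_subset _ _) ∅ ∅
      (by simpa using by omega) (hasStructurallyUnstable_of_sink hPA hS hAS
        fun y u hl hf hu => hf (Finset.mem_filter.2 ⟨hl, hu⟩))

/-- States that reach all states, none of which reaches another one: one representative of every
source among the strongly connected components. -/
def IsSourceBasis {X : Type} {p : ℕ} (PA : Matrix X X Bool) (s : Fin p → X) : Prop :=
  (∀ x, ∃ i, StateReaches PA (s i) x) ∧ ∀ i j, StateReaches PA (s i) (s j) → i = j

theorem IsSourceBasis.reaches_of_reaches {X : Type} {p : ℕ} {PA : Matrix X X Bool}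
    {s : Fin p → X} (hs : IsSourceBasis PA s) {i : Fin p} {x : X} (h : StateReaches PA x (s i)) :
    StateReaches PA (s i) x := by
  obtain ⟨j, hj⟩ := hs.1 x
  rwa [hs.2 j i (hj.trans h)] at hj

/-- A smallest set of states that reaches all states is a source basis. -/
theorem exists_isSourceBasis {n : ℕ} (PA : Matrix (Fin n) (Fin n) Bool) :
    ∃ (p : ℕ) (s : Fin p → Fin n), IsSourceBasis PA s := by
  classical
  obtain ⟨R, hR, hmin⟩ := Finset.exists_min_image
    (Finset.univ.filter fun R : Finset (Fin n) => ∀ x, ∃ r ∈ R, StateReaches PA r x) Finset.card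
    ⟨Finset.univ, by simpa using fun x => ⟨x, .refl⟩⟩
  simp only [Finset.mem_filter, Finset.mem_univ, true_and] at hR hmin
  refine ⟨R.card, fun i => R.equivFin.symm i, fun x => ?_, fun i j hij => ?_⟩
  · obtain ⟨r, hr, hrx⟩ := hR x
    exact ⟨R.equivFin ⟨r, hr⟩, by simpa using hrx⟩
  · by_contra hne
    set a := R.equivFin.symm i
    set b := R.equivFin.symm j
    have hab : a ≠ b := fun h => hne (R.equivFin.symm.injective h)
    have := hmin (R.erase b) fun x => by
      obtain ⟨r, hr, hrx⟩ := hR x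
      by_cases hrb : r = b
      · exact ⟨a, Finset.mem_erase.2 ⟨fun h => hab (Subtype.ext h), a.2⟩,
          hij.trans (by rwa [hrb] at hrx)⟩
      · exact ⟨r, Finset.mem_erase.2 ⟨hrb, hr⟩, hrx⟩
    have h2 := Finset.card_erase_lt_of_mem b.2
    omega

theorem card_sum_le_of_disjoint {α ι X : Type} [Fintype ι] [DecidableEq α] (T : Finset α)
    (g : α → X) (S : ι → Set X) [∀ i, DecidablePred (· ∈ S i)] (N : ℕ)
    (hdisj : ∀ i j x, x ∈ S i → x ∈ S j → i = j) (h : ∀ i, N ≤ (T.filter fun a => g a ∈ S i).card) :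
    Fintype.card ι * N ≤ T.card := by
  classical
  calc Fintype.card ι * N = ∑ _i : ι, N := by simp
    _ ≤ ∑ i, (T.filter fun a => g a ∈ S i).card := Finset.sum_le_sum fun i _ => h i
    _ = (Finset.univ.biUnion fun i => T.filter fun a => g a ∈ S i).card := by
        refine (Finset.card_biUnion fun i _ j _ hij =>
          Finset.disjoint_left.2 fun a hi hj => ?_).symm
        exact hij (hdisj i j _ (Finset.mem_filter.1 hi).2 (Finset.mem_filter.1 hj).2)
    _ ≤ T.card := Finset.card_le_card fun a ha => by
        obtain ⟨i, -, hi⟩ := Finset.mem_biUnion.1 ha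
        exact (Finset.mem_filter.1 hi).1

/-- Every source and every sink among the strongly connected components needs `k + 1` actuators or
sensors and `k + 1` links of its own. -/
theorem Design.Feasible.le_cost {n k p m : ℕ} {PA : Matrix (Fin n) (Fin n) Bool} {D : Design n}
    (hD : D.Feasible PA k) (hPA : HasPerfectMatching PA) {s : Fin p → Fin n} {t : Fin m → Fin n}
    (hs : IsSourceBasis PA s) (ht : IsSourceBasis PAᵀ t) :
    (k + 1) * p + (k + 1) * m + (k + 1) * max p m ≤ D.cost := by
  classical
  let S : Fin p → Set (Fin n) := fun i => {x | StateReaches PA x (s i)}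
  let T : Fin m → Set (Fin n) := fun i => {x | StateReaches PA (t i) x}
  have hS : ∀ i j x, x ∈ S i → x ∈ S j → i = j := fun i j x hi hj =>
    hs.2 i j ((hs.reaches_of_reaches hi).trans hj)
  have hT : ∀ i j x, x ∈ T i → x ∈ T j → i = j := fun i j x hi hj =>
    ht.2 i j ((ht.reaches_of_reaches ((stateReaches_transpose PA x (t i)).2 hi)).trans
      ((stateReaches_transpose PA x (t j)).2 hj))
  have h1 := fun i => hD.card_source (S := S i) hPA ⟨s i, .refl⟩
    fun a b hab hb => ReflTransGen.head hab hb
  have h2 := fun i => hD.card_sink (S := T i) hPA ⟨t i, .refl⟩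
    fun a b hab hb => ReflTransGen.tail hb hab
  have e1 := card_sum_le_of_disjoint Finset.univ D.act S (k + 1) hS fun i => (h1 i).1
  have e2 := card_sum_le_of_disjoint D.links (fun e => D.act e.2) S (k + 1) hS fun i => (h1 i).2
  have e3 := card_sum_le_of_disjoint Finset.univ D.sens T (k + 1) hT fun i => (h2 i).1
  have e4 := card_sum_le_of_disjoint D.links (fun e => D.sens e.1) T (k + 1) hT fun i => (h2 i).2
  simp only [Fintype.card_fin, Finset.card_univ] at e1 e2 e3 e4
  rw [Design.cost, mul_comm _ p, mul_comm _ m, mul_comm _ (max p m)]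
  rcases max_choice p m with h | h <;> rw [h] <;> omega

/-- A union of connected blocks is a solution if each of them is at most as large as a smallest
choice of actuators and sensors for the sources and sinks. -/
theorem unionDesign_isSolution {n k p m p' m' : ℕ} {PA : Matrix (Fin n) (Fin n) Bool}
    {act : Fin ((k + 1) * p) → Fin n} {sens : Fin ((k + 1) * m) → Fin n}
    {K : Fin (k + 1) → Finset (Fin m × Fin p)} (hPA : HasPerfectMatching PA)
    (h : (unionDesign act sens K).GenericallyFeasible PA k)
    (hK : ∀ i, (K i).card ≤ max p m) {s : Fin p' → Fin n} {t : Fin m' → Fin n}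
    (hs : IsSourceBasis PA s) (ht : IsSourceBasis PAᵀ t) (hp : p ≤ p') (hm : m ≤ m') :
    (unionDesign act sens K).IsSolution PA k := by
  refine ⟨h.feasible, fun D' hD' => le_trans ?_ (hD'.le_cost hPA hs ht)⟩
  have h1 : (unionDesign act sens K).links.card ≤ (k + 1) * max p m := by
    refine Finset.card_biUnion_le.trans ((Finset.sum_le_sum fun i _ =>
      Finset.card_image_le.trans (hK i)).trans ?_)
    simp
  have h2 : (k + 1) * max p m ≤ (k + 1) * max p' m' :=
    Nat.mul_le_mul_left _ (max_le_max hp hm)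
  have h3 := Nat.mul_le_mul_left (k + 1) hp
  have h4 := Nat.mul_le_mul_left (k + 1) hm
  change (k + 1) * p + (k + 1) * m + (unionDesign act sens K).links.card ≤ _
  omega

/-- Unions of minimum collections with pairing patterns are generically feasible, and optimal if
there is a perfect matching: then a source basis is a possible choice of actuators, so that the
minimum collections are at most as large as the bases of sources and sinks. -/
theorem unionDesign_genericallyFeasible_and_isSolution {n k p m : ℕ}
    {PA : Matrix (Fin n) (Fin n) Bool}
    {act : Fin ((k + 1) * p) → Fin n} {sens : Fin ((k + 1) * m) → Fin n}
    {K : Fin (k + 1) → Finset (Fin m × Fin p)}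
    (hact : ∀ i, IsMinimumActuation PA (block act i))
    (hsens : ∀ i, IsMinimumSensing PA (block sens i))
    (hK : ∀ i, IsPairingPattern PA (block act i) (block sens i) (K i)) :
    (unionDesign act sens K).GenericallyFeasible PA k ∧
      (HasPerfectMatching PA → (unionDesign act sens K).IsSolution PA k) := by
  have h : (unionDesign act sens K).GenericallyFeasible PA k := by
    refine unionDesign_genericallyFeasible fun hn i =>
      closedLoopConnected_of_isPairingPattern hn
        (exists_stateReaches_of_structurallyControllable (hact i).1) (fun x => ?_) (hK i)
    obtain ⟨y, hy⟩ := exists_stateReaches_of_structurallyControllable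
      ((structurallyObservable_iff _ _).1 (hsens i).1) x
    exact ⟨y, (stateReaches_transpose PA _ _).1 hy⟩
  refine ⟨h, fun hPA => ?_⟩
  obtain ⟨p', s, hs⟩ := exists_isSourceBasis PA
  obtain ⟨m', t, ht⟩ := exists_isSourceBasis PAᵀ
  refine unionDesign_isSolution hPA h (fun i => card_le_of_isPairingPattern (hK i)) hs ht ?_ ?_
  · exact (hact 0).2 p' s (structurallyControllable_of_reach hPA hs.1)
  · exact (hsens 0).2 m' t ((structurallyObservable_iff _ _).2
      (structurallyControllable_of_reach (hasPerfectMatching_transpose hPA) ht.1))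

end Optimality

/-! ### Abstract machine states -/

namespace RAM

/-- The registers that the program names, apart from the three registers that are reserved for the
computation of addresses. -/
inductive Reg where
  | numV | numE | bound | one | ctr | tmp | aux | vtx | wtx | arc | stkLen | todoLen | outLen | root
  | go | numSrc | numSnk | numPair | actLen | sensLen | numLink | round | pos | actOff | sensOff
  | totAct | totSens | totLink
  deriving DecidableEq

/-- The tables that the program keeps in memory: the ends of the arcs, the linked lists of the arcs
that leave (`headF`, `nextF`) and that enter (`headR`, `nextR`) a vertex, the starting points and
the stack of the searches, the labels and the roots found by the forward and by the backward
searches, the marks of the matched sources and sinks, and the actuators and sensors of a block. -/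
inductive Tab where
  | src | tgt | headF | nextF | headR | nextR | starts | stk | labF₁ | labF | outF | srcs
  | labR₁ | labR | outR | snks | usedS | usedT | acts | sens
  deriving DecidableEq

/-- The number of the machine register; the registers `0`, `1`, `2` hold addresses. -/
def Reg.idx (r : Reg) : ℕ := r.ctorIdx + 3

/-- The offset of a table in the interleaved memory: the entry `i` of the table `t` has the address
`W + 32 * i + t.idx`, where `W` is the content of register `2`. -/
def Tab.idx (t : Tab) : ℕ := t.ctorIdx

theorem Reg.idx_inj {r r' : Reg} : r.idx = r'.idx ↔ r = r' := by
  refine ⟨fun h => ?_, fun h => h ▸ rfl⟩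
  cases r <;> cases r' <;> first | rfl | exact absurd h (by decide)

theorem Tab.idx_inj {t t' : Tab} : t.idx = t'.idx ↔ t = t' := by
  refine ⟨fun h => ?_, fun h => h ▸ rfl⟩
  cases t <;> cases t' <;> first | rfl | exact absurd h (by decide)

theorem Tab.idx_lt (t : Tab) : t.idx < 32 := by
  cases t <;> decide

/-- An abstract machine state: named registers, unbounded tables, and the memory below the tables,
which holds the input and receives the output. -/
structure HState where
  reg : Reg → ℕ
  tab : Tab → ℕ → ℕ
  low : ℕ → ℕ

namespace HState

def setReg (h : HState) (d : Reg) (x : ℕ) : HState := { h with reg := Function.update h.reg d x }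

def setTab (h : HState) (t : Tab) (i x : ℕ) : HState :=
  { h with tab := Function.update h.tab t (Function.update (h.tab t) i x) }

def setLow (h : HState) (i x : ℕ) : HState := { h with low := Function.update h.low i x }

variable (h : HState)

@[simp] theorem reg_setReg (d r : Reg) (x : ℕ) :
    (h.setReg d x).reg r = if r = d then x else h.reg r := by
  simp [setReg, Function.update_apply]

@[simp] theorem tab_setReg (d : Reg) (x : ℕ) : (h.setReg d x).tab = h.tab := rfl

@[simp] theorem low_setReg (d : Reg) (x : ℕ) : (h.setReg d x).low = h.low := rfl

@[simp] theorem reg_setTab (t : Tab) (i x : ℕ) : (h.setTab t i x).reg = h.reg := rfl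

@[simp] theorem tab_setTab (t t' : Tab) (i x : ℕ) :
    (h.setTab t i x).tab t' = if t' = t then Function.update (h.tab t) i x else h.tab t' := by
  simp only [setTab, Function.update_apply]

@[simp] theorem low_setTab (t : Tab) (i x : ℕ) : (h.setTab t i x).low = h.low := rfl

@[simp] theorem reg_setLow (i x : ℕ) : (h.setLow i x).reg = h.reg := rfl

@[simp] theorem tab_setLow (i x : ℕ) : (h.setLow i x).tab = h.tab := rfl

@[simp] theorem low_setLow (i x : ℕ) : (h.setLow i x).low = Function.update h.low i x := rfl

end HState

/-- The machine state `s` represents the abstract state `h`, with tables interleaved above `W`. -/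
structure Rep (W : ℕ) (s : State) (h : HState) : Prop where
  reg : ∀ r, s.reg (Reg.idx r) = h.reg r
  base : s.reg 2 = W
  tab : ∀ t i, s.mem (W + 32 * i + Tab.idx t) = h.tab t i
  low : ∀ a < W, s.mem a = h.low a

/-- Loop-free code on abstract states. -/
inductive Code where
  | skip
  | cst (d : Reg) (c : ℕ)
  | add (d a b : Reg)
  | sub (d a b : Reg)
  /-- `d` becomes the entry of the table `t` with index `i` -/
  | get (d : Reg) (t : Tab) (i : Reg)
  /-- the entry of the table `t` with index `i` becomes `s` -/
  | put (t : Tab) (i s : Reg)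
  | getLow (d a : Reg)
  | putLow (a s : Reg)
  | seq (c₁ c₂ : Code)
  | ite (r : Reg) (c₁ c₂ : Code)

namespace Code

/-- A sequence of codes. -/
def seqs : List Code → Code
  | [] => skip
  | c :: l => seq c (seqs l)

/-- The effect of a code on abstract states. -/
@[simp] def eval : Code → HState → HState
  | skip, h => h
  | cst d c, h => h.setReg d c
  | add d a b, h => h.setReg d (h.reg a + h.reg b)
  | sub d a b, h => h.setReg d (h.reg a - h.reg b)
  | get d t i, h => h.setReg d (h.tab t (h.reg i))
  | put t i s, h => h.setTab t (h.reg i) (h.reg s)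
  | getLow d a, h => h.setReg d (h.low (h.reg a))
  | putLow a s, h => h.setLow (h.reg a) (h.reg s)
  | seq c₁ c₂, h => c₂.eval (c₁.eval h)
  | ite r c₁ c₂, h => if h.reg r ≠ 0 then c₁.eval h else c₂.eval h

@[simp] theorem eval_seqs_nil (h : HState) : (seqs []).eval h = h := rfl

@[simp] theorem eval_seqs_cons (c : Code) (l : List Code) (h : HState) :
    (seqs (c :: l)).eval h = (seqs l).eval (c.eval h) := rfl

/-- All direct memory accesses are below the tables. -/
@[simp] def Ok (W : ℕ) : Code → HState → Prop
  | getLow _ a, h => h.reg a < W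
  | putLow a _, h => h.reg a < W
  | seq c₁ c₂, h => c₁.Ok W h ∧ c₂.Ok W (c₁.eval h)
  | ite r c₁ c₂, h => if h.reg r ≠ 0 then c₁.Ok W h else c₂.Ok W h
  | _, _ => True

@[simp] theorem ok_seqs_nil (W : ℕ) (h : HState) : (seqs []).Ok W h := trivial

@[simp] theorem ok_seqs_cons (W : ℕ) (c : Code) (l : List Code) (h : HState) :
    (seqs (c :: l)).Ok W h ↔ c.Ok W h ∧ (seqs l).Ok W (c.eval h) := Iff.rfl

/-- A bound on the number of machine steps. -/
def cost : Code → ℕ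
  | get _ _ _ => 9
  | put _ _ _ => 9
  | seq c₁ c₂ => c₁.cost + c₂.cost
  | ite _ c₁ c₂ => max c₁.cost c₂.cost + 1
  | _ => 1

/-- The machine code that puts the address of an entry of a table into register `0`. -/
def address (t : Tab) (i : Reg) : Cmd :=
  .seq (.add 0 i.idx i.idx) <| .seq (.add 0 0 0) <| .seq (.add 0 0 0) <| .seq (.add 0 0 0) <|
  .seq (.add 0 0 0) <| .seq (.add 0 0 2) <| .seq (.const 1 t.idx) (.add 0 0 1)

/-- The machine command that carries out a code. -/
def compile : Code → Cmd
  | skip => .skip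
  | cst d c => .const d.idx c
  | add d a b => .add d.idx a.idx b.idx
  | sub d a b => .sub d.idx a.idx b.idx
  | get d t i => .seq (address t i) (.load d.idx 0)
  | put t i s => .seq (address t i) (.store 0 s.idx)
  | getLow d a => .load d.idx a.idx
  | putLow a s => .store a.idx s.idx
  | seq c₁ c₂ => .seq c₁.compile c₂.compile
  | ite r c₁ c₂ => .ifNonzero r.idx c₁.compile c₂.compile

end Code

theorem Reg.idx_ne {r : Reg} : r.idx ≠ 0 ∧ r.idx ≠ 1 ∧ r.idx ≠ 2 := by
  simp only [Reg.idx]; omega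

theorem Rep.update_reg {W : ℕ} {s : State} {h : HState} (hs : Rep W s h) (d : Reg) (x : ℕ) :
    Rep W { s with reg := Function.update s.reg d.idx x } (h.setReg d x) where
  reg r := by
    by_cases hr : r = d
    · simp [hr]
    · dsimp only
      rw [Function.update_of_ne (fun h => hr (Reg.idx_inj.1 h)), hs.reg]; simp [hr]
  base := by dsimp only; rw [Function.update_of_ne (Reg.idx_ne.2.2).symm, hs.base]
  tab := hs.tab
  low := hs.low

theorem Rep.exec_address {W : ℕ} {s : State} {h : HState} (hs : Rep W s h) (t : Tab) (i : Reg) :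
    ∃ s', Exec (Code.address t i) s s' 8 ∧ Rep W s' h ∧ s'.reg 0 = W + 32 * h.reg i + t.idx := by
  refine ⟨_, .seq (.add ..) (.seq (.add ..) (.seq (.add ..) (.seq (.add ..) (.seq (.add ..)
    (.seq (.add ..) (.seq (.const ..) (.add ..))))))), ⟨fun r => ?_, ?_, hs.tab, hs.low⟩, ?_⟩
  · obtain ⟨h0, h1, h2⟩ := Reg.idx_ne (r := r)
    simp [h0, h1, hs.reg]
  · simp [hs.base]
  · simp [hs.base, hs.reg]
    ring

/-- Compiled code simulates the code on abstract states. -/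
theorem Rep.exec_compile {W : ℕ} (c : Code) : ∀ {s : State} {h : HState}, Rep W s h → c.Ok W h →
    ∃ s' t, Exec c.compile s s' t ∧ t ≤ c.cost ∧ Rep W s' (c.eval h) := by
  induction c with
  | skip => exact fun hs _ => ⟨_, _, .skip _, le_rfl, hs⟩
  | cst d c => exact fun hs _ => ⟨_, _, .const .., le_rfl, hs.update_reg d _⟩
  | add d a b =>
    intro s h hs _
    refine ⟨_, _, .add .., le_rfl, ?_⟩
    rw [hs.reg, hs.reg]
    exact hs.update_reg d _
  | sub d a b =>
    intro s h hs _
    refine ⟨_, _, .sub .., le_rfl, ?_⟩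
    rw [hs.reg, hs.reg]
    exact hs.update_reg d _
  | get d t i =>
    intro s h hs _
    obtain ⟨s', he, hs', h0⟩ := hs.exec_address t i
    refine ⟨_, _, .seq he (.load ..), le_rfl, ?_⟩
    rw [h0, hs'.tab]
    exact hs'.update_reg d _
  | put t i x =>
    intro s h hs _
    obtain ⟨s', he, hs', h0⟩ := hs.exec_address t i
    refine ⟨_, _, .seq he (.store ..), le_rfl, ⟨hs'.reg, hs'.base, fun t' i' => ?_, fun a ha => ?_⟩⟩
    · rw [h0]
      simp only [Code.eval, HState.tab_setTab]
      by_cases ht : t' = t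
      · subst ht
        by_cases hi : i' = h.reg i
        · rw [hi]; simp [hs'.reg]
        · have := t'.idx_lt
          rw [Function.update_of_ne (by omega), hs'.tab]; simp [hi]
      · have h1 := t'.idx_lt
        have h2 := t.idx_lt
        have h3 : t'.idx ≠ t.idx := fun h => ht (Tab.idx_inj.1 h)
        rw [Function.update_of_ne (by omega), hs'.tab, if_neg ht]
    · dsimp only
      rw [h0, Function.update_of_ne (by omega), hs'.low a ha]
      rfl
  | getLow d a =>
    intro s h hs hok
    refine ⟨_, _, .load .., le_rfl, ?_⟩
    rw [hs.reg, hs.low _ hok]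
    exact hs.update_reg d _
  | putLow a x =>
    intro s h hs hok
    have hok : h.reg a < W := hok
    refine ⟨_, _, .store .., le_rfl, ⟨hs.reg, hs.base, fun t' i' => ?_, fun a' ha => ?_⟩⟩
    · dsimp only
      rw [hs.reg, Function.update_of_ne (by omega), hs.tab]
      rfl
    · rw [hs.reg, hs.reg]
      simp only [Code.eval, HState.low_setLow, Function.update_apply]
      rw [hs.low a' ha]
  | seq c₁ c₂ ih₁ ih₂ =>
    intro s h hs hok
    obtain ⟨s₁, t₁, he₁, ht₁, hs₁⟩ := ih₁ hs hok.1
    obtain ⟨s₂, t₂, he₂, ht₂, hs₂⟩ := ih₂ hs₁ hok.2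
    exact ⟨s₂, _, .seq he₁ he₂, Nat.add_le_add ht₁ ht₂, hs₂⟩
  | ite r c₁ c₂ ih₁ ih₂ =>
    intro s h hs hok
    by_cases hr : h.reg r = 0
    · simp only [Code.Ok, hr, ne_eq, not_true_eq_false, if_false] at hok
      obtain ⟨s', t, he, ht, hs'⟩ := ih₂ hs hok
      refine ⟨s', _, .ifFalse (by rw [hs.reg, hr]) he, ?_, by simpa [hr] using hs'⟩
      exact Nat.succ_le_succ (ht.trans (le_max_right _ _))
    · simp only [Code.Ok, hr, ne_eq, not_false_eq_true, if_true] at hok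
      obtain ⟨s', t, he, ht, hs'⟩ := ih₁ hs hok
      refine ⟨s', _, .ifTrue (by rwa [hs.reg]) he, ?_, by simpa [hr] using hs'⟩
      exact Nat.succ_le_succ (ht.trans (le_max_left _ _))

/-- Started in a state that represents `h`, the command `c` stops after at most `T` steps in a state
that represents an abstract state with property `Q`. -/
def Runs (W : ℕ) (c : Cmd) (h : HState) (T : ℕ) (Q : HState → Prop) : Prop :=
  ∀ s, Rep W s h → ∃ s' t h', Exec c s s' t ∧ t ≤ T ∧ Rep W s' h' ∧ Q h'

theorem Runs.code {W : ℕ} {c : Code} {h : HState} {Q : HState → Prop} (hok : c.Ok W h)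
    (hQ : Q (c.eval h)) : Runs W c.compile h c.cost Q := fun s hs => by
  obtain ⟨s', t, he, ht, hs'⟩ := hs.exec_compile c hok
  exact ⟨s', t, _, he, ht, hs', hQ⟩

theorem Runs.mono {W : ℕ} {c : Cmd} {h : HState} {T T' : ℕ} {Q Q' : HState → Prop}
    (hc : Runs W c h T Q) (hT : T ≤ T') (hQ : ∀ h', Q h' → Q' h') : Runs W c h T' Q' :=
  fun s hs => by
    obtain ⟨s', t, h', he, ht, hs', hq⟩ := hc s hs
    exact ⟨s', t, h', he, ht.trans hT, hs', hQ h' hq⟩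

theorem Runs.seq {W : ℕ} {c₁ c₂ : Cmd} {h : HState} {T₁ T₂ : ℕ} {Q₁ Q : HState → Prop}
    (h₁ : Runs W c₁ h T₁ Q₁) (h₂ : ∀ h', Q₁ h' → Runs W c₂ h' T₂ Q) :
    Runs W (.seq c₁ c₂) h (T₁ + T₂) Q := fun s hs => by
  obtain ⟨s₁, t₁, h₁', he₁, ht₁, hs₁, hq₁⟩ := h₁ s hs
  obtain ⟨s₂, t₂, h₂', he₂, ht₂, hs₂, hq₂⟩ := h₂ _ hq₁ s₁ hs₁
  exact ⟨s₂, _, h₂', .seq he₁ he₂, Nat.add_le_add ht₁ ht₂, hs₂, hq₂⟩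

/-- A loop whose body takes at most `T` steps and decreases the variant `μ`. -/
theorem Runs.loop {W : ℕ} {r : Reg} {c : Cmd} {T : ℕ} (I : ℕ → HState → Prop)
    (hbody : ∀ μ h, I μ h → h.reg r ≠ 0 → Runs W c h T fun h' => ∃ μ' < μ, I μ' h') :
    ∀ μ h, I μ h → Runs W (.whileNonzero r.idx c) h ((T + 1) * μ + 1)
      fun h' => (∃ μ', I μ' h') ∧ h'.reg r = 0 := by
  intro μ
  induction μ using Nat.strong_induction_on with
  | _ μ ih =>
    intro h hI s hs
    by_cases hr : h.reg r = 0
    · exact ⟨s, 1, h, .whileFalse (by rw [hs.reg, hr]), Nat.le_add_left _ _, hs, ⟨μ, hI⟩, hr⟩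
    · obtain ⟨s₁, t₁, h₁, he₁, ht₁, hs₁, μ', hμ', hI'⟩ := hbody μ h hI hr s hs
      obtain ⟨s₂, t₂, h₂, he₂, ht₂, hs₂, hq⟩ := ih μ' hμ' h₁ hI' s₁ hs₁
      refine ⟨s₂, _, h₂, .whileTrue (by rwa [hs.reg]) he₁ he₂, ?_, hs₂, hq⟩
      have : (T + 1) * (μ' + 1) ≤ (T + 1) * μ := Nat.mul_le_mul_left _ hμ'
      rw [Nat.mul_add, Nat.mul_one] at this
      omega

/-- A counted loop: the invariant is indexed by the number of remaining rounds. -/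
theorem Runs.countdown {W : ℕ} {r : Reg} {c : Cmd} {T : ℕ} (I : ℕ → HState → Prop)
    (hr : ∀ μ h, I μ h → (h.reg r = 0 ↔ μ = 0))
    (hbody : ∀ μ h, I (μ + 1) h → Runs W c h T (I μ)) :
    ∀ μ h, I μ h → Runs W (.whileNonzero r.idx c) h ((T + 1) * μ + 1) (I 0) := by
  intro μ h hI
  refine (Runs.loop I (fun μ h hI hne => ?_) μ h hI).mono le_rfl ?_
  · obtain _ | μ := μ
    · exact absurd ((hr 0 h hI).2 rfl) hne
    · exact (hbody μ h hI).mono le_rfl fun h' h'' => ⟨μ, Nat.lt_succ_self μ, h''⟩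
  · rintro h' ⟨⟨μ', h1⟩, h2⟩
    rwa [(hr μ' h' h1).1 h2] at h1

end RAM

namespace RAM

open Relation

/-! ### Graph search -/

/-- The table `f` holds the list `l` as a stack: the head of the list is the top of the stack. -/
def IsStack (f : ℕ → ℕ) : List ℕ → Prop
  | [] => True
  | x :: l => f l.length = x ∧ IsStack f l

theorem IsStack.update {f : ℕ → ℕ} : ∀ {l : List ℕ}, IsStack f l → ∀ {i : ℕ}, l.length ≤ i →
    ∀ x, IsStack (Function.update f i x) l
  | [], _, _, _, _ => trivial
  | y :: l, h, i, hi, x => by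
    simp only [List.length_cons] at hi
    exact ⟨by rw [Function.update_of_ne (by omega)]; exact h.1, h.2.update (by omega) x⟩

theorem IsStack.push {f : ℕ → ℕ} {l : List ℕ} (h : IsStack f l) (x : ℕ) :
    IsStack (Function.update f l.length x) (x :: l) :=
  ⟨Function.update_self _ _ _, h.update le_rfl x⟩

/-- A linked list: the links `e` and `next ε` are `0` at the end and the successor of the next
entry otherwise. -/
def IsLinked (next : ℕ → ℕ) : ℕ → List ℕ → Prop
  | e, [] => e = 0
  | e, ε :: l => e = ε + 1 ∧ IsLinked next (next ε) l

theorem IsLinked.eq_zero_iff {next : ℕ → ℕ} {e : ℕ} {l : List ℕ} (h : IsLinked next e l) :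
    e = 0 ↔ l = [] := by
  cases l with
  | nil => exact iff_of_true h rfl
  | cons ε l => simp [h.1]

/-- The digraph whose arcs that leave `v` are listed by `adj v`, and end at the vertices `far`. -/
def Arc (adj : ℕ → List ℕ) (far : ℕ → ℕ) (v w : ℕ) : Prop := ∃ ε ∈ adj v, far ε = w

/-- The state of a graph search from several roots in succession: the labels of the vertices, the
vertices whose arcs have not been scanned yet, the arcs that remain to be scanned at the current
vertex, the starting points that remain, and the roots. A vertex gets the label `o + 1` when it is
found from the root `o`. -/
structure Search where
  lab : ℕ → ℕ
  stack : List ℕ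
  pend : List ℕ
  todo : List ℕ
  roots : List ℕ
  cur : ℕ

namespace Search

/-- The invariant of a search with the starting points `T`. Every vertex on the stack has the label
of the current root, and a later root is not reachable from an earlier one. -/
structure Inv (adj : ℕ → List ℕ) (far : ℕ → ℕ) (N : ℕ) (T : List ℕ) (S : Search) : Prop where
  done : ∃ dn, dn ++ S.todo = T ∧ S.roots.reverse.Sublist dn ∧ ∀ v ∈ dn, S.lab v ≠ 0
  sound : ∀ v, S.lab v ≠ 0 → v < N ∧
    ∃ o ∈ S.roots, S.lab v = o + 1 ∧ ReflTransGen (Arc adj far) o v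
  closed : ∀ v, S.lab v ≠ 0 → ∀ ε ∈ adj v, S.lab (far ε) ≠ 0 ∨ v ∈ S.stack ∨ ε ∈ S.pend
  stack : ∀ v ∈ S.stack, S.lab v ≠ 0 ∧ S.lab v = S.cur
  pend : ∀ ε ∈ S.pend, ∃ v, ε ∈ adj v ∧ S.lab v ≠ 0 ∧ S.lab v = S.cur
  roots : ∀ o ∈ S.roots, S.lab o ≠ 0
  pairwise : S.roots.Pairwise fun a b => ¬ ReflTransGen (Arc adj far) b a

/-- A bound on the number of rounds that remain: one for every arc that may be scanned, and up to
two for every vertex, which is found and later taken from the stack. -/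
def size (adj : ℕ → List ℕ) (N : ℕ) (S : Search) : ℕ :=
  ∑ v ∈ Finset.range N, (if S.lab v = 0 then (adj v).length + 2 else 0) +
    (S.stack.map fun v => (adj v).length + 1).sum + S.pend.length + S.todo.length

variable {adj : ℕ → List ℕ} {far : ℕ → ℕ} {N : ℕ} {T : List ℕ} {S : Search}

theorem sum_update_label {lab : ℕ → ℕ} {w c : ℕ} (hw : w < N) (h0 : lab w = 0) (hc : c ≠ 0)
    (g : ℕ → ℕ) : ∑ v ∈ Finset.range N, (if lab v = 0 then g v else 0) =
      ∑ v ∈ Finset.range N, (if Function.update lab w c v = 0 then g v else 0) + g w := by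
  have hw' := Finset.mem_range.2 hw
  rw [← Finset.add_sum_erase _ _ hw', ← Finset.add_sum_erase _ _ hw', if_pos h0,
    Function.update_self, if_neg hc, zero_add, add_comm]
  congr 1
  refine Finset.sum_congr rfl fun v hv => ?_
  rw [Function.update_of_ne (Finset.ne_of_mem_erase hv)]

theorem Inv.scan_old (hS : S.Inv adj far N T) {ε : ℕ} {l : List ℕ} (hp : S.pend = ε :: l)
    (h : S.lab (far ε) ≠ 0) : Inv adj far N T { S with pend := l } where
  done := hS.done
  sound := hS.sound
  closed v hv δ hδ := by
    rcases hS.closed v hv δ hδ with h1 | h1 | h1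
    · exact Or.inl h1
    · exact Or.inr (Or.inl h1)
    · rw [hp] at h1
      rcases List.mem_cons.1 h1 with rfl | h1
      · exact Or.inl h
      · exact Or.inr (Or.inr h1)
  stack := hS.stack
  pend δ hδ := hS.pend δ (by rw [hp]; exact List.mem_cons_of_mem _ hδ)
  roots := hS.roots
  pairwise := hS.pairwise

theorem Inv.scan_new (hS : S.Inv adj far N T) (hfar : ∀ v, v < N → ∀ ε ∈ adj v, far ε < N)
    {ε : ℕ} {l : List ℕ} (hp : S.pend = ε :: l) (h : S.lab (far ε) = 0) :
    Inv adj far N T { S with lab := Function.update S.lab (far ε) S.cur,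
                             stack := far ε :: S.stack, pend := l } ∧ S.cur ≠ 0 ∧ far ε < N := by
  obtain ⟨v₀, hv₀, hl₀, hc₀⟩ := hS.pend ε (by rw [hp]; exact List.mem_cons_self)
  have hc : S.cur ≠ 0 := hc₀ ▸ hl₀
  obtain ⟨hvN, o, ho, hlo, hreach⟩ := hS.sound v₀ hl₀
  have hN := hfar v₀ hvN ε hv₀
  have hne : ∀ {v}, S.lab v ≠ 0 → v ≠ far ε := fun hv h' => hv (h' ▸ h)
  have hmono : ∀ {v}, S.lab v ≠ 0 → Function.update S.lab (far ε) S.cur v ≠ 0 := fun hv => by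
    rwa [Function.update_of_ne (hne hv)]
  refine ⟨⟨?_, fun v hv => ?_, fun v hv δ hδ => ?_, fun v hv => ?_, fun δ hδ => ?_,
    fun o ho => hmono (hS.roots o ho), hS.pairwise⟩, hc, hN⟩
  · obtain ⟨dn, h1, h2, h3⟩ := hS.done
    exact ⟨dn, h1, h2, fun v hv => hmono (h3 v hv)⟩
  · by_cases hvf : v = far ε
    · subst hvf
      refine ⟨hN, o, ho, ?_, hreach.tail ⟨ε, hv₀, rfl⟩⟩
      simp only [Function.update_self]
      rw [← hc₀, hlo]
    · simp only [Function.update_of_ne hvf] at hv ⊢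
      exact hS.sound v hv
  · by_cases hvf : v = far ε
    · exact Or.inr (Or.inl (by simp [hvf]))
    · simp only [Function.update_of_ne hvf] at hv
      rcases hS.closed v hv δ hδ with h1 | h1 | h1
      · exact Or.inl (hmono h1)
      · exact Or.inr (Or.inl (List.mem_cons_of_mem _ h1))
      · rw [hp] at h1
        rcases List.mem_cons.1 h1 with rfl | h1
        · exact Or.inl (by simpa using hc)
        · exact Or.inr (Or.inr h1)
  · rcases List.mem_cons.1 hv with rfl | hv
    · simpa using hc
    · have := hS.stack v hv
      simpa only [Function.update_of_ne (hne this.1)] using this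
  · obtain ⟨v, h1, h2, h3⟩ := hS.pend δ (by rw [hp]; exact List.mem_cons_of_mem _ hδ)
    exact ⟨v, h1, hmono h2, by simpa only [Function.update_of_ne (hne h2)] using h3⟩

theorem Inv.pop (hS : S.Inv adj far N T) {v : ℕ} {l : List ℕ} (hp : S.pend = [])
    (hs : S.stack = v :: l) : Inv adj far N T { S with stack := l, pend := adj v } where
  done := hS.done
  sound := hS.sound
  closed w hw δ hδ := by
    rcases hS.closed w hw δ hδ with h1 | h1 | h1
    · exact Or.inl h1
    · rw [hs] at h1
      rcases List.mem_cons.1 h1 with rfl | h1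
      · exact Or.inr (Or.inr hδ)
      · exact Or.inr (Or.inl h1)
    · simp [hp] at h1
  stack w hw := hS.stack w (by rw [hs]; exact List.mem_cons_of_mem _ hw)
  pend δ hδ := ⟨v, hδ, hS.stack v (by rw [hs]; exact List.mem_cons_self)⟩
  roots := hS.roots
  pairwise := hS.pairwise

theorem Inv.start_old (hS : S.Inv adj far N T) {v : ℕ} {l : List ℕ} (ht : S.todo = v :: l)
    (hv : S.lab v ≠ 0) : Inv adj far N T { S with todo := l } where
  done := by
    obtain ⟨dn, h1, h2, h3⟩ := hS.done
    refine ⟨dn ++ [v], by rw [← h1, ht]; simp, h2.trans (List.sublist_append_left _ _), ?_⟩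
    simpa [or_imp, forall_and] using ⟨h3, hv⟩
  sound := hS.sound
  closed := hS.closed
  stack := hS.stack
  pend := hS.pend
  roots := hS.roots
  pairwise := hS.pairwise

/-- When no arcs remain to be scanned, the labelled vertices are closed under reachability. -/
theorem Inv.label_of_reach (hS : S.Inv adj far N T) (hp : S.pend = []) (hs : S.stack = [])
    {v w : ℕ} (hv : S.lab v ≠ 0) (h : ReflTransGen (Arc adj far) v w) : S.lab w ≠ 0 := by
  induction h with
  | refl => exact hv
  | @tail b c _ hbc ih =>
    obtain ⟨ε, hε, rfl⟩ := hbc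
    simpa [hp, hs] using hS.closed b ih ε hε

theorem Inv.start_new (hS : S.Inv adj far N T) (hT : ∀ v ∈ T, v < N) {v : ℕ} {l : List ℕ}
    (hp : S.pend = []) (hs : S.stack = []) (ht : S.todo = v :: l) (hv : S.lab v = 0) :
    Inv adj far N T { S with lab := Function.update S.lab v (v + 1), stack := [v], todo := l,
                             roots := v :: S.roots, cur := v + 1 } ∧ v < N := by
  obtain ⟨dn, h1, h2, h3⟩ := hS.done
  have hN : v < N := hT v (by rw [← h1, ht]; simp)
  have hne : ∀ {w}, S.lab w ≠ 0 → w ≠ v := fun hw h' => hw (h' ▸ hv)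
  have hmono : ∀ {w}, S.lab w ≠ 0 → Function.update S.lab v (v + 1) w ≠ 0 := fun hw => by
    rwa [Function.update_of_ne (hne hw)]
  refine ⟨⟨⟨dn ++ [v], by rw [← h1, ht]; simp, ?_, fun w hw => ?_⟩, fun w hw => ?_,
    fun w hw δ hδ => ?_, fun w hw => ?_, fun δ hδ => ?_, fun o ho => ?_, ?_⟩, hN⟩
  · rw [List.reverse_cons]
    exact h2.append (List.Sublist.refl _)
  · rcases List.mem_append.1 hw with hw | hw
    · exact hmono (h3 w hw)
    · rw [List.mem_singleton.1 hw]; simp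
  · by_cases hwv : w = v
    · subst hwv
      exact ⟨hN, w, List.mem_cons_self, by simp, .refl⟩
    · simp only [Function.update_of_ne hwv] at hw ⊢
      obtain ⟨h4, o, ho, h5⟩ := hS.sound w hw
      exact ⟨h4, o, List.mem_cons_of_mem _ ho, h5⟩
  · by_cases hwv : w = v
    · exact Or.inr (Or.inl (by simp [hwv]))
    · simp only [Function.update_of_ne hwv] at hw
      exact Or.inl (hmono (by simpa [hp, hs] using hS.closed w hw δ hδ))
  · rw [List.mem_singleton.1 hw]; simp
  · simp [hp] at hδ
  · rcases List.mem_cons.1 ho with rfl | ho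
    · simp
    · exact hmono (hS.roots o ho)
  · exact List.pairwise_cons.2 ⟨fun o ho h =>
      hS.label_of_reach hp hs (hS.roots o ho) h hv, hS.pairwise⟩

end Search

/-- The outcome of a search with the starting points `T`. -/
structure IsSweep (adj : ℕ → List ℕ) (far : ℕ → ℕ) (N : ℕ) (T : List ℕ) (lab : ℕ → ℕ)
    (roots : List ℕ) : Prop where
  sound : ∀ v, lab v ≠ 0 → v < N ∧ ∃ o ∈ roots, lab v = o + 1 ∧ ReflTransGen (Arc adj far) o v
  complete : ∀ v ∈ T, ∀ w, ReflTransGen (Arc adj far) v w → lab w ≠ 0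
  sublist : roots.reverse.Sublist T
  pairwise : roots.Pairwise fun a b => ¬ ReflTransGen (Arc adj far) b a

section Program

open Reg Code

/-- One round of a search: scan an arc, or take a vertex from the stack, or else take the next
starting point. -/
def sweepBody (head next far lab start out : Tab) : Code :=
  seqs [
    ite arc
      (seqs [sub arc arc one, get wtx far arc, get arc next arc, get tmp lab wtx,
        ite tmp skip (seqs [put lab wtx root, put .stk stkLen wtx, add stkLen stkLen one])])
      (ite stkLen
        (seqs [sub stkLen stkLen one, get vtx .stk stkLen, get arc head vtx])
        (seqs [sub todoLen todoLen one, get vtx start todoLen, get tmp lab vtx,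
          ite tmp skip (seqs [add root vtx one, put lab vtx root, put out outLen vtx,
            add outLen outLen one, put .stk stkLen vtx, add stkLen stkLen one])])),
    add go arc stkLen, add go go todoLen]

/-- The search from the starting points in the table `start`, of which there are `todoLen`: label
the vertices in the table `lab`, and list the roots in the table `out`. -/
def sweep (head next far lab start out : Tab) : Cmd :=
  .seq (seqs [cst outLen 0, cst stkLen 0, cst arc 0, cst root 0, add go todoLen arc]).compile
    (.whileNonzero go.idx (sweepBody head next far lab start out).compile)

/-- The abstract machine state represents the search `S`. -/
structure RepSearch (head next far lab start out : Tab) (adj : ℕ → List ℕ) (N : ℕ)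
    (h : HState) (S : Search) : Prop where
  head : ∀ v < N, IsLinked (h.tab next) (h.tab head v) (adj v)
  one : h.reg one = 1
  lab : h.tab lab = S.lab
  stack : IsStack (h.tab .stk) S.stack
  stkLen : h.reg stkLen = S.stack.length
  pend : IsLinked (h.tab next) (h.reg arc) S.pend
  todo : IsStack (h.tab start) S.todo
  todoLen : h.reg todoLen = S.todo.length
  roots : IsStack (h.tab out) S.roots
  outLen : h.reg outLen = S.roots.length
  root : h.reg root = S.cur
  go : h.reg go = h.reg arc + h.reg Reg.stkLen + h.reg Reg.todoLen

/-- Everything except the given registers and tables is the same in both states. -/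
def SameExcept (R : List Reg) (L : List Tab) (h h' : HState) : Prop :=
  (∀ r, r ∉ R → h'.reg r = h.reg r) ∧ (∀ t, t ∉ L → h'.tab t = h.tab t) ∧ h'.low = h.low

theorem SameExcept.trans {R : List Reg} {L : List Tab} {h h' h'' : HState}
    (h₁ : SameExcept R L h h') (h₂ : SameExcept R L h' h'') : SameExcept R L h h'' :=
  ⟨fun r hr => (h₂.1 r hr).trans (h₁.1 r hr), fun t ht => (h₂.2.1 t ht).trans (h₁.2.1 t ht),
    h₂.2.2.trans h₁.2.2⟩

/-- The registers that a search changes. -/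
def sweepRegs : List Reg := [outLen, stkLen, arc, root, go, wtx, vtx, tmp, todoLen]

/-- One round carries out one step of the search, and makes it smaller. -/
theorem sweepBody_step {head next far lab start out : Tab} {adj : ℕ → List ℕ} {N : ℕ} {T : List ℕ}
    (hnd : [lab, out, .stk, head, next, far, start].Nodup) (hT : ∀ v ∈ T, v < N)
    {h : HState} {S : Search} (hR : RepSearch head next far lab start out adj N h S)
    (hfar : ∀ v < N, ∀ ε ∈ adj v, h.tab far ε < N)
    (hS : S.Inv adj (h.tab far) N T) (hgo : h.reg go ≠ 0) :
    ∃ S', RepSearch head next far lab start out adj N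
        ((sweepBody head next far lab start out).eval h) S' ∧
      S'.Inv adj (h.tab far) N T ∧ S'.size adj N < S.size adj N ∧
      SameExcept sweepRegs [lab, out, .stk] h
        ((sweepBody head next far lab start out).eval h) := by
  simp only [List.nodup_cons, List.mem_cons, List.not_mem_nil, or_false, not_or, not_false_eq_true,
    List.nodup_nil, and_true] at hnd
  obtain ⟨⟨n1, n2, n3, n4, n5, n6⟩, ⟨n7, n8, n9, n10, n11⟩, ⟨n12, n13, n14, n15⟩, -⟩ := hnd
  have m1 := Ne.symm n1
  have m2 := Ne.symm n2
  have m3 := Ne.symm n3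
  have m4 := Ne.symm n4
  have m6 := Ne.symm n6
  have m7 := Ne.symm n7
  have m8 := Ne.symm n8
  have m9 := Ne.symm n9
  have m11 := Ne.symm n11
  have m12 := Ne.symm n12
  have m13 := Ne.symm n13
  have m15 := Ne.symm n15
  generalize hev : (sweepBody head next far lab start out).eval h = h'
  rcases hp : S.pend with _ | ⟨ε, l⟩
  · have hpend := hR.pend
    rw [hp] at hpend
    have ha : h.reg arc = 0 := hpend
    rcases hs : S.stack with _ | ⟨v, l⟩
    · have hk : h.reg stkLen = 0 := by rw [hR.stkLen, hs]; rfl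
      rcases ht : S.todo with _ | ⟨v, l⟩
      · exact absurd (by rw [hR.go, ha, hk, hR.todoLen, ht]; rfl) hgo
      · have htodo := hR.todo
        have htl := hR.todoLen
        rw [ht] at htodo htl
        rw [List.length_cons] at htl
        obtain ⟨hv, hl⟩ := htodo
        by_cases hlab : S.lab v = 0
        · obtain ⟨hS', hN⟩ := hS.start_new hT hp hs ht hlab
          simp [sweepBody, ha, hk, htl, hv, hR.one, hR.lab, hlab] at hev
          subst hev
          refine ⟨_, ⟨?_, ?_, ?_, ?_, ?_, ?_, ?_, ?_, ?_, ?_, ?_, ?_⟩, hS', ?_, ?_, ?_, ?_⟩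
          · simpa [m3, m4, m8, m9, m12, m13] using hR.head
          · simpa using hR.one
          · simp [n1, n2, hR.lab]
          · simp [IsStack]
          · simp
          · simp [hp, IsLinked, ha]
          · simpa [m6, m11, m15] using hl
          · simp
          · simpa [m1, n7, hR.outLen] using hR.roots.push v
          · simp [hR.outLen]
          · simp
          · simp [ha]
          · simp only [Search.size, hp, hs, ht]
            rw [Search.sum_update_label hN hlab (Nat.succ_ne_zero v)]
            simp
            omega
          · intro r hr
            simp only [sweepRegs, List.mem_cons, List.not_mem_nil, or_false, not_or] at hr
            simp [hr]
          · intro t ht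
            simp only [List.mem_cons, List.not_mem_nil, or_false, not_or] at ht
            simp [ht]
          · simp
        · simp [sweepBody, ha, hk, htl, hv, hR.one, hR.lab, hlab] at hev
          subst hev
          refine ⟨_, ⟨?_, ?_, ?_, ?_, ?_, ?_, ?_, ?_, ?_, ?_, ?_, ?_⟩, hS.start_old ht hlab,
            ?_, ?_, ?_, ?_⟩
          · simpa using hR.head
          · simpa using hR.one
          · simpa using hR.lab
          · simpa using hR.stack
          · simpa using hR.stkLen
          · simpa using hR.pend
          · simpa using hl
          · simp
          · simpa using hR.roots
          · simpa using hR.outLen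
          · simpa using hR.root
          · simp [ha, hk]
          · simp [Search.size, ht]
          · intro r hr
            simp only [sweepRegs, List.mem_cons, List.not_mem_nil, or_false, not_or] at hr
            simp [hr]
          · intro t _
            simp
          · simp
    · have hstack := hR.stack
      have hk := hR.stkLen
      rw [hs] at hstack hk
      rw [List.length_cons] at hk
      obtain ⟨hv, hl⟩ := hstack
      have hN := (hS.sound v (hS.stack v (by rw [hs]; exact List.mem_cons_self)).1).1
      simp [sweepBody, ha, hk, hv, hR.one] at hev
      subst hev
      refine ⟨_, ⟨?_, ?_, ?_, ?_, ?_, ?_, ?_, ?_, ?_, ?_, ?_, ?_⟩, hS.pop hp hs, ?_, ?_, ?_, ?_⟩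
      · simpa using hR.head
      · simpa using hR.one
      · simpa using hR.lab
      · simpa using hl
      · simp
      · simpa using hR.head v hN
      · simpa using hR.todo
      · simpa using hR.todoLen
      · simpa using hR.roots
      · simpa using hR.outLen
      · simpa using hR.root
      · simp
      · simp only [Search.size, hp, hs, List.map_cons, List.sum_cons, List.length_nil]
        omega
      · intro r hr
        simp only [sweepRegs, List.mem_cons, List.not_mem_nil, or_false, not_or] at hr
        simp [hr]
      · intro t _
        simp
      · simp
  · have hpend := hR.pend
    rw [hp] at hpend
    obtain ⟨ha, hl⟩ := hpend
    by_cases hlab : S.lab (h.tab far ε) = 0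
    · obtain ⟨hS', hc, hN⟩ := hS.scan_new hfar hp hlab
      simp [sweepBody, ha, hR.one, hR.lab, hlab] at hev
      subst hev
      refine ⟨_, ⟨?_, ?_, ?_, ?_, ?_, ?_, ?_, ?_, ?_, ?_, ?_, ?_⟩, hS', ?_, ?_, ?_, ?_⟩
      · simpa [m3, m4, m12, m13] using hR.head
      · simpa using hR.one
      · simp [n2, hR.root, hR.lab]
      · simpa [hR.stkLen, m2] using hR.stack.push (h.tab far ε)
      · simp [hR.stkLen]
      · simpa [m4, m13] using hl
      · simpa [m6, m15] using hR.todo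
      · simpa using hR.todoLen
      · simpa [m1, n7] using hR.roots
      · simpa using hR.outLen
      · simpa using hR.root
      · simp
      · simp only [Search.size, hp]
        rw [Search.sum_update_label hN hlab hc]
        simp
        omega
      · intro r hr
        simp only [sweepRegs, List.mem_cons, List.not_mem_nil, or_false, not_or] at hr
        simp [hr]
      · intro t ht
        simp only [List.mem_cons, List.not_mem_nil, or_false, not_or] at ht
        simp [ht]
      · simp
    · simp [sweepBody, ha, hR.one, hR.lab, hlab] at hev
      subst hev
      refine ⟨_, ⟨?_, ?_, ?_, ?_, ?_, ?_, ?_, ?_, ?_, ?_, ?_, ?_⟩, hS.scan_old hp hlab,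
        ?_, ?_, ?_, ?_⟩
      · simpa using hR.head
      · simpa using hR.one
      · simpa using hR.lab
      · simpa using hR.stack
      · simpa using hR.stkLen
      · simpa using hl
      · simpa using hR.todo
      · simpa using hR.todoLen
      · simpa using hR.roots
      · simpa using hR.outLen
      · simpa using hR.root
      · simp
      · simp [Search.size, hp]
      · intro r hr
        simp only [sweepRegs, List.mem_cons, List.not_mem_nil, or_false, not_or] at hr
        simp [hr]
      · intro t _
        simp
      · simp

theorem sweepBody_ok (W : ℕ) (head next far lab start out : Tab) (h : HState) :
    (sweepBody head next far lab start out).Ok W h := by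
  simp [sweepBody]

/-- The search started with the empty table of labels finds, in time linear in the number of
vertices, arcs and starting points, everything that is reachable from the starting points. -/
theorem runs_sweep {W : ℕ} {head next far lab start out : Tab} {adj : ℕ → List ℕ} {N : ℕ}
    {T : List ℕ} (hnd : [lab, out, .stk, head, next, far, start].Nodup) (hT : ∀ v ∈ T, v < N)
    {h : HState} (hone : h.reg one = 1)
    (hadj : ∀ v < N, IsLinked (h.tab next) (h.tab head v) (adj v))
    (hfar : ∀ v < N, ∀ ε ∈ adj v, h.tab far ε < N) (hlab : ∀ v, h.tab lab v = 0)
    (hstart : IsStack (h.tab start) T) (hlen : h.reg todoLen = T.length) :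
    Runs W (sweep head next far lab start out) h
      (100 * (∑ v ∈ Finset.range N, ((adj v).length + 2) + T.length) + 7)
      fun h' => ∃ roots, IsStack (h'.tab out) roots ∧ h'.reg outLen = roots.length ∧
        IsSweep adj (h.tab far) N T (h'.tab lab) roots ∧
        SameExcept sweepRegs [lab, out, .stk] h h' := by
  have hnf : far ∉ [lab, out, .stk] := by
    simp only [List.nodup_cons, List.mem_cons, List.not_mem_nil, or_false, not_or] at hnd
    simp only [List.mem_cons, List.not_mem_nil, or_false, not_or]
    exact ⟨Ne.symm hnd.1.2.2.2.2.1, Ne.symm hnd.2.1.2.2.2.1, Ne.symm hnd.2.2.1.2.2.1⟩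
  refine (Runs.seq (T₁ := 6) (Q₁ := fun h' => ∃ S,
    RepSearch head next far lab start out adj N h' S ∧ S.Inv adj (h.tab far) N T ∧
    S.size adj N = ∑ v ∈ Finset.range N, ((adj v).length + 2) + T.length ∧
    SameExcept sweepRegs [lab, out, .stk] h h') (Runs.code ?_ ?_)
    (T₂ := 100 * (∑ v ∈ Finset.range N, ((adj v).length + 2) + T.length) + 1)
    fun h' hh' => ?_).mono (by omega) fun _ h => h
  · simp
  · refine ⟨⟨h.tab lab, [], [], T, [], 0⟩, ⟨?_, ?_, ?_, ?_, ?_, ?_, ?_, ?_, ?_, ?_, ?_, ?_⟩,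
      ⟨⟨[], rfl, by simp, by simp⟩, ?_, ?_, ?_, ?_, ?_, ?_⟩, ?_, ?_, ?_, ?_⟩
    · simpa using hadj
    · simpa using hone
    · simp
    · trivial
    · simp
    · simp [IsLinked]
    · simpa using hstart
    · simpa using hlen
    · trivial
    · simp
    · simp
    · simp
    · simp [hlab]
    · simp [hlab]
    · simp
    · simp
    · simp
    · simp
    · simp [Search.size, hlab]
    · intro r hr
      simp only [sweepRegs, List.mem_cons, List.not_mem_nil, or_false, not_or] at hr
      simp [hr]
    · simp
    · simp
  · obtain ⟨S, hR, hS, hsz, hsame⟩ := hh'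
    refine (Runs.loop (T := 99) (fun μ h' => ∃ S : Search,
      RepSearch head next far lab start out adj N h' S ∧ S.Inv adj (h.tab far) N T ∧
      S.size adj N = μ ∧ SameExcept sweepRegs [lab, out, .stk] h h')
      ?_ _ h' ⟨S, hR, hS, rfl, hsame⟩).mono (by rw [hsz]) ?_
    · rintro μ h₁ ⟨S, hR, hS, hsz, hsame⟩ hgo
      have hf : h₁.tab far = h.tab far := hsame.2.1 far hnf
      rw [← hf] at hS
      obtain ⟨S', hR', hS', hlt, hsame'⟩ :=
        sweepBody_step hnd hT hR (by rwa [hf]) hS hgo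
      have hc : (sweepBody head next far lab start out).cost ≤ 99 := by
        simp [sweepBody, cost, seqs]
      refine (Runs.code (sweepBody_ok ..) ?_).mono hc fun _ h => h
      rw [hf] at hS'
      exact ⟨_, hsz ▸ hlt, S', hR', hS', rfl, hsame.trans hsame'⟩
    · rintro h'' ⟨⟨μ, S, hR, hS, -, hsame⟩, hgo⟩
      have hg := hR.go
      rw [hgo] at hg
      have hp : S.pend = [] := hR.pend.eq_zero_iff.1 (by omega)
      have hs : S.stack = [] := List.eq_nil_of_length_eq_zero (by rw [← hR.stkLen]; omega)
      have ht : S.todo = [] := List.eq_nil_of_length_eq_zero (by rw [← hR.todoLen]; omega)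
      refine ⟨S.roots, hR.roots, hR.outLen, ?_, hsame⟩
      obtain ⟨dn, h1, h2, h3⟩ := hS.done
      rw [ht, List.append_nil] at h1
      subst h1
      rw [hR.lab]
      exact ⟨hS.sound, fun v hv w hw => hS.label_of_reach hp hs (h3 v hv) hw, h2, hS.pairwise⟩

end Program

end RAM

namespace RAM

open Relation Reg Code

/-- A counted loop: the invariant is indexed by the number of rounds that are done. -/
theorem Runs.range {W : ℕ} {r : Reg} {c : Cmd} {T : ℕ} (N : ℕ) (I : ℕ → HState → Prop)
    (hr : ∀ i ≤ N, ∀ h, I i h → h.reg r = N - i)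
    (hbody : ∀ i < N, ∀ h, I i h → Runs W c h T (I (i + 1))) {h : HState} (h0 : I 0 h) :
    Runs W (.whileNonzero r.idx c) h ((T + 1) * N + 1) (I N) := by
  refine (Runs.countdown (r := r) (T := T) (fun μ h => μ ≤ N ∧ I (N - μ) h) ?_ ?_ N h
    ⟨le_rfl, by rwa [Nat.sub_self]⟩).mono le_rfl fun h' h' => ?_
  · rintro μ h ⟨hμ, hI⟩
    rw [hr _ (Nat.sub_le _ _) h hI]
    omega
  · rintro μ h ⟨hμ, hI⟩
    refine (hbody _ (by omega) h hI).mono le_rfl fun h' hI' => ⟨by omega, ?_⟩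
    rwa [show N - (μ + 1) + 1 = N - μ by omega] at hI'
  · simpa using h'.2

theorem SameExcept.mono {R R' : List Reg} {L L' : List Tab} {h h' : HState}
    (hs : SameExcept R L h h') (hR : R ⊆ R') (hL : L ⊆ L') : SameExcept R' L' h h' :=
  ⟨fun r hr => hs.1 r fun h => hr (hR h), fun t ht => hs.2.1 t fun h => ht (hL h), hs.2.2⟩

theorem SameExcept.refl (R : List Reg) (L : List Tab) (h : HState) : SameExcept R L h h :=
  ⟨fun _ _ => rfl, fun _ _ => rfl, rfl⟩

/-! ### Reading the arcs -/

/-- The indices `e < m` with `f e = v`, in decreasing order. -/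
def arcsOf (f : ℕ → ℕ) : ℕ → ℕ → List ℕ
  | 0, _ => []
  | e + 1, v => if f e = v then e :: arcsOf f e v else arcsOf f e v

theorem mem_arcsOf {f : ℕ → ℕ} {m v e : ℕ} : e ∈ arcsOf f m v ↔ e < m ∧ f e = v := by
  induction m with
  | zero => simp [arcsOf]
  | succ m ih =>
    simp only [arcsOf]
    split_ifs with h
    · simp only [List.mem_cons, ih]
      constructor
      · rintro (rfl | h')
        · exact ⟨by omega, h⟩
        · exact ⟨by omega, h'.2⟩
      · rintro ⟨h1, h2⟩
        by_cases he : e = m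
        · exact Or.inl he
        · exact Or.inr ⟨by omega, h2⟩
    · rw [ih]
      refine and_congr_left fun h2 => ⟨fun h1 => by omega, fun h1 => ?_⟩
      have : e ≠ m := fun h' => h (h' ▸ h2)
      omega

theorem sum_length_arcsOf {f : ℕ → ℕ} {m N : ℕ} (hf : ∀ e < m, f e < N) :
    ∑ v ∈ Finset.range N, (arcsOf f m v).length = m := by
  induction m with
  | zero => simp [arcsOf]
  | succ m ih =>
    have : ∀ v, (arcsOf f (m + 1) v).length = (arcsOf f m v).length + if f m = v then 1 else 0 :=
      fun v => by simp only [arcsOf]; split_ifs <;> simp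
    simp only [this, Finset.sum_add_distrib, ih fun e he => hf e (by omega)]
    simp [hf m (by omega)]

theorem IsLinked.update {next : ℕ → ℕ} {l : List ℕ} {e i x : ℕ} (h : IsLinked next e l)
    (hi : ∀ ε ∈ l, ε ≠ i) : IsLinked (Function.update next i x) e l := by
  induction l generalizing e with
  | nil => exact h
  | cons ε l ih =>
    refine ⟨h.1, ?_⟩
    rw [Function.update_of_ne (hi ε List.mem_cons_self)]
    exact ih h.2 fun δ hδ => hi δ (List.mem_cons_of_mem _ hδ)

/-- The next arc is put in front of the list of the arcs that leave its source. -/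
theorem IsLinked.insert {f next head : ℕ → ℕ} {e : ℕ}
    (h : ∀ v, IsLinked next (head v) (arcsOf f e v)) (v : ℕ) :
    IsLinked (Function.update next e (head (f e))) (Function.update head (f e) (e + 1) v)
      (arcsOf f (e + 1) v) := by
  have key : ∀ v, IsLinked (Function.update next e (head (f e))) (head v) (arcsOf f e v) :=
    fun v => (h v).update fun ε hε => by have := (mem_arcsOf.1 hε).1; omega
  simp only [arcsOf]
  split_ifs with hv
  · subst hv
    rw [Function.update_self]
    exact ⟨rfl, by rw [Function.update_self]; exact key _⟩
  · rw [Function.update_of_ne (Ne.symm hv)]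
    exact key v

/-- Read one arc, and put it in front of the lists of its source and of its target. -/
def readArcsBody : Code :=
  seqs [getLow vtx pos, add pos pos one, getLow wtx pos, add pos pos one, put .src aux vtx,
    put .tgt aux wtx, get tmp .headF vtx, put .nextF aux tmp, get tmp .headR wtx,
    put .nextR aux tmp, add aux aux one, put .headF vtx aux, put .headR wtx aux, sub ctr ctr one]

/-- The tables of the arcs, and the lists of the arcs that leave and that enter a vertex. -/
def readArcs : Cmd :=
  .seq (seqs [cst aux 0, cst pos 3, add ctr numE aux]).compile
    (.whileNonzero ctr.idx readArcsBody.compile)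

theorem runs_readArcs {W m : ℕ} {s t : ℕ → ℕ} {h : HState} (hW : 3 + 2 * m ≤ W)
    (hone : h.reg one = 1) (hm : h.reg numE = m) (hs : ∀ e < m, h.low (3 + 2 * e) = s e)
    (ht : ∀ e < m, h.low (3 + 2 * e + 1) = t e) (hF : ∀ v, h.tab .headF v = 0)
    (hR : ∀ v, h.tab .headR v = 0) :
    Runs W readArcs h (100 * m + 5) fun h' =>
      (∀ e < m, h'.tab .src e = s e) ∧ (∀ e < m, h'.tab .tgt e = t e) ∧
      (∀ v, IsLinked (h'.tab .nextF) (h'.tab .headF v) (arcsOf s m v)) ∧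
      (∀ v, IsLinked (h'.tab .nextR) (h'.tab .headR v) (arcsOf t m v)) ∧
      SameExcept [vtx, wtx, pos, aux, tmp, ctr] [.src, .tgt, .headF, .nextF, .headR, .nextR]
        h h' := by
  let I : ℕ → HState → Prop := fun i h' => h'.reg ctr = m - i ∧ h'.reg aux = i ∧
    h'.reg pos = 3 + 2 * i ∧
    (∀ e < i, h'.tab .src e = s e) ∧ (∀ e < i, h'.tab .tgt e = t e) ∧
    (∀ v, IsLinked (h'.tab .nextF) (h'.tab .headF v) (arcsOf s i v)) ∧
    (∀ v, IsLinked (h'.tab .nextR) (h'.tab .headR v) (arcsOf t i v)) ∧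
    SameExcept [vtx, wtx, pos, aux, tmp, ctr] [.src, .tgt, .headF, .nextF, .headR, .nextR] h h'
  refine (Runs.seq (T₁ := 4) (Q₁ := I 0) (Runs.code ?_ ?_) (T₂ := (99 + 1) * m + 1)
    fun h' hI => ?_).mono (by omega) fun _ h => h
  · simp
  · refine ⟨by simp [hm], by simp, by simp, by simp, by simp, ?_, ?_, fun r hr => ?_, ?_, ?_⟩
    · simpa [arcsOf, IsLinked] using hF
    · simpa [arcsOf, IsLinked] using hR
    · simp only [List.mem_cons, List.not_mem_nil, or_false, not_or] at hr
      simp [hr]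
    · simp
    · simp
  · refine (Runs.range m I (fun i _ h hI => hI.1) (fun i hi h₁ hI => ?_) hI).mono le_rfl ?_
    · obtain ⟨h1, h2, h3, h4, h5, h6, h7, h8⟩ := hI
      have hone₁ : h₁.reg one = 1 := by rw [h8.1 _ (by decide), hone]
      have hc : readArcsBody.cost ≤ 99 := by decide
      have hls : h₁.low (3 + 2 * i) = s i := by rw [h8.2.2, hs i hi]
      have hlt : h₁.low (3 + 2 * i + 1) = t i := by rw [h8.2.2, ht i hi]
      refine (Runs.code ?_ ?_).mono hc fun _ h => h
      · simp [readArcsBody, h3, hone₁]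
        omega
      · generalize hev : readArcsBody.eval h₁ = h'
        simp [readArcsBody, h1, h2, h3, hone₁, hls, hlt] at hev
        subst hev
        refine ⟨?_, by simp, ?_, fun e he => ?_, fun e he => ?_, ?_, ?_, ?_⟩
        · simp; omega
        · simp; omega
        · by_cases hei : e = i
          · simp [hei]
          · simpa [Function.update_of_ne hei] using h4 e (by omega)
        · by_cases hei : e = i
          · simp [hei]
          · simpa [Function.update_of_ne hei] using h5 e (by omega)
        · simpa using IsLinked.insert h6
        · simpa using IsLinked.insert h7
        · refine h8.trans ⟨fun r hr => ?_, fun t ht => ?_, ?_⟩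
          · simp only [List.mem_cons, List.not_mem_nil, or_false, not_or] at hr
            simp [hr]
          · simp only [List.mem_cons, List.not_mem_nil, or_false, not_or] at ht
            simp [ht]
          · simp
    · exact fun h' hI => hI.2.2.2

/-! ### Sources and sinks -/

/-- The list of the starting points `0, 1, …` of the searches. -/
def listVertices : Cmd :=
  .seq (seqs [cst aux 0, add ctr numV aux]).compile
    (.whileNonzero ctr.idx (seqs [put .starts aux aux, add aux aux one, sub ctr ctr one]).compile)

theorem isStack_reverse_range {f : ℕ → ℕ} : ∀ {n : ℕ}, (∀ i < n, f i = i) →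
    IsStack f (List.range n).reverse
  | 0, _ => trivial
  | n + 1, h => by
    rw [List.range_succ, List.reverse_append]
    exact ⟨by simpa using h n (by omega), isStack_reverse_range fun i hi => h i (by omega)⟩

theorem runs_listVertices {W n : ℕ} {h : HState} (hone : h.reg one = 1) (hn : h.reg numV = n) :
    Runs W listVertices h (20 * n + 5) fun h' => (∀ i < n, h'.tab .starts i = i) ∧
      SameExcept [aux, ctr] [.starts] h h' := by
  let I : ℕ → HState → Prop := fun i h' => h'.reg ctr = n - i ∧ h'.reg aux = i ∧
    (∀ e < i, h'.tab .starts e = e) ∧ SameExcept [aux, ctr] [.starts] h h'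
  refine (Runs.seq (T₁ := 3) (Q₁ := I 0) (Runs.code ?_ ?_) (T₂ := (12 + 1) * n + 1)
    fun h' hI => ?_).mono (by omega) fun _ h => h
  · simp
  · refine ⟨by simp [hn], by simp, by simp, fun r hr => ?_, ?_, ?_⟩
    · simp only [List.mem_cons, List.not_mem_nil, or_false, not_or] at hr
      simp [hr]
    · simp
    · simp
  · refine (Runs.range n I (fun i _ h hI => hI.1) (fun i hi h₁ hI => ?_) hI).mono le_rfl ?_
    · obtain ⟨h1, h2, h4, h8⟩ := hI
      have hone₁ : h₁.reg one = 1 := by rw [h8.1 _ (by decide), hone]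
      refine (Runs.code ?_ ?_)
      · simp
      · simp only [eval_seqs_cons, eval, eval_seqs_nil]
        refine ⟨?_, ?_, fun e he => ?_, ?_⟩
        · simp [h1, hone₁]; omega
        · simp [h2, hone₁]
        · by_cases hei : e = i
          · simp [hei, h2]
          · simpa [h2, Function.update_of_ne hei] using h4 e (by omega)
        · refine h8.trans ⟨fun r hr => ?_, fun t ht => ?_, ?_⟩
          · simp only [List.mem_cons, List.not_mem_nil, or_false, not_or] at hr
            simp [hr]
          · simp only [List.mem_cons, List.not_mem_nil, or_false] at ht
            simp [ht]
          · simp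
    · exact fun h' hI => hI.2.2

/-- The list `S` contains one vertex of every strong component without predecessors, with respect
to the reachability `R` on the numbers below `n`; the label `o + 1` of a vertex tells that the
member `o` of the list reaches it. -/
structure IsLabelledBasis (R : ℕ → ℕ → Prop) (n : ℕ) (lab : ℕ → ℕ) (S : List ℕ) : Prop where
  lt : ∀ v ∈ S, v < n
  reach : ∀ v < n, ∃ o ∈ S, lab v = o + 1 ∧ R o v
  indep : S.Pairwise fun a b => ¬ R a b ∧ ¬ R b a

/-- The roots of a first search from all vertices, taken as the starting points of a second search
in the opposite order, leave a root in every strong component without predecessors. -/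
theorem IsSweep.isLabelledBasis {adj : ℕ → List ℕ} {far : ℕ → ℕ} {n : ℕ} {T roots₁ : List ℕ}
    {lab₁ : ℕ → ℕ} {lab : ℕ → ℕ} {roots : List ℕ} (h₁ : IsSweep adj far n T lab₁ roots₁)
    (h : IsSweep adj far n roots₁ lab roots) (hT : ∀ v < n, v ∈ T) :
    IsLabelledBasis (ReflTransGen (Arc adj far)) n lab roots where
  lt v hv := (h.sound v (h.complete v (h.sublist.subset (by simpa using hv)) v .refl)).1
  reach v hv := by
    obtain ⟨-, o, ho, -, hov⟩ := h₁.sound v (h₁.complete v (hT v hv) v .refl)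
    obtain ⟨-, o', ho', hl, hov'⟩ := h.sound v (h.complete o ho v hov)
    exact ⟨o', ho', hl, hov'⟩
  indep := by
    refine List.Pairwise.and ?_ h.pairwise
    have := h₁.pairwise.sublist h.sublist
    rwa [List.pairwise_reverse] at this

/-- Two searches in succession, the second one from the roots of the first one. The stack `out₁` of
these roots is read from its top, hence the order is reversed. -/
def findBasis (head next far lab₁ out₁ lab out : Tab) (len : Reg) : Cmd :=
  .seq (seqs [cst tmp 0, add todoLen numV tmp]).compile <|
  .seq (sweep head next far lab₁ .starts out₁) <|
  .seq (seqs [cst tmp 0, add todoLen outLen tmp]).compile <|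
  .seq (sweep head next far lab out₁ out) (seqs [cst tmp 0, add len outLen tmp]).compile

theorem runs_findBasis {W n m : ℕ} {f : ℕ → ℕ} {head next far lab₁ out₁ lab out : Tab} {len : Reg}
    {h : HState}
    (hnd : [lab₁, out₁, lab, out, .stk, head, next, far, .starts].Nodup)
    (hlen : len ∉ one :: sweepRegs)
    (hone : h.reg one = 1) (hn : h.reg numV = n) (hf : ∀ e < m, f e < n)
    (hadj : ∀ v, IsLinked (h.tab next) (h.tab head v) (arcsOf f m v))
    (hfar : ∀ e < m, h.tab far e < n) (hlab₁ : ∀ v, h.tab lab₁ v = 0) (hlab : ∀ v, h.tab lab v = 0)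
    (hstart : ∀ i < n, h.tab .starts i = i) :
    Runs W (findBasis head next far lab₁ out₁ lab out len) h (1000 * (n + m) + 50) fun h' =>
      ∃ S, IsStack (h'.tab out) S ∧ h'.reg len = S.length ∧
        IsLabelledBasis (ReflTransGen (Arc (arcsOf f m) (h.tab far))) n (h'.tab lab) S ∧
        SameExcept (len :: sweepRegs) [lab₁, out₁, lab, out, .stk] h h' := by
  have hsum : ∑ v ∈ Finset.range n, ((arcsOf f m v).length + 2) = m + 2 * n := by
    rw [Finset.sum_add_distrib, sum_length_arcsOf hf]; simp [mul_comm]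
  have hfar' : ∀ {h' : HState}, h'.tab far = h.tab far → ∀ v < n, ∀ ε ∈ arcsOf f m v,
    h'.tab far ε < n := fun h' v _ ε hε => by rw [h']; exact hfar ε (mem_arcsOf.1 hε).1
  have hT : ∀ v < n, v ∈ (List.range n).reverse := by simp
  have hnd₁ : [lab₁, out₁, .stk, head, next, far, .starts].Nodup := by
    refine hnd.sublist ?_
    simp
  have hnd₂ : [lab, out, .stk, head, next, far, out₁].Nodup := by
    simp only [List.nodup_cons, List.mem_cons, List.not_mem_nil, or_false, not_or] at hnd ⊢
    grind
  have hne : ∀ t ∈ [head, next, far, .starts], t ∉ [lab₁, out₁, lab, out, .stk] := by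
    simp only [List.nodup_cons, List.mem_cons, List.not_mem_nil, or_false, not_or] at hnd ⊢
    grind
  have hlab_ne : lab ∉ [lab₁, out₁, .stk] := by
    simp only [List.nodup_cons, List.mem_cons, List.not_mem_nil, or_false, not_or] at hnd ⊢
    grind
  refine (Runs.seq (T₁ := 3) (Q₁ := fun h₁ => h₁.reg todoLen = n ∧
    SameExcept (len :: sweepRegs) [lab₁, out₁, lab, out, .stk] h h₁ ∧ h₁.tab = h.tab)
    (Runs.code ?_ ?_) (T₂ := 100 * (m + 2 * n + n) + 7 + (3 + (100 * (m + 2 * n + n) + 7 + 3)))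
    fun h₁ hh₁ => ?_).mono (by omega) fun _ h => h
  · simp
  · refine ⟨by simp [hn], ⟨fun r hr => ?_, ?_, ?_⟩, ?_⟩
    · simp only [sweepRegs, List.mem_cons, List.not_mem_nil, or_false, not_or] at hr
      simp [hr]
    · simp
    · simp
    · simp
  obtain ⟨htodo, hs₁, ht₁⟩ := hh₁
  have hs := runs_sweep (W := W) (head := head) (next := next) (lab := lab₁) (start := .starts)
    (out := out₁) (far := far) (h := h₁) (adj := arcsOf f m) hnd₁ (T := (List.range n).reverse)
    (by simp) (by rw [hs₁.1 _ (by simp [sweepRegs] at hlen ⊢; tauto), hone])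
    (by rw [ht₁]; exact fun v _ => hadj v) (hfar' (by rw [ht₁]))
    (by rwa [ht₁]) (by rw [ht₁]; exact isStack_reverse_range hstart) (by simpa using htodo)
  rw [hsum, List.length_reverse, List.length_range] at hs
  refine Runs.seq hs fun h₂ hh₂ => ?_
  obtain ⟨roots₁, hst₂, hlen₂, hsw₂, hsame₂⟩ := hh₂
  have hs₁₂ : SameExcept (len :: sweepRegs) [lab₁, out₁, lab, out, .stk] h₁ h₂ :=
    hsame₂.mono (List.subset_cons_self _ _) (by simp)
  have hs₂ := hs₁.trans hs₁₂
  have hlen₁ : roots₁.length ≤ n := by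
    simpa using hsw₂.sublist.length_le
  refine Runs.seq (T₁ := 3) (Q₁ := fun h₃ => h₃.reg todoLen = roots₁.length ∧
    SameExcept (len :: sweepRegs) [lab₁, out₁, lab, out, .stk] h h₃ ∧ h₃.tab = h₂.tab)
    (Runs.code ?_ ?_) (fun h₃ hh₃ => ?_)
  · simp
  · refine ⟨by simp [hlen₂], hs₂.trans ⟨fun r hr => ?_, ?_, ?_⟩, ?_⟩
    · simp only [sweepRegs, List.mem_cons, List.not_mem_nil, or_false, not_or] at hr
      simp [hr]
    · simp
    · simp
    · simp
  obtain ⟨htodo₃, hs₃, ht₃⟩ := hh₃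
  have hfar₃ : h₃.tab far = h.tab far := hs₃.2.1 _ (hne _ (by simp))
  have hs := runs_sweep (W := W) (head := head) (next := next) (lab := lab) (start := out₁)
    (out := out) (far := far) (h := h₃) (adj := arcsOf f m) (N := n) (T := roots₁) hnd₂
    (fun v hv => (hsw₂.sound v (hsw₂.complete v (hsw₂.sublist.subset (by simpa using hv)) v
      .refl)).1)
    (by rw [hs₃.1 _ (by simp [sweepRegs] at hlen ⊢; tauto), hone])
    (by rw [hs₃.2.1 _ (hne _ (by simp)), hs₃.2.1 _ (hne _ (by simp))]; exact fun v _ => hadj v)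
    (hfar' hfar₃) (by rwa [ht₃, hsame₂.2.1 _ hlab_ne, ht₁]) (by rwa [ht₃]) htodo₃
  rw [hsum] at hs
  refine Runs.seq (hs.mono (by omega) fun _ h => h) fun h₄ hh₄ => ?_
  obtain ⟨roots, hst₄, hlen₄, hsw₄, hsame₄⟩ := hh₄
  have hs₄ : SameExcept (len :: sweepRegs) [lab₁, out₁, lab, out, .stk] h h₄ :=
    hs₃.trans (hsame₄.mono (List.subset_cons_self _ _) (by simp))
  rw [hfar₃] at hsw₄
  rw [ht₁] at hsw₂
  refine Runs.code ?_ ⟨roots, ?_, ?_, ?_, hs₄.trans ⟨fun r hr => ?_, ?_, ?_⟩⟩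
  · simp
  · simpa using hst₄
  · simp [hlen₄]
  · simpa using hsw₂.isLabelledBasis hsw₄ hT
  · simp only [sweepRegs, List.mem_cons, List.not_mem_nil, or_false, not_or] at hr
    simp [hr]
  · simp
  · simp

end RAM

namespace RAM

open Relation Reg Code

/-! ### Matching sources with sinks -/

/-- A loop that takes the entries of a stack one by one. -/
theorem Runs.stack {W : ℕ} {r : Reg} {c : Cmd} {T : ℕ} (I : List ℕ → HState → Prop)
    (hr : ∀ l h, I l h → h.reg r = l.length)
    (hbody : ∀ v l h, I (v :: l) h → Runs W c h T (I l)) (l : List ℕ) (h : HState) (hI : I l h) :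
    Runs W (.whileNonzero r.idx c) h ((T + 1) * l.length + 1) (I []) := by
  refine (Runs.countdown (r := r) (T := T) (fun μ h => ∃ l, l.length = μ ∧ I l h) ?_ ?_ l.length h
    ⟨l, rfl, hI⟩).mono le_rfl ?_
  · rintro μ h ⟨l, rfl, hI⟩
    rw [hr l h hI]
  · rintro μ h ⟨l, hl, hI⟩
    obtain _ | ⟨v, l⟩ := l
    · simp at hl
    · exact (hbody v l h hI).mono le_rfl fun h' hI' => ⟨l, by simpa using hl, hI'⟩
  · rintro h' ⟨l, hl, hI⟩
    rwa [List.length_eq_zero_iff.1 hl] at hI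

/-- The pairs of a matching of `S` into `T` along the relation `R`. -/
structure IsPairing (R : ℕ → ℕ → Prop) (S T : List ℕ) (P : List (ℕ × ℕ)) : Prop where
  fst : (P.map Prod.fst).Nodup
  snd : (P.map Prod.snd).Nodup
  mem : ∀ e ∈ P, R e.1 e.2 ∧ e.1 ∈ S ∧ e.2 ∈ T

/-- The abstract machine state represents the pairs `P`. -/
structure RepPairs (h : HState) (P : List (ℕ × ℕ)) : Prop where
  acts : IsStack (h.tab .acts) (P.map Prod.fst)
  sens : IsStack (h.tab .sens) (P.map Prod.snd)
  num : h.reg numPair = P.length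
  usedS : ∀ v, h.tab .usedS v = 0 ↔ v ∉ P.map Prod.fst
  usedT : ∀ v, h.tab .usedT v = 0 ↔ v ∉ P.map Prod.snd

/-- Add the pair of `vtx` and `wtx` if neither of them is matched. -/
def tryPair : Code :=
  seqs [get tmp .usedS vtx, ite tmp skip <| seqs [get tmp .usedT wtx, ite tmp skip <|
    seqs [put .usedS vtx one, put .usedT wtx one, put .acts numPair vtx, put .sens numPair wtx,
      add numPair numPair one]]]

theorem update_one_eq_zero_iff {f : ℕ → ℕ} {l : List ℕ} (h : ∀ v, f v = 0 ↔ v ∉ l) (w v : ℕ) :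
    Function.update f w 1 v = 0 ↔ v ∉ w :: l := by
  by_cases hv : v = w
  · simp [hv]
  · simpa [hv] using h v

/-- Afterwards one of the two vertices is matched, which is all that the pairing needs from a
maximum matching. -/
theorem tryPair_step {R : ℕ → ℕ → Prop} {S T : List ℕ} {P : List (ℕ × ℕ)} {h : HState}
    (hone : h.reg one = 1) (hR : RepPairs h P) (hP : IsPairing R S T P)
    (hvw : R (h.reg vtx) (h.reg wtx)) (hv : h.reg vtx ∈ S) (hw : h.reg wtx ∈ T) :
    ∃ P', RepPairs (tryPair.eval h) P' ∧ IsPairing R S T P' ∧ P ⊆ P' ∧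
      (h.reg vtx ∈ P'.map Prod.fst ∨ h.reg wtx ∈ P'.map Prod.snd) ∧
      SameExcept [tmp, numPair] [.usedS, .usedT, .acts, .sens] h (tryPair.eval h) := by
  generalize hev : tryPair.eval h = h'
  by_cases h1 : h.tab .usedS (h.reg vtx) = 0
  · by_cases h2 : h.tab .usedT (h.reg wtx) = 0
    · simp [tryPair, h1, h2, hone] at hev
      subst hev
      refine ⟨(h.reg vtx, h.reg wtx) :: P, ⟨?_, ?_, ?_, fun v => ?_, fun v => ?_⟩,
        ⟨?_, ?_, ?_⟩, List.subset_cons_self _ _, Or.inl (by simp), fun r hr => ?_, fun t ht => ?_,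
        ?_⟩
      · simpa [hR.num] using hR.acts.push (h.reg vtx)
      · simpa [hR.num] using hR.sens.push (h.reg wtx)
      · simp [hR.num]
      · simpa using update_one_eq_zero_iff hR.usedS (h.reg vtx) v
      · simpa using update_one_eq_zero_iff hR.usedT (h.reg wtx) v
      · exact List.nodup_cons.2 ⟨(hR.usedS _).1 h1, hP.fst⟩
      · exact List.nodup_cons.2 ⟨(hR.usedT _).1 h2, hP.snd⟩
      · intro e he
        rcases List.mem_cons.1 he with rfl | he
        · exact ⟨hvw, hv, hw⟩
        · exact hP.mem e he
      · simp only [List.mem_cons, List.not_mem_nil, or_false, not_or] at hr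
        simp [hr]
      · simp only [List.mem_cons, List.not_mem_nil, or_false, not_or] at ht
        simp [ht]
      · simp
    · simp [tryPair, h1, h2] at hev
      subst hev
      refine ⟨P, ⟨?_, ?_, ?_, ?_, ?_⟩, hP, List.Subset.refl _,
        Or.inr (not_not.1 fun h => h2 ((hR.usedT _).2 h)), fun r hr => ?_, ?_, ?_⟩
      · simpa using hR.acts
      · simpa using hR.sens
      · simpa using hR.num
      · simpa using hR.usedS
      · simpa using hR.usedT
      · simp only [List.mem_cons, List.not_mem_nil, or_false, not_or] at hr
        simp [hr]
      · simp
      · simp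
  · simp [tryPair, h1] at hev
    subst hev
    refine ⟨P, ⟨?_, ?_, ?_, ?_, ?_⟩, hP, List.Subset.refl _,
      Or.inl (not_not.1 fun h => h1 ((hR.usedS _).2 h)), fun r hr => ?_, ?_, ?_⟩
    · simpa using hR.acts
    · simpa using hR.sens
    · simpa using hR.num
    · simpa using hR.usedS
    · simpa using hR.usedT
    · simp only [List.mem_cons, List.not_mem_nil, or_false, not_or] at hr
      simp [hr]
    · simp
    · simp

/-- Try to pair the next source with the sink that its label names. -/
def pairSourceBody : Code :=
  seqs [sub ctr ctr one, get vtx .srcs ctr, get wtx .labR vtx, sub wtx wtx one, tryPair]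

/-- Try to pair the next sink with the source that its label names. -/
def pairSinkBody : Code :=
  seqs [sub ctr ctr one, get wtx .snks ctr, get vtx .labF wtx, sub vtx vtx one, tryPair]

/-- Match greedily along the pairs of a source and a sink that it reaches, and of a sink and a
source that reaches it. -/
def matchPairs : Cmd :=
  .seq (seqs [cst numPair 0, add ctr numSrc numPair]).compile <|
  .seq (.whileNonzero ctr.idx pairSourceBody.compile) <|
  .seq (seqs [cst tmp 0, add ctr numSnk tmp]).compile
    (.whileNonzero ctr.idx pairSinkBody.compile)

/-- The tables `labF` and `labR` name one source for every sink and one sink for every source, so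
that linear time suffices for a matching that meets these pairs. -/
theorem runs_matchPairs {W n : ℕ} {R : ℕ → ℕ → Prop} {S T : List ℕ} {h : HState}
    (hone : h.reg one = 1) (hS : IsLabelledBasis R n (h.tab .labF) S)
    (hT : IsLabelledBasis (fun v w => R w v) n (h.tab .labR) T)
    (hs : IsStack (h.tab .srcs) S) (ht : IsStack (h.tab .snks) T)
    (hSn : h.reg numSrc = S.length) (hTn : h.reg numSnk = T.length)
    (huS : ∀ v, h.tab .usedS v = 0) (huT : ∀ v, h.tab .usedT v = 0) :
    Runs W matchPairs h (100 * (S.length + T.length) + 20) fun h' => ∃ P, RepPairs h' P ∧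
      IsPairing R S T P ∧
      (∀ v ∈ S, ∃ w, R v w ∧ (v ∈ P.map Prod.fst ∨ w ∈ P.map Prod.snd)) ∧
      (∀ w ∈ T, ∃ v, R v w ∧ (v ∈ P.map Prod.fst ∨ w ∈ P.map Prod.snd)) ∧
      SameExcept [tmp, ctr, vtx, wtx, numPair] [.usedS, .usedT, .acts, .sens] h h' := by
  let E := SameExcept [tmp, ctr, vtx, wtx, numPair] [.usedS, .usedT, .acts, .sens]
  let I : List ℕ → HState → Prop := fun l h' => h'.reg ctr = l.length ∧ l <:+ S ∧ E h h' ∧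
    ∃ P, RepPairs h' P ∧ IsPairing R S T P ∧
      ∀ v ∈ S, v ∈ l ∨ ∃ w, R v w ∧ (v ∈ P.map Prod.fst ∨ w ∈ P.map Prod.snd)
  let J : List ℕ → HState → Prop := fun l h' => h'.reg ctr = l.length ∧ l <:+ T ∧ E h h' ∧
    ∃ P, RepPairs h' P ∧ IsPairing R S T P ∧
      (∀ v ∈ S, ∃ w, R v w ∧ (v ∈ P.map Prod.fst ∨ w ∈ P.map Prod.snd)) ∧
      ∀ w ∈ T, w ∈ l ∨ ∃ v, R v w ∧ (v ∈ P.map Prod.fst ∨ w ∈ P.map Prod.snd)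
  have hsub : ∀ {P P' : List (ℕ × ℕ)} {v w : ℕ}, P ⊆ P' →
      (v ∈ P.map Prod.fst ∨ w ∈ P.map Prod.snd) → (v ∈ P'.map Prod.fst ∨ w ∈ P'.map Prod.snd) :=
    fun hP => Or.imp (fun h => List.map_subset _ hP h) (fun h => List.map_subset _ hP h)
  have hstk : ∀ {f : ℕ → ℕ} {l L : List ℕ}, IsStack f L → l <:+ L → IsStack f l := by
    intro f l L hL
    induction L with
    | nil => intro h; rw [List.suffix_nil.1 h]; trivial
    | cons x L ih =>
      intro h
      rcases List.suffix_cons_iff.1 h with rfl | h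
      · exact hL
      · exact ih hL.2 h
  have c1 : pairSourceBody.cost ≤ 90 := by decide
  have c2 : pairSinkBody.cost ≤ 90 := by decide
  refine (Runs.seq (T₁ := 3) (Q₁ := I S) (Runs.code ?_ ?_)
    (T₂ := (90 + 1) * S.length + 1 + (3 + ((90 + 1) * T.length + 1))) fun h₁ hh₁ => Runs.seq
    (Q₁ := I []) (Runs.stack I (fun _ _ h => h.1) (fun v l h' hI => ?_) _ _ hh₁) fun h₂ hh₂ =>
    Runs.seq (Q₁ := J T) (T₁ := 3) (Runs.code ?_ ?_) fun h₃ hh₃ =>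
    (Runs.stack J (fun _ _ h => h.1) (fun v l h' hI => ?_) _ _ hh₃).mono le_rfl ?_).mono (by omega)
    fun _ h => h
  · simp
  · refine ⟨by simp [hSn], List.suffix_refl _, ⟨fun r hr => ?_, ?_, ?_⟩, [], ⟨trivial, trivial,
      by simp, by simpa using huS, by simpa using huT⟩, ⟨by simp, by simp, by simp⟩,
      fun v hv => Or.inl hv⟩
    · simp only [List.mem_cons, List.not_mem_nil, or_false, not_or] at hr
      simp [hr]
    · simp
    · simp
  · obtain ⟨h1, h2, h3, P, h4, h5, h6⟩ := hI
    have hone' : h'.reg one = 1 := by rw [h3.1 _ (by decide), hone]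
    have hv : v ∈ S := h2.subset List.mem_cons_self
    obtain ⟨w, hw, hl, hvw⟩ := hT.reach v (hS.lt v hv)
    have hget : h'.tab .srcs l.length = v := by
      rw [h3.2.1 _ (by decide)]; exact (hstk hs h2).1
    have hget' : h'.tab .labR v = w + 1 := by
      rw [h3.2.1 _ (by decide)]; exact hl
    refine (Runs.code (by simp [pairSourceBody, tryPair]) ?_).mono c1 fun _ h => h
    let h'' := (((h'.setReg ctr l.length).setReg vtx v).setReg wtx (w + 1)).setReg wtx w
    have hev : pairSourceBody.eval h' = tryPair.eval h'' := by
      simp [pairSourceBody, h1, hone', hget, hget', h'']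
    have hE : SameExcept [ctr, vtx, wtx] [] h' h'' := by
      refine ⟨fun r hr => ?_, ?_, ?_⟩
      · simp only [List.mem_cons, List.not_mem_nil, or_false, not_or] at hr
        simp [h'', hr]
      · simp [h'']
      · simp [h'']
    obtain ⟨P', k1, k2, k3, k4, k5⟩ := tryPair_step (R := R) (S := S) (T := T) (P := P) (h := h'')
      (by simpa [h''] using hone') ⟨by simpa [h''] using h4.acts, by simpa [h''] using h4.sens,
      by simpa [h''] using h4.num, by simpa [h''] using h4.usedS, by simpa [h''] using h4.usedT⟩
      h5 (by simpa [h''] using hvw) (by simpa [h''] using hv) (by simpa [h''] using hw)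
    simp only [hev]
    refine ⟨?_, (List.suffix_cons _ _).trans h2, (h3.trans (hE.mono (by simp) (by simp))).trans
      (k5.mono (by simp) (by simp)), P', k1, k2, fun x hx => ?_⟩
    · rw [k5.1 _ (by decide)]; simp [h'']
    · rcases h6 x hx with h6 | ⟨y, h6, h7⟩
      · rcases List.mem_cons.1 h6 with rfl | h6
        · exact Or.inr ⟨w, hvw, by simpa [h''] using k4⟩
        · exact Or.inl h6
      · exact Or.inr ⟨y, h6, hsub k3 h7⟩
  · simp
  · obtain ⟨h1, h2, h3, P, h4, h5, h6⟩ := hh₂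
    have hTn' : h₂.reg numSnk = T.length := by rw [h3.1 _ (by decide), hTn]
    refine ⟨by simp [hTn'], List.suffix_refl _, h3.trans ⟨fun r hr => ?_, ?_, ?_⟩, P,
      ⟨by simpa using h4.acts, by simpa using h4.sens, by simpa using h4.num,
        by simpa using h4.usedS, by simpa using h4.usedT⟩, h5, fun v hv => ?_,
      fun v hv => Or.inl hv⟩
    · simp only [List.mem_cons, List.not_mem_nil, or_false, not_or] at hr
      simp [hr]
    · simp
    · simp
    · simpa using h6 v hv
  · obtain ⟨h1, h2, h3, P, h4, h5, h6, h7⟩ := hI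
    have hone' : h'.reg one = 1 := by rw [h3.1 _ (by decide), hone]
    have hv : v ∈ T := h2.subset List.mem_cons_self
    obtain ⟨w, hw, hl, hvw⟩ := hS.reach v (hT.lt v hv)
    have hget : h'.tab .snks l.length = v := by
      rw [h3.2.1 _ (by decide)]; exact (hstk ht h2).1
    have hget' : h'.tab .labF v = w + 1 := by
      rw [h3.2.1 _ (by decide)]; exact hl
    refine (Runs.code (by simp [pairSinkBody, tryPair]) ?_).mono c2 fun _ h => h
    let h'' := (((h'.setReg ctr l.length).setReg wtx v).setReg vtx (w + 1)).setReg vtx w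
    have hev : pairSinkBody.eval h' = tryPair.eval h'' := by
      simp [pairSinkBody, h1, hone', hget, hget', h'']
    have hE : SameExcept [ctr, vtx, wtx] [] h' h'' := by
      refine ⟨fun r hr => ?_, ?_, ?_⟩
      · simp only [List.mem_cons, List.not_mem_nil, or_false, not_or] at hr
        simp [h'', hr]
      · simp [h'']
      · simp [h'']
    obtain ⟨P', k1, k2, k3, k4, k5⟩ := tryPair_step (R := R) (S := S) (T := T) (P := P) (h := h'')
      (by simpa [h''] using hone') ⟨by simpa [h''] using h4.acts, by simpa [h''] using h4.sens,
      by simpa [h''] using h4.num, by simpa [h''] using h4.usedS, by simpa [h''] using h4.usedT⟩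
      h5 (by simpa [h''] using hvw) (by simpa [h''] using hw) (by simpa [h''] using hv)
    simp only [hev]
    refine ⟨?_, (List.suffix_cons _ _).trans h2, (h3.trans (hE.mono (by simp) (by simp))).trans
      (k5.mono (by simp) (by simp)), P', k1, k2, fun x hx => ?_, fun x hx => ?_⟩
    · rw [k5.1 _ (by decide)]; simp [h'']
    · obtain ⟨y, h6, h7⟩ := h6 x hx
      exact ⟨y, h6, hsub k3 h7⟩
    · rcases h7 x hx with h6 | ⟨y, h6, h7⟩
      · rcases List.mem_cons.1 h6 with rfl | h6
        · exact Or.inr ⟨w, hvw, by simpa [h''] using k4⟩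
        · exact Or.inl h6
      · exact Or.inr ⟨y, h6, hsub k3 h7⟩
  · rintro h' ⟨-, -, h3, P, h4, h5, h6, h7⟩
    exact ⟨P, h4, h5, h6, by simpa using h7, h3⟩

def appendFreeBody (used list out : Tab) (len : Reg) : Code :=
  seqs [sub ctr ctr one, get vtx list ctr, get tmp used vtx,
    ite tmp skip (seqs [put out len vtx, add len len one])]

/-- Append the unmatched members of a list to the matched ones. -/
def appendFree (used list out : Tab) (num len : Reg) : Cmd :=
  .seq (seqs [cst tmp 0, add ctr num tmp, add len numPair tmp]).compile
    (.whileNonzero ctr.idx (appendFreeBody used list out len).compile)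

theorem runs_appendFree {W : ℕ} {used list out : Tab} {num len : Reg} {S A : List ℕ} {h : HState}
    (hused : used ≠ out) (hlist : list ≠ out) (hlen : len ∉ [one, tmp, ctr, vtx, numPair])
    (hnum : num ∉ [tmp, len])
    (hone : h.reg one = 1) (hS : S.Nodup) (hs : IsStack (h.tab list) S)
    (hSn : h.reg num = S.length) (hA : IsStack (h.tab out) A) (hAn : h.reg numPair = A.length)
    (hu : ∀ v, h.tab used v = 0 ↔ v ∉ A) :
    Runs W (appendFree used list out num len) h (40 * S.length + 5) fun h' => ∃ L,
      IsStack (h'.tab out) (L ++ A) ∧ h'.reg len = (L ++ A).length ∧ L.Nodup ∧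
      (∀ v, v ∈ L ↔ v ∈ S ∧ v ∉ A) ∧ SameExcept [len, tmp, ctr, vtx] [out] h h' := by
  let I : List ℕ → HState → Prop := fun l h' => h'.reg ctr = l.length ∧
    ∃ L done, done ++ l = S ∧ IsStack (h'.tab out) (L ++ A) ∧ h'.reg len = (L ++ A).length ∧
      L.Nodup ∧ (∀ v, v ∈ L ↔ v ∈ done ∧ v ∉ A) ∧ IsStack (h'.tab list) l ∧
      SameExcept [len, tmp, ctr, vtx] [out] h h'
  simp only [List.mem_cons, List.not_mem_nil, or_false, not_or] at hlen hnum
  obtain ⟨l1, l2, l3, l4, l5⟩ := hlen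
  have l1' := Ne.symm l1
  have l2' := Ne.symm l2
  have l3' := Ne.symm l3
  have l4' := Ne.symm l4
  have l5' := Ne.symm l5
  have hc : (appendFreeBody used list out len).cost ≤ 39 := by
    simp [appendFreeBody, cost, seqs]
  refine (Runs.seq (T₁ := 4) (Q₁ := I S) (Runs.code ?_ ?_)
    (T₂ := (39 + 1) * S.length + 1) fun h₁ hh₁ =>
    (Runs.stack I (fun _ _ h => h.1) (fun v l h' hI => ?_) _ _ hh₁).mono le_rfl ?_).mono (by omega)
    fun _ h => h
  · simp
  · refine ⟨by simp [hSn, hnum, l3'], [], [], rfl, by simpa using hA, by simp [hAn],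
      List.nodup_nil, by simp, by simpa using hs, fun r hr => ?_, ?_, ?_⟩
    · simp only [List.mem_cons, List.not_mem_nil, or_false, not_or] at hr
      simp [hr]
    · simp
    · simp
  · obtain ⟨k1, L, done, k2, k3, k4, k5, k6, k7, k8⟩ := hI
    have hone' : h'.reg one = 1 := by
      rw [k8.1 _ (by simp [l1']), hone]
    have hget : h'.tab list l.length = v := k7.1
    have hget' : h'.tab used v = h.tab used v := by rw [k8.2.1 _ (by simpa using hused)]
    refine (Runs.code (by simp [appendFreeBody]) ?_).mono hc fun _ h => h
    generalize hev : (appendFreeBody used list out len).eval h' = h''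
    by_cases hv : v ∈ A
    · have hvu : ¬ h.tab used v = 0 := by rw [hu, not_not]; exact hv
      simp [appendFreeBody, k1, hone', hget, hget', hvu] at hev
      subst hev
      refine ⟨by simp, L, done ++ [v], by simp [← k2], by simpa using k3,
        by simpa [l2, l3, l4] using k4, k5, fun x => ?_, by simpa using k7.2,
        k8.trans ⟨fun r hr => ?_, ?_, ?_⟩⟩
      · rw [k6, List.mem_append, List.mem_singleton]
        refine and_congr_left fun hx => ⟨Or.inl, fun h => h.resolve_right ?_⟩
        rintro rfl
        exact hx hv
      · simp only [List.mem_cons, List.not_mem_nil, or_false, not_or] at hr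
        simp [hr]
      · simp
      · simp
    · have hvu : h.tab used v = 0 := (hu v).2 hv
      have hvd : v ∉ done := by
        rw [← k2] at hS
        intro hvd
        exact (List.nodup_append.1 hS).2.2 v hvd v List.mem_cons_self rfl
      simp [appendFreeBody, k1, hone', hget, hget', hvu] at hev
      subst hev
      refine ⟨by simp [l3'], v :: L, done ++ [v], by simp [← k2], ?_,
        by simp [l2, l3, l4, k4],
        List.nodup_cons.2 ⟨fun h => hvd ((k6 v).1 h).1, k5⟩, fun x => ?_,
        by simpa [hlist] using k7.2,
        k8.trans ⟨fun r hr => ?_, fun t ht => ?_, ?_⟩⟩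
      · simpa [l2, l3, l4, k4] using k3.push v
      · rw [List.mem_cons, k6, List.mem_append, List.mem_singleton]
        constructor
        · rintro (rfl | h)
          · exact ⟨Or.inr rfl, hv⟩
          · exact ⟨Or.inl h.1, h.2⟩
        · rintro ⟨h | h, hx⟩
          · exact Or.inr ⟨h, hx⟩
          · exact Or.inl h
      · simp only [List.mem_cons, List.not_mem_nil, or_false, not_or] at hr
        simp [hr]
      · simp only [List.mem_cons, List.not_mem_nil, or_false] at ht
        simp [ht]
      · simp
  · rintro h' ⟨-, L, done, k2, k3, k4, k5, k6, k7, k8⟩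
    rw [List.append_nil] at k2
    exact ⟨L, k3, k4, k5, k2 ▸ k6, k8⟩

end RAM

namespace RAM

open Relation Reg Code

/-! ### Writing the output -/

/-- The list `w` has been written to the beginning of the memory. -/
def Written (h : HState) (w : List ℕ) : Prop :=
  h.reg pos = w.length ∧ ∀ a < w.length, h.low a = w.getD a 0

theorem written_append {low : ℕ → ℕ} {w : List ℕ} (h : ∀ a < w.length, low a = w.getD a 0)
    (x : ℕ) : ∀ a < (w ++ [x]).length,
      Function.update low w.length x a = (w ++ [x]).getD a 0 := by
  intro a ha
  by_cases haw : a = w.length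
  · simp [haw]
  · have : a < w.length := by simp at ha; omega
    rw [Function.update_of_ne haw, h a this, List.getD_append _ _ _ _ this]

/-- Everything except the given registers and the output is the same in both states. -/
def SameUpToOutput (R : List Reg) (h h' : HState) : Prop :=
  (∀ r, r ∉ R → h'.reg r = h.reg r) ∧ h'.tab = h.tab

theorem SameUpToOutput.trans {R : List Reg} {h h' h'' : HState} (h₁ : SameUpToOutput R h h')
    (h₂ : SameUpToOutput R h' h'') : SameUpToOutput R h h'' :=
  ⟨fun r hr => (h₂.1 r hr).trans (h₁.1 r hr), h₂.2.trans h₁.2⟩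

theorem SameUpToOutput.mono {R R' : List Reg} {h h' : HState} (hs : SameUpToOutput R h h')
    (hR : R ⊆ R') : SameUpToOutput R' h h' :=
  ⟨fun r hr => hs.1 r fun h => hr (hR h), hs.2⟩

/-- A counted loop whose round `i` writes `g i`. -/
theorem Runs.write {W : ℕ} {r : Reg} {c : Cmd} {T : ℕ} (N : ℕ) (g : ℕ → List ℕ)
    (J : ℕ → HState → Prop) (hr : ∀ i ≤ N, ∀ h, J i h → h.reg r = N - i)
    (hbody : ∀ i < N, ∀ w h, Written h w → J i h → w.length + (g i).length ≤ W →
      Runs W c h T fun h' => Written h' (w ++ g i) ∧ J (i + 1) h')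
    {w : List ℕ} {h : HState} (hw : Written h w) (h0 : J 0 h)
    (hW : w.length + ((List.range N).flatMap g).length ≤ W) :
    Runs W (.whileNonzero r.idx c) h ((T + 1) * N + 1)
      fun h' => Written h' (w ++ (List.range N).flatMap g) ∧ J N h' := by
  refine Runs.range N (fun i h' => Written h' (w ++ (List.range i).flatMap g) ∧ J i h')
    (fun i hi h hI => hr i hi h hI.2) (fun i hi h hI => ?_) ⟨by simpa using hw, h0⟩
  have hs : ((List.range (i + 1)).flatMap g).length ≤ ((List.range N).flatMap g).length :=
    ((List.range_sublist.2 hi).flatMap g).length_le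
  rw [List.range_succ, List.flatMap_append] at hs ⊢
  simp only [List.flatMap_cons, List.flatMap_nil, List.append_nil] at hs ⊢
  rw [← List.append_assoc]
  refine hbody i hi _ h hI.1 hI.2 ?_
  rw [List.length_append] at hs ⊢
  omega

def writeTableBody (t : Tab) : Code :=
  seqs [get tmp t aux, putLow pos tmp, add pos pos one, add aux aux one, sub ctr ctr one]

/-- Write the entries of a table, `bound + 1` times. -/
def writeTable (t : Tab) (len : Reg) : Cmd :=
  .seq (seqs [add round bound one]).compile <| .whileNonzero round.idx <|
    .seq (seqs [cst aux 0, add ctr len aux]).compile <|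
    .seq (.whileNonzero ctr.idx (writeTableBody t).compile) (seqs [sub round round one]).compile

theorem runs_writeTable {W k N : ℕ} {t : Tab} {len : Reg} {h : HState} {w : List ℕ}
    (hlen : len ∉ [tmp, aux, ctr, round, pos]) (hone : h.reg one = 1) (hk : h.reg bound = k)
    (hN : h.reg len = N) (hw : Written h w)
    (hW : w.length + ((List.range (k + 1)).flatMap fun _ => (List.range N).flatMap fun i =>
      [h.tab t i]).length ≤ W) :
    Runs W (writeTable t len) h ((20 * N + 10) * (k + 1) + 5) fun h' =>
      Written h' (w ++ (List.range (k + 1)).flatMap fun _ => (List.range N).flatMap fun i =>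
        [h.tab t i]) ∧ SameUpToOutput [tmp, aux, ctr, round, pos] h h' := by
  let J : ℕ → HState → Prop := fun i h' => h'.reg round = k + 1 - i ∧
    SameUpToOutput [tmp, aux, ctr, round, pos] h h'
  refine (Runs.seq (T₁ := 2) (Q₁ := fun h' => Written h' w ∧ J 0 h') (Runs.code ?_ ?_)
    (T₂ := (3 + ((14 + 1) * N + 1 + 2) + 1) * (k + 1) + 1) fun h₁ hh₁ =>
    (Runs.write (k + 1) _ J (fun _ _ _ h => h.1) (fun i hi w' h' hw' hJ hW' =>
      Runs.seq (Q₁ := fun h'' => Written h'' w' ∧ h''.reg ctr = N ∧ h''.reg aux = 0 ∧ J i h'')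
      (Runs.code ?_ ?_) fun h₂ hh₂ => Runs.seq (Q₁ := fun h'' => Written h'' (w' ++ _) ∧ J i h'')
      ((Runs.write N _ (fun j h'' => h''.reg ctr = N - j ∧ h''.reg aux = j ∧ J i h'')
        (fun _ _ _ h => h.1) (fun j hj w'' h'' hw'' hJ' hW'' => Runs.code ?_ ?_)
        hh₂.1 ⟨hh₂.2.1, hh₂.2.2⟩ hW').mono le_rfl fun _ h => ⟨h.1, h.2.2.2⟩)
      fun h₃ hh₃ => Runs.code ?_ ?_) hh₁.1 hh₁.2 hW).mono
      le_rfl ?_).mono ?_ fun _ h => h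
  · simp
  · refine ⟨by simpa [Written] using hw, by simp [hk, hone], fun r hr => ?_, by simp⟩
    simp only [List.mem_cons, List.not_mem_nil, or_false, not_or] at hr
    simp [hr]
  · simp
  · have hN' : h'.reg len = N := by rw [hJ.2.1 _ hlen, hN]
    have hla : len ≠ aux := by simp at hlen; tauto
    refine ⟨by simpa [Written] using hw', by simp [hN', hla], by simp, by simpa using hJ.1,
      hJ.2.trans ⟨fun r hr => ?_, by simp⟩⟩
    simp only [List.mem_cons, List.not_mem_nil, or_false, not_or] at hr
    simp [hr]
  · simpa [writeTableBody, hw''.1] using hW''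
  · obtain ⟨h1, h2, h3, h4⟩ := hJ'
    have hone' : h''.reg one = 1 := by rw [h4.1 _ (by decide), hone]
    have htab : h''.tab t = h.tab t := by rw [h4.2]
    generalize hev : (writeTableBody t).eval h'' = h₃
    simp [writeTableBody, h1, h2, hone', htab, hw''.1] at hev
    subst hev
    refine ⟨⟨by simp, by simpa using written_append hw''.2 _⟩, by simp; omega, by simp,
      by simpa using h3, h4.trans ⟨fun r hr => ?_, by simp⟩⟩
    simp only [List.mem_cons, List.not_mem_nil, or_false, not_or] at hr
    simp [hr]
  · simp
  · obtain ⟨h1, h2, h3⟩ := hh₃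
    have hone' : h₃.reg one = 1 := by rw [h3.1 _ (by decide), hone]
    refine ⟨by simpa [Written] using h1, by simp [hone', h2]; omega,
      h3.trans ⟨fun r hr => ?_, by simp⟩⟩
    simp only [List.mem_cons, List.not_mem_nil, or_false, not_or] at hr
    simp [hr]
  · exact fun h' hh' => ⟨hh'.1, hh'.2.2⟩
  · have : (3 + ((14 + 1) * N + 1 + 2) + 1) * (k + 1) ≤ (20 * N + 10) * (k + 1) :=
      Nat.mul_le_mul_right _ (by omega)
    omega

/-- The sensor, in a block of `q` sensors, at the beginning of the link number `l`. -/
def linkSensor (q l : ℕ) : ℕ := if l < q then l else 0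

/-- The actuator, in a block of `p` actuators, at the end of the link number `l`. The first `r`
actuators and sensors are those of a matching. -/
def linkActuator (r p l : ℕ) : ℕ :=
  if l + 1 < r then l + 1 else if l < r then 0 else if l < p then l else 0

/-- Put the sensor of the link `aux` into `vtx`. -/
def sensorCode : Code :=
  seqs [cst vtx 0, sub tmp numSnk aux, ite tmp (add vtx aux vtx) skip]

/-- Put the actuator of the link `aux` into `vtx`. -/
def actuatorCode : Code :=
  seqs [cst vtx 0, add arc aux one, sub tmp numPair arc,
    ite tmp (add vtx arc vtx) (seqs [sub tmp numPair aux,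
      ite tmp skip (seqs [sub tmp numSrc aux, ite tmp (add vtx aux vtx) skip])])]

/-- Write the position in the whole collection that belongs to the position `vtx` in a block. -/
def writeOffset (off : Reg) : Code :=
  seqs [add vtx vtx off, putLow pos vtx, add pos pos one]

def writeLinkBody : Code :=
  seqs [sensorCode, writeOffset sensOff, actuatorCode, writeOffset actOff, add aux aux one,
    sub ctr ctr one]

/-- Write the links of all blocks. -/
def writeLinks : Cmd :=
  .seq (seqs [add round bound one, cst actOff 0, cst sensOff 0]).compile <|
  .whileNonzero round.idx <|
    .seq (seqs [cst aux 0, add ctr numLink aux]).compile <|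
    .seq (.whileNonzero ctr.idx writeLinkBody.compile)
      (seqs [sub round round one, add actOff actOff numSrc, add sensOff sensOff numSnk]).compile

/-- The output for the link number `l` of the block number `b`. -/
def linkWords (r p q b l : ℕ) : List ℕ := [linkSensor q l + b * q, linkActuator r p l + b * p]

theorem sensorCode_eval (h : HState) :
    (sensorCode.eval h).reg vtx = linkSensor (h.reg numSnk) (h.reg aux) ∧
      SameExcept [vtx, tmp, arc] [] h (sensorCode.eval h) := by
  generalize hev : sensorCode.eval h = h'
  by_cases hq : h.reg numSnk - h.reg aux = 0
  all_goals
    simp only [sensorCode, eval, eval_seqs_cons, eval_seqs_nil, HState.reg_setReg, if_true, ne_eq,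
      hq, not_true_eq_false, not_false_eq_true, if_false, reduceCtorEq] at hev
    subst hev
    refine ⟨?_, fun r hr => ?_, by simp, by simp⟩
    · simp [linkSensor]
      omega
    · simp only [List.mem_cons, List.not_mem_nil, or_false, not_or] at hr
      simp [hr]

theorem actuatorCode_eval {h : HState} (hone : h.reg one = 1) :
    (actuatorCode.eval h).reg vtx = linkActuator (h.reg numPair) (h.reg numSrc) (h.reg aux) ∧
      SameExcept [vtx, tmp, arc] [] h (actuatorCode.eval h) := by
  generalize hev : actuatorCode.eval h = h'
  by_cases h1 : h.reg numPair - (h.reg aux + 1) = 0 <;>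
  by_cases h2 : h.reg numPair - h.reg aux = 0 <;> by_cases h3 : h.reg numSrc - h.reg aux = 0
  all_goals
    simp only [actuatorCode, eval, eval_seqs_cons, eval_seqs_nil, HState.reg_setReg, if_true, ne_eq,
      hone, h1, h2, h3, not_true_eq_false, not_false_eq_true, if_false, reduceCtorEq] at hev
    subst hev
    refine ⟨?_, fun r hr => ?_, by simp, by simp⟩
    · simp only [linkActuator, HState.reg_setReg, if_true, reduceCtorEq, if_false]
      split_ifs <;> omega
    · simp only [List.mem_cons, List.not_mem_nil, or_false, not_or] at hr
      simp [hr]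

theorem writeOffset_eval {h : HState} (hone : h.reg one = 1) {w : List ℕ} (hw : Written h w)
    (off : Reg) :
    Written ((writeOffset off).eval h) (w ++ [h.reg vtx + h.reg off]) ∧
      SameUpToOutput [vtx, pos] h ((writeOffset off).eval h) ∧
      ∀ W, w.length < W → (writeOffset off).Ok W h := by
  refine ⟨⟨?_, ?_⟩, ⟨fun r hr => ?_, ?_⟩, fun W hW => ?_⟩
  · simp [writeOffset, hone, hw.1]
  · simpa [writeOffset, hone, hw.1] using written_append hw.2 (h.reg vtx + h.reg off)
  · simp only [List.mem_cons, List.not_mem_nil, or_false, not_or] at hr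
    simp [writeOffset, hr]
  · simp [writeOffset]
  · simpa [writeOffset, hw.1] using hW

theorem writeLinkBody_eval {h : HState} (hone : h.reg one = 1) (w : List ℕ) (hw : Written h w)
    {r p q b l : ℕ} (hr : h.reg numPair = r) (hp : h.reg numSrc = p) (hq : h.reg numSnk = q)
    (hl : h.reg aux = l) (ha : h.reg actOff = b * p) (hs : h.reg sensOff = b * q) :
    Written (writeLinkBody.eval h) (w ++ linkWords r p q b l) ∧
      (writeLinkBody.eval h).reg aux = l + 1 ∧ (writeLinkBody.eval h).reg ctr = h.reg ctr - 1 ∧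
      SameUpToOutput [vtx, tmp, pos, arc, aux, ctr] h (writeLinkBody.eval h) ∧
      (∀ W, w.length + 2 ≤ W → writeLinkBody.Ok W h) := by
  have hup : ∀ {h h' : HState}, SameExcept [vtx, tmp, arc] [] h h' →
      SameUpToOutput [vtx, tmp, pos, arc] h h' := fun hs =>
    ⟨fun r hr => hs.1 r (by simp at hr ⊢; tauto), funext fun t => hs.2.1 t (by simp)⟩
  have hwr : ∀ {h h' : HState} {w : List ℕ}, Written h w → SameExcept [vtx, tmp, arc] [] h h' →
      Written h' w := fun hw hs => ⟨by rw [hs.1 _ (by decide), hw.1], by rw [hs.2.2]; exact hw.2⟩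
  obtain ⟨e1, s1⟩ := sensorCode_eval h
  have ok1 : ∀ W, sensorCode.Ok W h := fun W => by simp [sensorCode]
  generalize hev₁ : sensorCode.eval h = h₁ at e1 s1
  have t1 := hup s1
  obtain ⟨w2, s2, ok2⟩ := writeOffset_eval (h := h₁)
    (by rw [s1.1 _ (by decide), hone]) (hwr hw s1) sensOff
  generalize hev₂ : (writeOffset sensOff).eval h₁ = h₂ at w2 s2
  have t2 := t1.trans (s2.mono (R' := [vtx, tmp, pos, arc]) (by simp))
  obtain ⟨e3, s3⟩ := actuatorCode_eval (h := h₂) (by rw [t2.1 _ (by decide), hone])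
  have ok3 : ∀ W, actuatorCode.Ok W h₂ := fun W => by simp [actuatorCode]
  generalize hev₃ : actuatorCode.eval h₂ = h₃ at e3 s3
  have t3 := t2.trans (hup s3)
  obtain ⟨w4, s4, ok4⟩ := writeOffset_eval (h := h₃)
    (by rw [t3.1 _ (by decide), hone]) (hwr w2 s3) actOff
  generalize hev₄ : (writeOffset actOff).eval h₃ = h₄ at w4 s4
  have t4 := t3.trans (s4.mono (R' := [vtx, tmp, pos, arc]) (by simp))
  have hev : writeLinkBody.eval h =
      (h₄.setReg aux (l + 1)).setReg ctr (h.reg ctr - 1) := by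
    simp [writeLinkBody, hev₁, hev₂, hev₃, hev₄, t4.1 aux (by decide), t4.1 one (by decide),
      t4.1 ctr (by decide), hone, hl]
  rw [hev]
  refine ⟨?_, by simp, by simp, (t4.mono (by simp)).trans ⟨fun r hr => ?_, by simp⟩,
    fun W hW => ?_⟩
  · rw [e3, e1, t2.1 _ (by decide), t2.1 _ (by decide), t2.1 _ (by decide), t3.1 _ (by decide),
      s1.1 _ (by decide), hr, hp, hq, hl, ha, hs] at w4
    simpa [Written, linkWords] using w4
  · simp only [List.mem_cons, List.not_mem_nil, or_false, not_or] at hr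
    simp [hr]
  · have h1 := ok2 W (by omega)
    have h2 := ok4 W (by simp; omega)
    simp [writeLinkBody, hev₁, hev₂, hev₃, ok1, ok3, h1, h2]

theorem runs_writeLinks {W k r p q x : ℕ} {h : HState} {w : List ℕ}
    (hone : h.reg one = 1) (hk : h.reg bound = k) (hr : h.reg numPair = r)
    (hp : h.reg numSrc = p) (hq : h.reg numSnk = q) (hx : h.reg numLink = x) (hw : Written h w)
    (hW : w.length + ((List.range (k + 1)).flatMap fun b => (List.range x).flatMap fun l =>
      linkWords r p q b l).length ≤ W) :
    Runs W writeLinks h ((50 * x + 10) * (k + 1) + 10) fun h' =>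
      Written h' (w ++ (List.range (k + 1)).flatMap fun b => (List.range x).flatMap fun l =>
      linkWords r p q b l) := by
  let R := [vtx, tmp, pos, arc, aux, ctr, round, actOff, sensOff]
  let J : ℕ → HState → Prop := fun i h' => h'.reg round = k + 1 - i ∧
    h'.reg actOff = i * p ∧ h'.reg sensOff = i * q ∧ SameUpToOutput R h h'
  have hc : writeLinkBody.cost ≤ 40 := by decide
  refine (Runs.seq (T₁ := 4) (Q₁ := fun h' => Written h' w ∧ J 0 h') (Runs.code ?_ ?_)
    (T₂ := (3 + ((40 + 1) * x + 1 + 4) + 1) * (k + 1) + 1) fun h₁ hh₁ =>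
    (Runs.write (k + 1) _ J (fun _ _ _ h => h.1) (fun i hi w' h' hw' hJ hW' =>
      Runs.seq (Q₁ := fun h'' => Written h'' w' ∧ h''.reg ctr = x ∧ h''.reg aux = 0 ∧ J i h'')
      (Runs.code ?_ ?_) fun h₂ hh₂ => Runs.seq (Q₁ := fun h'' => Written h'' (w' ++ _) ∧ J i h'')
      ((Runs.write x _ (fun j h'' => h''.reg ctr = x - j ∧ h''.reg aux = j ∧ J i h'')
        (fun _ _ _ h => h.1) (fun j hj w'' h'' hw'' hJ' hW'' => (Runs.code ?_ ?_).mono hc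
          fun _ h => h)
        hh₂.1 ⟨hh₂.2.1, hh₂.2.2⟩ hW').mono le_rfl fun _ h => ⟨h.1, h.2.2.2⟩)
      fun h₃ hh₃ => Runs.code ?_ ?_) hh₁.1 hh₁.2 hW).mono
      le_rfl fun _ h => h.1).mono ?_ fun _ h => h
  · simp
  · refine ⟨by simpa [Written] using hw, by simp [hk, hone], by simp, by simp, fun r hr => ?_,
      by simp⟩
    simp only [R, List.mem_cons, List.not_mem_nil, or_false, not_or] at hr
    simp [hr]
  · simp
  · have hN' : h'.reg numLink = x := by rw [hJ.2.2.2.1 _ (by decide), hx]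
    refine ⟨by simpa [Written] using hw', by simp [hN'], by simp, by simpa using hJ.1,
      by simpa using hJ.2.1, by simpa using hJ.2.2.1, hJ.2.2.2.trans ⟨fun r hr => ?_, by simp⟩⟩
    simp only [R, List.mem_cons, List.not_mem_nil, or_false, not_or] at hr
    simp [hr]
  · obtain ⟨h1, h2, h3, h4, h5, h6⟩ := hJ'
    exact (writeLinkBody_eval (by rw [h6.1 _ (by decide), hone]) w'' hw''
      (by rw [h6.1 _ (by decide), hr]) (by rw [h6.1 _ (by decide), hp])
      (by rw [h6.1 _ (by decide), hq]) h2 h4 h5).2.2.2.2 W hW''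
  · obtain ⟨h1, h2, h3, h4, h5, h6⟩ := hJ'
    obtain ⟨k1, k2, k3, k4, -⟩ := writeLinkBody_eval (by rw [h6.1 _ (by decide), hone]) w'' hw''
      (by rw [h6.1 _ (by decide), hr]) (by rw [h6.1 _ (by decide), hp])
      (by rw [h6.1 _ (by decide), hq]) h2 h4 h5
    refine ⟨k1, by rw [k3, h1]; omega, k2, by rw [k4.1 _ (by decide), h3],
      by rw [k4.1 _ (by decide), h4], by rw [k4.1 _ (by decide), h5], h6.trans (k4.mono ?_)⟩
    simp [R]
  · simp
  · obtain ⟨h0, h1, h2, h3, h4⟩ := hh₃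
    have hone' : h₃.reg one = 1 := by rw [h4.1 _ (by decide), hone]
    have hp' : h₃.reg numSrc = p := by rw [h4.1 _ (by decide), hp]
    have hq' : h₃.reg numSnk = q := by rw [h4.1 _ (by decide), hq]
    refine ⟨by simpa [Written] using h0, by simp [hone', h1]; omega, by simp [h2, hp']; ring,
      by simp [h3, hq']; ring, h4.trans ⟨fun r hr => ?_, by simp⟩⟩
    simp only [R, List.mem_cons, List.not_mem_nil, or_false, not_or] at hr
    simp [hr]
  · have : (3 + ((40 + 1) * x + 1 + 4) + 1) * (k + 1) ≤ (50 * x + 10) * (k + 1) :=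
      Nat.mul_le_mul_right _ (by omega)
    omega

end RAM

namespace RAM

open Relation Reg Code

/-- Compute the sizes of the output, and write them. -/
def writeSizes : Cmd :=
  .seq (seqs [cst totAct 0, cst totSens 0, cst totLink 0, sub tmp numSnk numSrc,
    add numLink numSrc tmp, add ctr bound one]).compile <|
  .seq (.whileNonzero ctr.idx (seqs [add totAct totAct numSrc, add totSens totSens numSnk,
    add totLink totLink numLink, sub ctr ctr one]).compile)
  (seqs [cst pos 0, putLow pos totAct, add pos pos one, putLow pos totSens, add pos pos one,
    putLow pos totLink, add pos pos one]).compile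

theorem runs_writeSizes {W k p q : ℕ} {h : HState} (hone : h.reg one = 1) (hk : h.reg bound = k)
    (hp : h.reg numSrc = p) (hq : h.reg numSnk = q) (hW : 3 ≤ W) :
    Runs W writeSizes h (10 * (k + 1) + 20) fun h' =>
      Written h' [(k + 1) * p, (k + 1) * q, (k + 1) * (p + (q - p))] ∧
      h'.reg numLink = p + (q - p) ∧
      SameUpToOutput [totAct, totSens, totLink, tmp, numLink, ctr, pos] h h' := by
  let I : ℕ → HState → Prop := fun i h' => h'.reg ctr = k + 1 - i ∧ h'.reg totAct = i * p ∧
    h'.reg totSens = i * q ∧ h'.reg totLink = i * (p + (q - p)) ∧ h'.reg numLink = p + (q - p) ∧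
    SameUpToOutput [totAct, totSens, totLink, tmp, numLink, ctr, pos] h h'
  refine (Runs.seq (T₁ := 7) (Q₁ := I 0) (Runs.code ?_ ?_) (T₂ := (5 + 1) * (k + 1) + 1 + 8)
    fun h₁ hh₁ => Runs.seq (Q₁ := I (k + 1)) (Runs.range (k + 1) I (fun _ _ _ h => h.1)
      (fun i hi h' hI => Runs.code ?_ ?_) hh₁) fun h₂ hh₂ => Runs.code ?_ ?_).mono (by omega)
      fun _ h => h
  · simp
  · refine ⟨by simp [hk, hone], by simp, by simp, by simp, by simp [hp, hq], fun r hr => ?_,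
      by simp⟩
    simp only [List.mem_cons, List.not_mem_nil, or_false, not_or] at hr
    simp [hr]
  · simp
  · obtain ⟨h1, h2, h3, h4, h5, h6⟩ := hI
    have hone' : h'.reg one = 1 := by rw [h6.1 _ (by decide), hone]
    have hp' : h'.reg numSrc = p := by rw [h6.1 _ (by decide), hp]
    have hq' : h'.reg numSnk = q := by rw [h6.1 _ (by decide), hq]
    refine ⟨by simp [h1, hone']; omega, by simp [h2, hp']; ring, by simp [h3, hq']; ring,
      by simp [h4, h5]; ring, by simpa using h5, h6.trans ⟨fun r hr => ?_, by simp⟩⟩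
    simp only [List.mem_cons, List.not_mem_nil, or_false, not_or] at hr
    simp [hr]
  · obtain ⟨h1, h2, h3, h4, h5, h6⟩ := hh₂
    have hone' : h₂.reg one = 1 := by rw [h6.1 _ (by decide), hone]
    simp [hone']
    omega
  · obtain ⟨h1, h2, h3, h4, h5, h6⟩ := hh₂
    have hone' : h₂.reg one = 1 := by rw [h6.1 _ (by decide), hone]
    refine ⟨⟨by simp [hone'], fun a ha => ?_⟩, by simpa using h5,
      h6.trans ⟨fun r hr => ?_, by simp⟩⟩
    · have : a = 0 ∨ a = 1 ∨ a = 2 := by simp at ha; omega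
      rcases this with rfl | rfl | rfl <;> simp [hone', h2, h3, h4]
    · simp only [List.mem_cons, List.not_mem_nil, or_false, not_or] at hr
      simp [hr]

/-! ### The whole computation -/

theorem IsStack.map_range {f : ℕ → ℕ} : ∀ {l : List ℕ}, IsStack f l →
    (List.range l.length).map f = l.reverse
  | [], _ => rfl
  | x :: l, h => by
    rw [List.length_cons, List.range_succ, List.map_append, h.2.map_range]
    simp [h.1]

theorem IsStack.mem_iff {f : ℕ → ℕ} {l : List ℕ} (h : IsStack f l) {v : ℕ} :
    v ∈ l ↔ ∃ i < l.length, f i = v := by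
  rw [← List.mem_reverse, ← h.map_range]
  simp

theorem IsStack.injOn {f : ℕ → ℕ} {l : List ℕ} (h : IsStack f l) (hl : l.Nodup) {i j : ℕ}
    (hi : i < l.length) (hj : j < l.length) (hij : f i = f j) : i = j := by
  rw [← List.nodup_reverse, ← h.map_range] at hl
  exact List.inj_on_of_nodup_map hl (List.mem_range.2 hi) (List.mem_range.2 hj) hij

theorem IsStack.of_append {f : ℕ → ℕ} {l l' : List ℕ} (h : IsStack f (l ++ l')) :
    IsStack f l' := by
  induction l with
  | nil => exact h
  | cons x l ih => exact ih h.2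

theorem IsStack.mem_pairs {f g : ℕ → ℕ} {P : List (ℕ × ℕ)} (hf : IsStack f (P.map Prod.fst))
    (hg : IsStack g (P.map Prod.snd)) {e : ℕ × ℕ} : e ∈ P ↔ ∃ l < P.length, (f l, g l) = e := by
  induction P with
  | nil => simp
  | cons x P ih =>
    have h1 : f P.length = x.1 := by simpa using hf.1
    have h2 : g P.length = x.2 := by simpa using hg.1
    rw [List.mem_cons, ih hf.2 hg.2, List.length_cons]
    constructor
    · rintro (rfl | ⟨l, hl, he⟩)
      · exact ⟨P.length, by omega, by rw [h1, h2]⟩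
      · exact ⟨l, by omega, he⟩
    · rintro ⟨l, hl, he⟩
      by_cases hlP : l = P.length
      · left
        rw [← he, hlP, h1, h2]
      · exact Or.inr ⟨l, by omega, he⟩

/-- The first `p` values of `a` are one vertex of every strong component without predecessors, the
first `q` values of `s` one vertex of every strong component without successors, with respect to
the reachability `R`, and the first `r` of each are paired in such a way that every source reaches,
and every sink is reached from, a member of a pair. -/
structure IsPairedBases (R : ℕ → ℕ → Prop) (n p q r : ℕ) (a s : ℕ → ℕ) : Prop where
  act_lt : ∀ i < p, a i < n
  sens_lt : ∀ j < q, s j < n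
  act_reach : ∀ v < n, ∃ i < p, R (a i) v
  sens_reach : ∀ v < n, ∃ j < q, R v (s j)
  act_indep : ∀ i < p, ∀ j < p, R (a i) (a j) → i = j
  sens_indep : ∀ i < q, ∀ j < q, R (s i) (s j) → i = j
  le_act : r ≤ p
  le_sens : r ≤ q
  pair : ∀ l < r, R (a l) (s l)
  act_pair : ∀ i < p, ∃ l < r, R (a i) (s l)
  sens_pair : ∀ j < q, ∃ l < r, R (a l) (s j)

theorem IsLabelledBasis.nodup {R : ℕ → ℕ → Prop} {n : ℕ} {lab : ℕ → ℕ} {S : List ℕ}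
    (h : IsLabelledBasis R n lab S) (hR : ∀ v, R v v) : S.Nodup :=
  h.indep.imp fun {a b} hab (he : a = b) => hab.1 (he ▸ hR a)

theorem IsLabelledBasis.eq_of_reach {R : ℕ → ℕ → Prop} {n : ℕ} {lab : ℕ → ℕ} {S : List ℕ}
    (h : IsLabelledBasis R n lab S) {a b : ℕ} (ha : a ∈ S) (hb : b ∈ S) (hab : R a b) : a = b := by
  by_contra hne
  have : Std.Symm fun a b => ¬ R a b ∧ ¬ R b a := ⟨fun _ _ => And.symm⟩
  exact (h.indep.forall ha hb hne).1 hab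

theorem IsLabelledBasis.length_le {R : ℕ → ℕ → Prop} {n : ℕ} {lab : ℕ → ℕ} {S : List ℕ}
    (h : IsLabelledBasis R n lab S) (hR : ∀ v, R v v) : S.length ≤ n := by
  have := (List.subperm_of_subset (h.nodup hR) (l₂ := List.range n)
    fun v hv => List.mem_range.2 (h.lt v hv)).length_le
  simpa using this

/-- The tables `a` and `s` begin with the matched members, in the order of the pairs, and continue
with the unmatched ones. -/
theorem isPairedBases_of_stacks {R : ℕ → ℕ → Prop} {n : ℕ} {labF labR a s : ℕ → ℕ}
    {S T A B : List ℕ} {P : List (ℕ × ℕ)} (hrefl : ∀ v, R v v)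
    (hS : IsLabelledBasis R n labF S) (hT : IsLabelledBasis (fun v w => R w v) n labR T)
    (hP : IsPairing R S T P)
    (hcovS : ∀ v ∈ S, ∃ w, R v w ∧ (v ∈ P.map Prod.fst ∨ w ∈ P.map Prod.snd))
    (hcovT : ∀ w ∈ T, ∃ v, R v w ∧ (v ∈ P.map Prod.fst ∨ w ∈ P.map Prod.snd))
    (ha : IsStack a (A ++ P.map Prod.fst)) (hs : IsStack s (B ++ P.map Prod.snd))
    (hA : A.Nodup) (hB : B.Nodup) (hAS : ∀ v, v ∈ A ↔ v ∈ S ∧ v ∉ P.map Prod.fst)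
    (hBT : ∀ v, v ∈ B ↔ v ∈ T ∧ v ∉ P.map Prod.snd) :
    IsPairedBases R n S.length T.length P.length a s := by
  have memS : ∀ v, v ∈ A ++ P.map Prod.fst ↔ v ∈ S := fun v => by
    rw [List.mem_append, hAS]
    constructor
    · rintro (h | h)
      · exact h.1
      · obtain ⟨e, he, rfl⟩ := List.mem_map.1 h
        exact (hP.mem e he).2.1
    · intro h
      by_cases hv : v ∈ P.map Prod.fst
      · exact Or.inr hv
      · exact Or.inl ⟨h, hv⟩
  have memT : ∀ v, v ∈ B ++ P.map Prod.snd ↔ v ∈ T := fun v => by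
    rw [List.mem_append, hBT]
    constructor
    · rintro (h | h)
      · exact h.1
      · obtain ⟨e, he, rfl⟩ := List.mem_map.1 h
        exact (hP.mem e he).2.2
    · intro h
      by_cases hv : v ∈ P.map Prod.snd
      · exact Or.inr hv
      · exact Or.inl ⟨h, hv⟩
  have ndS : (A ++ P.map Prod.fst).Nodup := hA.append hP.fst fun v hv hv' => ((hAS v).1 hv).2 hv'
  have ndT : (B ++ P.map Prod.snd).Nodup := hB.append hP.snd fun v hv hv' => ((hBT v).1 hv).2 hv'
  have lenS : (A ++ P.map Prod.fst).length = S.length :=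
    ((List.perm_ext_iff_of_nodup ndS (hS.nodup hrefl)).2 memS).length_eq
  have lenT : (B ++ P.map Prod.snd).length = T.length :=
    ((List.perm_ext_iff_of_nodup ndT (hT.nodup hrefl)).2 memT).length_eq
  have hpairs : ∀ {e}, e ∈ P ↔ ∃ l < P.length, (a l, s l) = e :=
    IsStack.mem_pairs ha.of_append hs.of_append
  have amem : ∀ i < S.length, a i ∈ S := fun i hi =>
    (memS _).1 (ha.mem_iff.2 ⟨i, lenS ▸ hi, rfl⟩)
  have smem : ∀ i < T.length, s i ∈ T := fun i hi =>
    (memT _).1 (hs.mem_iff.2 ⟨i, lenT ▸ hi, rfl⟩)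
  have fst_pair : ∀ v ∈ P.map Prod.fst, ∃ l < P.length, a l = v ∧ R v (s l) := fun v hv => by
    obtain ⟨e, he, rfl⟩ := List.mem_map.1 hv
    obtain ⟨l, hl, rfl⟩ := hpairs.1 he
    exact ⟨l, hl, rfl, (hP.mem _ he).1⟩
  have snd_pair : ∀ v ∈ P.map Prod.snd, ∃ l < P.length, s l = v ∧ R (a l) v := fun v hv => by
    obtain ⟨e, he, rfl⟩ := List.mem_map.1 hv
    obtain ⟨l, hl, rfl⟩ := hpairs.1 he
    exact ⟨l, hl, rfl, (hP.mem _ he).1⟩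
  refine ⟨fun i hi => hS.lt _ (amem i hi), fun i hi => hT.lt _ (smem i hi), fun v hv => ?_,
    fun v hv => ?_, fun i hi j hj hij => ?_, fun i hi j hj hij => ?_, ?_, ?_, fun l hl => ?_,
    fun i hi => ?_, fun j hj => ?_⟩
  · obtain ⟨o, ho, -, hov⟩ := hS.reach v hv
    obtain ⟨i, hi, rfl⟩ := ha.mem_iff.1 ((memS o).2 ho)
    exact ⟨i, lenS ▸ hi, hov⟩
  · obtain ⟨o, ho, -, hov⟩ := hT.reach v hv
    obtain ⟨i, hi, rfl⟩ := hs.mem_iff.1 ((memT o).2 ho)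
    exact ⟨i, lenT ▸ hi, hov⟩
  · exact ha.injOn ndS (lenS ▸ hi) (lenS ▸ hj) (hS.eq_of_reach (amem i hi) (amem j hj) hij)
  · exact hs.injOn ndT (lenT ▸ hi) (lenT ▸ hj)
      (hT.eq_of_reach (smem j hj) (smem i hi) hij).symm
  · simp [← lenS]
  · simp [← lenT]
  · exact (hP.mem _ (hpairs.2 ⟨l, hl, rfl⟩)).1
  · obtain ⟨w, hw, h | h⟩ := hcovS _ (amem i hi)
    · obtain ⟨l, hl, -, h'⟩ := fst_pair _ h
      exact ⟨l, hl, h'⟩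
    · obtain ⟨l, hl, rfl, h'⟩ := snd_pair _ h
      exact ⟨l, hl, hw⟩
  · obtain ⟨w, hw, h | h⟩ := hcovT _ (smem j hj)
    · obtain ⟨l, hl, rfl, h'⟩ := fst_pair _ h
      exact ⟨l, hl, hw⟩
    · obtain ⟨l, hl, -, h'⟩ := snd_pair _ h
      exact ⟨l, hl, h'⟩

/-- The computation after the tables have been located in the memory. -/
def solve : Cmd :=
  .seq readArcs <| .seq listVertices <|
  .seq (findBasis .headF .nextF .tgt .labF₁ .outF .labF .srcs numSrc) <|
  .seq (findBasis .headR .nextR .src .labR₁ .outR .labR .snks numSnk) <|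
  .seq matchPairs <| .seq (appendFree .usedS .srcs .acts numSrc actLen) <|
  .seq (appendFree .usedT .snks .sens numSnk sensLen) <| .seq writeSizes <|
  .seq (writeTable .acts numSrc) <| .seq (writeTable .sens numSnk) writeLinks

/-- The output for the actuators `a 0, …, a (p - 1)` and the sensors `s 0, …, s (q - 1)` of a
block, the first `r` of which are paired. The number of links of a block is `max p q`, computed as
`p + (q - p)` with truncated subtraction. -/
def outputWords (k p q r : ℕ) (a s : ℕ → ℕ) : List ℕ :=
  [(k + 1) * p, (k + 1) * q, (k + 1) * (p + (q - p))] ++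
    ((List.range (k + 1)).flatMap fun _ => (List.range p).flatMap fun i => [a i]) ++
    ((List.range (k + 1)).flatMap fun _ => (List.range q).flatMap fun j => [s j]) ++
    (List.range (k + 1)).flatMap fun b => (List.range (p + (q - p))).flatMap fun l =>
      linkWords r p q b l

theorem length_outputWords (k p q r : ℕ) (a s : ℕ → ℕ) : (outputWords k p q r a s).length =
    3 + (k + 1) * p + (k + 1) * q + (k + 1) * (2 * (p + (q - p))) := by
  simp [outputWords, linkWords, List.length_flatMap]
  ring

/-- The digraph with the arcs from `s e` to `t e`, for `e < m`. -/
def ListedArc (m : ℕ) (s t : ℕ → ℕ) (v w : ℕ) : Prop := ∃ e < m, s e = v ∧ t e = w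

theorem arc_arcsOf {m : ℕ} {s t t' : ℕ → ℕ} (h : ∀ e < m, t' e = t e) :
    Arc (arcsOf s m) t' = ListedArc m s t := by
  funext v w
  simp only [Arc, ListedArc, mem_arcsOf, eq_iff_iff]
  constructor
  · rintro ⟨e, ⟨he, hv⟩, hw⟩
    exact ⟨e, he, hv, by rw [← h e he, hw]⟩
  · rintro ⟨e, he, hv, hw⟩
    exact ⟨e, ⟨he, hv⟩, by rw [h e he, hw]⟩

/-- The memory below `W` has to be large enough for the input and for the output, which has at most
`4 * n` words for each of the `k + 1` blocks, apart from the three sizes. -/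
theorem runs_solve {W n m k : ℕ} {s t : ℕ → ℕ} {h : HState} (hW : 3 + 2 * m + 4 * n * (k + 1) ≤ W)
    (hone : h.reg one = 1) (hn : h.reg numV = n) (hm : h.reg numE = m) (hk : h.reg bound = k)
    (hs : ∀ e < m, h.low (3 + 2 * e) = s e) (ht : ∀ e < m, h.low (3 + 2 * e + 1) = t e)
    (hsn : ∀ e < m, s e < n) (htn : ∀ e < m, t e < n) (htab : ∀ t i, h.tab t i = 0) :
    Runs W solve h (10000 * ((k + 1) * (n + m + 1))) fun h' => ∃ p q r a b,
      IsPairedBases (ReflTransGen (ListedArc m s t)) n p q r a b ∧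
      Written h' (outputWords k p q r a b) ∧ (outputWords k p q r a b).length ≤ W := by
  let R := ReflTransGen (ListedArc m s t)
  have hRrefl : ∀ v, R v v := fun _ => .refl
  intro s₀ hs₀
  refine Runs.mono (T := 100 * m + 5 + (20 * n + 5 + (1000 * (n + m) + 50 + (1000 * (n + m) + 50 +
    (100 * (n + n) + 20 + (40 * n + 5 + (40 * n + 5 + (10 * (k + 1) + 20 +
    ((20 * n + 10) * (k + 1) + 5 + ((20 * n + 10) * (k + 1) + 5 +
    ((50 * (n + n) + 10) * (k + 1) + 10)))))))))))
    (Runs.seq (runs_readArcs (s := s) (t := t) (by omega) hone hm hs ht (htab _) (htab _))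
    fun h₁ hh₁ => ?_) ?_ (fun _ h => h) s₀ hs₀
  · obtain ⟨hsrc, htgt, hF, hB, e₁⟩ := hh₁
    refine Runs.seq (runs_listVertices (n := n) (by rw [e₁.1 _ (by decide), hone])
      (by rw [e₁.1 _ (by decide), hn])) fun h₂ hh₂ => ?_
    obtain ⟨hst, e₂⟩ := hh₂
    have f₂ : ∀ t, t ∉ ([.starts] : List Tab) → h₂.tab t = h₁.tab t := e₂.2.1
    refine Runs.seq (runs_findBasis (n := n) (m := m) (f := s) (by decide) (by decide)
      (by rw [e₂.1 _ (by decide), e₁.1 _ (by decide), hone])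
      (by rw [e₂.1 _ (by decide), e₁.1 _ (by decide), hn]) hsn
      (by rw [f₂ _ (by decide), f₂ _ (by decide)]; exact hF)
      (by rw [f₂ _ (by decide)]; exact fun e he => by rw [htgt e he]; exact htn e he)
      (by rw [f₂ _ (by decide), e₁.2.1 _ (by decide)]; exact htab _)
      (by rw [f₂ _ (by decide), e₁.2.1 _ (by decide)]; exact htab _) hst) fun h₃ hh₃ => ?_
    obtain ⟨S, hS₁, hS₂, hS₃, e₃⟩ := hh₃
    rw [f₂ _ (by decide), arc_arcsOf htgt] at hS₃
    refine Runs.seq (runs_findBasis (n := n) (m := m) (f := t) (by decide) (by decide)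
      (by rw [e₃.1 _ (by decide), e₂.1 _ (by decide), e₁.1 _ (by decide), hone])
      (by rw [e₃.1 _ (by decide), e₂.1 _ (by decide), e₁.1 _ (by decide), hn]) htn
      (by rw [e₃.2.1 _ (by decide), e₃.2.1 _ (by decide), f₂ _ (by decide), f₂ _ (by decide)]
          exact hB)
      (by rw [e₃.2.1 _ (by decide), f₂ _ (by decide)]
          exact fun e he => by rw [hsrc e he]; exact hsn e he)
      (by rw [e₃.2.1 _ (by decide), f₂ _ (by decide), e₁.2.1 _ (by decide)]; exact htab _)
      (by rw [e₃.2.1 _ (by decide), f₂ _ (by decide), e₁.2.1 _ (by decide)]; exact htab _)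
      (by rw [e₃.2.1 _ (by decide)]; exact hst)) fun h₄ hh₄ => ?_
    obtain ⟨T, hT₁, hT₂, hT₃, e₄⟩ := hh₄
    rw [e₃.2.1 _ (by decide), f₂ _ (by decide), arc_arcsOf hsrc] at hT₃
    have hswap : ReflTransGen (ListedArc m t s) = fun v w => R w v := by
      have : ListedArc m t s = Function.swap (ListedArc m s t) := by
        funext v w
        simp only [ListedArc, Function.swap, and_comm]
      rw [this]
      funext v w
      exact propext reflTransGen_swap
    rw [hswap] at hT₃
    rw [← e₄.2.1 _ (by decide)] at hS₃ hS₁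
    rw [← e₄.1 _ (by decide)] at hS₂
    have hSn := hS₃.length_le hRrefl
    have hTn := hT₃.length_le hRrefl
    have hone₄ : h₄.reg one = 1 := by
      rw [e₄.1 _ (by decide), e₃.1 _ (by decide), e₂.1 _ (by decide), e₁.1 _ (by decide), hone]
    have hk₄ : h₄.reg bound = k := by
      rw [e₄.1 _ (by decide), e₃.1 _ (by decide), e₂.1 _ (by decide), e₁.1 _ (by decide), hk]
    refine Runs.seq ((runs_matchPairs hone₄ hS₃ hT₃ hS₁ hT₁ hS₂ hT₂
      (by rw [e₄.2.1 _ (by decide), e₃.2.1 _ (by decide), f₂ _ (by decide), e₁.2.1 _ (by decide)]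
          exact htab _)
      (by rw [e₄.2.1 _ (by decide), e₃.2.1 _ (by decide), f₂ _ (by decide), e₁.2.1 _ (by decide)]
          exact htab _)).mono (by omega) fun _ h => h) fun h₅ hh₅ => ?_
    obtain ⟨P, hP₁, hP₂, hP₃, hP₄, e₅⟩ := hh₅
    refine Runs.seq ((runs_appendFree (S := S) (A := P.map Prod.fst) (by decide) (by decide)
      (by decide) (by decide) (by rw [e₅.1 _ (by decide), hone₄]) (hS₃.nodup hRrefl)
      (by rwa [e₅.2.1 _ (by decide)]) (by rwa [e₅.1 _ (by decide)]) hP₁.acts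
      (by rw [hP₁.num, List.length_map]) hP₁.usedS).mono (by omega) fun _ h => h) fun h₆ hh₆ => ?_
    obtain ⟨A, hA₁, -, hA₂, hA₃, e₆⟩ := hh₆
    refine Runs.seq ((runs_appendFree (S := T) (A := P.map Prod.snd) (by decide) (by decide)
      (by decide) (by decide) (by rw [e₆.1 _ (by decide), e₅.1 _ (by decide), hone₄])
      (hT₃.nodup hRrefl) (by rwa [e₆.2.1 _ (by decide), e₅.2.1 _ (by decide)])
      (by rwa [e₆.1 _ (by decide), e₅.1 _ (by decide)])
      (by rw [e₆.2.1 _ (by decide)]; exact hP₁.sens)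
      (by rw [e₆.1 _ (by decide), hP₁.num, List.length_map])
      (by rw [e₆.2.1 _ (by decide)]; exact hP₁.usedT)).mono (by omega) fun _ h => h)
        fun h₇ hh₇ => ?_
    obtain ⟨B, hB₁, -, hB₂, hB₃, e₇⟩ := hh₇
    have hreg : ∀ r, r ∉ [actLen, sensLen, tmp, ctr, vtx, wtx, numPair] →
        h₇.reg r = h₄.reg r := fun r hr => by
      simp only [List.mem_cons, List.not_mem_nil, or_false, not_or] at hr
      rw [e₇.1 _ (by simp [hr]), e₆.1 _ (by simp [hr]), e₅.1 _ (by simp [hr])]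
    have hone₇ : h₇.reg one = 1 := by rw [hreg _ (by decide), hone₄]
    have hk₇ : h₇.reg bound = k := by rw [hreg _ (by decide), hk₄]
    have hp₇ : h₇.reg numSrc = S.length := by rw [hreg _ (by decide), hS₂]
    have hq₇ : h₇.reg numSnk = T.length := by rw [hreg _ (by decide), hT₂]
    have hr₇ : h₇.reg numPair = P.length := by
      rw [e₇.1 _ (by decide), e₆.1 _ (by decide), hP₁.num]
    rw [← e₇.2.1 _ (by decide)] at hA₁
    have hbases := isPairedBases_of_stacks hRrefl hS₃ hT₃ hP₂ hP₃ hP₄ hA₁ hB₁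
      hA₂ hB₂ hA₃ hB₃
    have hlen : (outputWords k S.length T.length P.length (h₇.tab .acts) (h₇.tab .sens)).length
        ≤ W := by
      have h1 : (k + 1) * S.length ≤ (k + 1) * n := Nat.mul_le_mul_left _ hSn
      have h2 : (k + 1) * T.length ≤ (k + 1) * n := Nat.mul_le_mul_left _ hTn
      have h3 : (k + 1) * (2 * (S.length + (T.length - S.length))) ≤ (k + 1) * (2 * n) :=
        Nat.mul_le_mul_left _ (by omega)
      have h4 : 4 * n * (k + 1) = (k + 1) * n + (k + 1) * n + (k + 1) * (2 * n) := by ring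
      rw [length_outputWords]
      omega
    have hlen' := hlen
    rw [outputWords] at hlen'
    simp only [List.length_append] at hlen'
    refine Runs.seq (runs_writeSizes hone₇ hk₇ hp₇ hq₇ (by omega)) fun h₈ hh₈ => ?_
    obtain ⟨w₈, hx₈, e₈⟩ := hh₈
    refine Runs.seq ((runs_writeTable (k := k) (N := S.length) (t := .acts) (by decide)
      (by rw [e₈.1 _ (by decide), hone₇])
      (by rw [e₈.1 _ (by decide), hk₇]) (by rw [e₈.1 _ (by decide), hp₇]) w₈
      (by rw [e₈.2]; omega)).mono
      (Nat.add_le_add_right (Nat.mul_le_mul_right _ (by omega)) _) fun _ h => h) fun h₉ hh₉ => ?_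
    obtain ⟨w₉, e₉⟩ := hh₉
    rw [e₈.2] at w₉
    refine Runs.seq ((runs_writeTable (k := k) (N := T.length) (t := .sens) (by decide)
      (by rw [e₉.1 _ (by decide), e₈.1 _ (by decide), hone₇])
      (by rw [e₉.1 _ (by decide), e₈.1 _ (by decide), hk₇])
      (by rw [e₉.1 _ (by decide), e₈.1 _ (by decide), hq₇]) w₉
      (by rw [e₉.2, e₈.2, List.length_append]; omega)).mono
      (Nat.add_le_add_right (Nat.mul_le_mul_right _ (by omega)) _) fun _ h => h) fun h' hh' => ?_
    obtain ⟨w', e'⟩ := hh'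
    rw [e₉.2, e₈.2] at w'
    refine (runs_writeLinks (k := k) (r := P.length) (p := S.length) (q := T.length)
      (by rw [e'.1 _ (by decide), e₉.1 _ (by decide), e₈.1 _ (by decide), hone₇])
      (by rw [e'.1 _ (by decide), e₉.1 _ (by decide), e₈.1 _ (by decide), hk₇])
      (by rw [e'.1 _ (by decide), e₉.1 _ (by decide), e₈.1 _ (by decide), hr₇])
      (by rw [e'.1 _ (by decide), e₉.1 _ (by decide), e₈.1 _ (by decide), hp₇])
      (by rw [e'.1 _ (by decide), e₉.1 _ (by decide), e₈.1 _ (by decide), hq₇])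
      (by rw [e'.1 _ (by decide), e₉.1 _ (by decide), hx₈]) w'
      (by rw [List.length_append, List.length_append]; omega)).mono
      (Nat.add_le_add_right (Nat.mul_le_mul_right _ (by omega)) _) fun h'' w'' =>
        ⟨_, _, _, _, _, hbases, w'', hlen⟩
  · have h1 : (k + 1) * (n + m + 1) = (k + 1) * n + k * m + m + k + 1 := by ring
    have h2 : (20 * n + 10) * (k + 1) = 20 * ((k + 1) * n) + 10 * k + 10 := by ring
    have h3 : (50 * (n + n) + 10) * (k + 1) = 100 * ((k + 1) * n) + 10 * k + 10 := by ring
    have h4 : n ≤ (k + 1) * n := Nat.le_mul_of_pos_left _ (Nat.succ_pos k)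
    omega

end RAM

namespace RAM

open Relation Reg Code

/-! ### The prologue -/

/-- Read the parameters, and prepare the choice of the position of the tables in the memory. -/
def readParameters : Cmd :=
  .seq (.const 0 0) <| .seq (.load numV.idx 0) <| .seq (.const 0 1) <| .seq (.load numE.idx 0) <|
  .seq (.const 0 2) <| .seq (.load bound.idx 0) <| .seq (.const 2 3) <| .seq (.add 2 2 numE.idx) <|
  .seq (.add 2 2 numE.idx) <| .seq (.const one.idx 1) <| .seq (.add ctr.idx bound.idx one.idx) <|
  .seq (.add 0 numV.idx numV.idx) (.add 0 0 0)

/-- The tables start above the input and above the output. There is no multiplication, hence the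
loop. -/
def locateTables : Cmd :=
  .seq readParameters (.whileNonzero ctr.idx (.seq (.add 2 2 0) (.sub ctr.idx ctr.idx one.idx)))

theorem exec_addRepeatedly (c : ℕ) : ∀ s : State, s.reg ctr.idx = c → s.reg one.idx = 1 →
    ∃ s', Exec (.whileNonzero ctr.idx (.seq (.add 2 2 0) (.sub ctr.idx ctr.idx one.idx))) s s'
      (3 * c + 1) ∧ s'.mem = s.mem ∧ s'.reg 2 = s.reg 2 + c * s.reg 0 ∧
      ∀ r, r ≠ 2 → r ≠ ctr.idx → s'.reg r = s.reg r := by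
  induction c with
  | zero => exact fun s hc _ => ⟨s, .whileFalse hc, rfl, by simp, fun _ _ _ => rfl⟩
  | succ c ih =>
    intro s hc h1
    have hs : (⟨Function.update (Function.update s.reg 2 (s.reg 2 + s.reg 0)) ctr.idx c,
        s.mem⟩ : State).reg ctr.idx = c := by simp
    obtain ⟨s', he, h2, h3, h4⟩ := ih _ hs (by
      simpa [show one.idx ≠ ctr.idx by decide, show one.idx ≠ 2 by decide] using h1)
    have hstep : Exec (.seq (.add 2 2 0) (.sub ctr.idx ctr.idx one.idx)) s
        ⟨Function.update (Function.update s.reg 2 (s.reg 2 + s.reg 0)) ctr.idx c, s.mem⟩ 2 := by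
      have := Exec.seq (.add s 2 2 0) (.sub _ ctr.idx ctr.idx one.idx)
      simpa [show one.idx ≠ 2 by decide, show ctr.idx ≠ 2 by decide, hc, h1] using this
    refine ⟨s', ?_, h2, ?_, fun r hr hr' => ?_⟩
    · have := Exec.whileTrue (by rw [hc]; exact Nat.succ_ne_zero c) hstep he
      convert this using 1
      ring
    · rw [h3]
      simp [show (2 : ℕ) ≠ ctr.idx by decide, show (0 : ℕ) ≠ ctr.idx by decide]
      ring
    · rw [h4 r hr hr']
      simp [hr, hr']

theorem exec_locateTables (input : List ℕ) {n m k : ℕ} (hn : input.getD 0 0 = n)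
    (hm : input.getD 1 0 = m) (hk : input.getD 2 0 = k) (hlen : input.length ≤ 3 + 2 * m) :
    ∃ s h, Exec locateTables (initial input) s (3 * (k + 1) + 14) ∧
      Rep (3 + 2 * m + 4 * n * (k + 1)) s h ∧ h.reg one = 1 ∧ h.reg numV = n ∧ h.reg numE = m ∧
      h.reg bound = k ∧ (∀ t i, h.tab t i = 0) ∧ ∀ a, h.low a = input.getD a 0 := by
  have i1 : numV.idx = 3 := rfl
  have i2 : numE.idx = 4 := rfl
  have i3 : bound.idx = 5 := rfl
  have i4 : one.idx = 6 := rfl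
  have i5 : ctr.idx = 7 := rfl
  have hprefix : ∃ s, Exec readParameters (initial input) s 13 ∧
      s.mem = (initial input).mem ∧ s.reg ctr.idx = k + 1 ∧ s.reg one.idx = 1 ∧
      s.reg numV.idx = n ∧ s.reg numE.idx = m ∧ s.reg bound.idx = k ∧ s.reg 2 = 3 + 2 * m ∧
      s.reg 0 = 4 * n := by
    refine ⟨_, .seq (.const ..) <| .seq (.load ..) <| .seq (.const ..) <| .seq (.load ..) <|
      .seq (.const ..) <| .seq (.load ..) <| .seq (.const ..) <| .seq (.add ..) <|
      .seq (.add ..) <| .seq (.const ..) <| .seq (.add ..) <| .seq (.add ..) (.add ..), ?_⟩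
    simp only [i1, i2, i3, i4, i5, initial]
    simp [← hn, ← hm, ← hk]
    constructor <;> ring
  obtain ⟨s, hs, hmem, h1, h2, h3, h4, h5, h6, h7⟩ := hprefix
  obtain ⟨s', he, k1, k2, k3⟩ := exec_addRepeatedly (k + 1) s h1 h2
  refine ⟨s', ⟨fun r => s'.reg r.idx, fun _ _ => 0, s'.mem⟩, ?_, ⟨fun _ => rfl, ?_,
    fun t i => ?_, fun _ _ => rfl⟩, ?_, ?_, ?_, ?_, fun _ _ => rfl, fun a => ?_⟩
  · rw [show 3 * (k + 1) + 14 = 13 + (3 * (k + 1) + 1) by ring]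
    exact .seq hs he
  · rw [k2, h6, h7]; ring
  · rw [k1, hmem]
    exact List.getD_eq_default _ _ (by omega)
  · rw [← h2]; exact k3 _ (by decide) (by decide)
  · rw [← h3]; exact k3 _ (by decide) (by decide)
  · rw [← h4]; exact k3 _ (by decide) (by decide)
  · rw [← h5]; exact k3 _ (by decide) (by decide)
  · dsimp only; rw [k1, hmem]; rfl

/-- The program that computes a solution of the co-design problem for stabilization. -/
def designProgram : Cmd := .seq locateTables solve

theorem getD_flatMap_pair {α : Type} (E : List α) (f g : α → ℕ) : ∀ e,
    (E.flatMap fun x => [f x, g x]).getD (2 * e) 0 = (E.map f).getD e 0 ∧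
    (E.flatMap fun x => [f x, g x]).getD (2 * e + 1) 0 = (E.map g).getD e 0 := by
  induction E with
  | nil => simp
  | cons x E ih =>
    rintro (_ | e)
    · simp
    · have := ih e
      simpa [Nat.mul_add] using this

theorem exec_designProgram {n : ℕ} (E : List (Fin n × Fin n)) (k : ℕ) :
    ∃ s' t p q r a b, Exec designProgram (initial (encodeInstance E k)) s' t ∧
      t ≤ 10020 * ((k + 1) * (n + E.length + 1)) ∧
      IsPairedBases (ReflTransGen fun v w => ∃ e ∈ E, (e.1 : ℕ) = v ∧ (e.2 : ℕ) = w) n p q r a b ∧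
      Holds s' (outputWords k p q r a b) := by
  obtain ⟨s, h, he, hR, hone, hn, hm, hk, htab, hlow⟩ :=
    exec_locateTables (encodeInstance E k) (n := n) (m := E.length) (k := k) rfl rfl rfl
      (by simp [encodeInstance, List.length_flatMap]; omega)
  have hfl := getD_flatMap_pair E (fun e => (e.1 : ℕ)) fun e => (e.2 : ℕ)
  have hs : ∀ e < E.length, h.low (3 + 2 * e) = (E.map fun e => (e.1 : ℕ)).getD e 0 := fun e _ => by
    rw [hlow, ← (hfl e).1, Nat.add_comm]; rfl
  have ht : ∀ e < E.length, h.low (3 + 2 * e + 1) = (E.map fun e => (e.2 : ℕ)).getD e 0 :=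
    fun e _ => by
      rw [hlow, ← (hfl e).2, show 3 + 2 * e + 1 = 2 * e + 1 + 3 by omega]; rfl
  have hlt : ∀ f : Fin n × Fin n → Fin n, ∀ e < E.length,
      (E.map fun x => (f x : ℕ)).getD e 0 < n := fun f e he => by
    simp [he]
  obtain ⟨s', t, h', he', ht', hR', p, q, r, a, b, hb, hw, hl⟩ :=
    runs_solve (le_refl (3 + 2 * E.length + 4 * n * (k + 1))) hone hn hm hk hs ht
      (hlt _) (hlt _) htab s hR
  refine ⟨s', _, p, q, r, a, b, .seq he he', ?_, ?_, fun i hi => ?_⟩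
  · have : k + 1 ≤ (k + 1) * (n + E.length + 1) := Nat.le_mul_of_pos_right _ (by omega)
    omega
  · convert hb using 1
    congr 1
    funext v w
    simp only [ListedArc, eq_iff_iff]
    constructor
    · rintro ⟨e, he, rfl, rfl⟩
      obtain ⟨i, hi, rfl⟩ := List.mem_iff_getElem.1 he
      exact ⟨i, hi, by simp [hi], by simp [hi]⟩
    · rintro ⟨i, hi, rfl, rfl⟩
      exact ⟨E[i], List.getElem_mem hi, by simp [hi], by simp [hi]⟩
  · rw [hR'.low _ (by omega), hw.2 i hi]

end RAM

/-! ### The computed design -/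

section PairedBases

open Relation RAM Matrix

variable {n k p q r : ℕ} {PA : Matrix (Fin n) (Fin n) Bool} {E : List (Fin n × Fin n)}
  {a b : ℕ → ℕ}

theorem reflTransGen_listed_iff (hE : ∀ i j, (i, j) ∈ E ↔ PA j i = true) {i : Fin n} {w : ℕ} :
    ReflTransGen (fun v w => ∃ e ∈ E, (e.1 : ℕ) = v ∧ (e.2 : ℕ) = w) i w ↔
      ∃ j : Fin n, (j : ℕ) = w ∧ StateReaches PA i j := by
  constructor
  · intro h
    induction h with
    | refl => exact ⟨i, rfl, .refl⟩
    | tail _ hbc ih =>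
      obtain ⟨j, rfl, hj⟩ := ih
      obtain ⟨e, he, h1, rfl⟩ := hbc
      refine ⟨e.2, rfl, hj.tail ((hE _ _).1 ?_)⟩
      rwa [← Fin.ext h1]
  · rintro ⟨j, rfl, h⟩
    induction h with
    | refl => exact .refl
    | tail _ hbc ih => exact ih.tail ⟨_, (hE _ _).2 hbc, rfl, rfl⟩

theorem reflTransGen_listed_coe_iff (hE : ∀ i j, (i, j) ∈ E ↔ PA j i = true) {i j : Fin n} :
    ReflTransGen (fun v w => ∃ e ∈ E, (e.1 : ℕ) = v ∧ (e.2 : ℕ) = w) i j ↔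
      StateReaches PA i j := by
  rw [reflTransGen_listed_iff hE]
  exact ⟨fun ⟨j', h, h'⟩ => Fin.ext h ▸ h', fun h => ⟨j, rfl, h⟩⟩

theorem linkSensor_lt (hq : 0 < q) (l : ℕ) : linkSensor q l < q := by
  unfold linkSensor; split_ifs <;> omega

theorem linkActuator_lt (hp : 0 < p) (hr : r ≤ p) (l : ℕ) : linkActuator r p l < p := by
  unfold linkActuator; split_ifs <;> omega

/-- Different numbers stand for different links, hence the output lists every link once. -/
theorem link_injective (hr : 0 < r) {l l' : ℕ} (hl : l < p + (q - p)) (hl' : l' < p + (q - p))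
    (h₁ : linkSensor q l = linkSensor q l') (h₂ : linkActuator r p l = linkActuator r p l') :
    l = l' := by
  unfold linkSensor at h₁
  unfold linkActuator at h₂
  split_ifs at h₁ h₂ <;> omega

/-- With paired bases of sources and sinks as actuators and sensors, the links number `0, 1, …` make
the closed loop strongly connected: those with numbers below `r` form the cycle through the pairs,
and each of the others joins the sensor and the actuator of its number, or number `0` if there is
none. -/
theorem exists_solution_of_isPairedBases (hn : 0 < n) (hPA : HasPerfectMatching PA)
    (hE : ∀ i j, (i, j) ∈ E ↔ PA j i = true)
    (h : IsPairedBases (ReflTransGen fun v w => ∃ e ∈ E, (e.1 : ℕ) = v ∧ (e.2 : ℕ) = w)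
      n p q r a b) (k : ℕ) :
    ∃ D : Design n, D.IsSolution PA k ∧ EncodesDesign D (outputWords k p q r a b) := by
  obtain ⟨j₀, hj₀, -⟩ := h.sens_reach 0 hn
  obtain ⟨l₀, hl₀, -⟩ := h.sens_pair j₀ hj₀
  have hr : 0 < r := by omega
  have hq : 0 < q := by omega
  have hp : 0 < p := lt_of_lt_of_le hr h.le_act
  let act : Fin p → Fin n := fun i => ⟨a i, h.act_lt i i.2⟩
  let sens : Fin q → Fin n := fun j => ⟨b j, h.sens_lt j j.2⟩
  let link : Fin (p + (q - p)) → Fin q × Fin p := fun l =>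
    (⟨linkSensor q l, linkSensor_lt hq l⟩, ⟨linkActuator r p l, linkActuator_lt hp h.le_act l⟩)
  let K : Finset (Fin q × Fin p) := Finset.univ.image link
  let actAll : Fin ((k + 1) * p) → Fin n := fun x => act (finProdFinEquiv.symm x).2
  let sensAll : Fin ((k + 1) * q) → Fin n := fun x => sens (finProdFinEquiv.symm x).2
  have hact : ∀ i, block actAll i = act := fun i => by
    funext j; simp only [block, actAll, Equiv.symm_apply_apply]
  have hsens : ∀ i, block sensAll i = sens := fun i => by
    funext j; simp only [block, sensAll, Equiv.symm_apply_apply]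
  have hs : IsSourceBasis PA act := by
    refine ⟨fun x => ?_, fun i j hij => ?_⟩
    · obtain ⟨i, hi, hx⟩ := h.act_reach x x.2
      exact ⟨⟨i, hi⟩, (reflTransGen_listed_coe_iff hE).1 hx⟩
    · exact Fin.ext (h.act_indep i i.2 j j.2 ((reflTransGen_listed_coe_iff hE (i := act i)
        (j := act j)).2 hij))
  have ht : IsSourceBasis PAᵀ sens := by
    refine ⟨fun x => ?_, fun i j hij => ?_⟩
    · obtain ⟨j, hj, hx⟩ := h.sens_reach x x.2
      exact ⟨⟨j, hj⟩, (stateReaches_transpose ..).2 ((reflTransGen_listed_coe_iff hE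
        (j := sens ⟨j, hj⟩)).1 hx)⟩
    · exact (Fin.ext (h.sens_indep j j.2 i i.2 ((reflTransGen_listed_coe_iff hE (i := sens j)
        (j := sens i)).2 ((stateReaches_transpose ..).1 hij)))).symm
  have hreach : ∀ (i : Fin p) (j : Fin q), ReflTransGen (fun v w => ∃ e ∈ E, (e.1 : ℕ) = v ∧
      (e.2 : ℕ) = w) (a i) (b j) → StateReaches PA (act i) (sens j) := fun i j hij =>
    (reflTransGen_listed_coe_iff hE (i := act i) (j := sens j)).1 hij
  have hK : ∀ l (hl : l < p + (q - p)) (s : Fin q) (u : Fin p), linkSensor q l = s →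
      linkActuator r p l = u → (s, u) ∈ K := fun l hl s u hs hu =>
    Finset.mem_image.2 ⟨⟨l, hl⟩, Finset.mem_univ _, Prod.ext (Fin.ext hs) (Fin.ext hu)⟩
  have hconn : ClosedLoopConnected PA act sens K := by
    obtain ⟨r, rfl⟩ : ∃ r', r = r' + 1 := ⟨r - 1, by omega⟩
    have hrp := h.le_act
    have hrq := h.le_sens
    refine closedLoopConnected_of_cycle (fun l : Fin (r + 1) => ⟨l, by omega⟩)
      (fun l : Fin (r + 1) => ⟨l, by omega⟩) hs.1 (fun x => ?_) (fun l => ?_) (fun l => ?_)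
      (fun v hv => ?_) (fun w hw => ?_)
    · obtain ⟨j, hj⟩ := ht.1 x
      exact ⟨j, (stateReaches_transpose ..).1 hj⟩
    · exact hreach _ _ (h.pair l l.2)
    · refine hK l (by omega) _ _ ?_ ?_
      · simp only [linkSensor]
        rw [if_pos (by omega)]
      · simp only [linkActuator]
        rw [Fin.val_add_one]
        have := l.2
        by_cases hl : l = Fin.last r
        · simp [hl]
        · have : (l : ℕ) ≠ r := fun h => hl (Fin.ext h)
          rw [if_pos (by omega), if_neg hl]
    · have hvr : r + 1 ≤ v := by
        by_contra hlt
        exact hv ⟨⟨v, by omega⟩, rfl⟩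
      obtain ⟨l, hl, hvl⟩ := h.act_pair v v.2
      refine ⟨⟨⟨l, hl⟩, hreach _ _ hvl⟩, ⟨_, linkSensor_lt hq v⟩, hK v (by omega) _ _ rfl ?_⟩
      simp only [linkActuator]
      rw [if_neg (by omega), if_neg (by omega), if_pos v.2]
    · have hwr : r + 1 ≤ w := by
        by_contra hlt
        exact hw ⟨⟨w, by omega⟩, rfl⟩
      obtain ⟨l, hl, hlw⟩ := h.sens_pair w w.2
      refine ⟨⟨⟨l, hl⟩, hreach _ _ hlw⟩, ⟨_, linkActuator_lt hp hrp w⟩,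
        hK w (by omega) _ _ ?_ rfl⟩
      simp only [linkSensor]
      rw [if_pos w.2]
  refine ⟨unionDesign actAll sensAll fun _ => K, ?_, ?_⟩
  · refine unionDesign_isSolution hPA (unionDesign_genericallyFeasible fun _ i => ?_)
      (fun i => Finset.card_image_le.trans ?_) hs ht le_rfl le_rfl
    · rw [hact, hsens]; exact hconn
    · simp; omega
  · let f : Fin (k + 1) × Fin (p + (q - p)) → Fin ((k + 1) * q) × Fin ((k + 1) * p) := fun x =>
      (finProdFinEquiv (x.1, (link x.2).1), finProdFinEquiv (x.1, (link x.2).2))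
    have hf : Function.Injective f := by
      rintro ⟨i, l⟩ ⟨i', l'⟩ hff
      have h1 := finProdFinEquiv.injective (congrArg Prod.fst hff)
      have h2 := finProdFinEquiv.injective (congrArg Prod.snd hff)
      simp only [Prod.mk.injEq] at h1 h2
      have h3 := Fin.ext (link_injective hr l.2 l'.2 (congrArg Fin.val h1.2)
        (congrArg Fin.val h2.2))
      rw [h1.1, h3]
    have hrange : ∀ (N : ℕ) (g : ℕ → List ℕ),
        (List.range N).flatMap g = (List.finRange N).flatMap fun i : Fin N => g i := fun N g => by
      rw [← List.map_coe_finRange_eq_range, List.flatMap_map]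
    have hofFn : ∀ {p : ℕ} (c : Fin p → Fin n) (a : ℕ → ℕ), (∀ i, (c i : ℕ) = a i) →
        (List.ofFn fun x : Fin ((k + 1) * p) => (c (finProdFinEquiv.symm x).2 : ℕ)) =
          (List.range (k + 1)).flatMap fun _ => (List.range p).flatMap fun i => [a i] := by
      intro p c a hc
      rw [List.ofFn_mul, List.ofFn_eq_map, hrange, List.flatMap]
      congr 1
      refine List.map_congr_left fun i _ => ?_
      rw [List.ofFn_eq_map, hrange, List.map_eq_flatMap]
      refine congrArg₂ _ (funext fun j => ?_) rfl
      rw [show (⟨(i : ℕ) * p + j, _⟩ : Fin ((k + 1) * p)) = finProdFinEquiv (i, j) from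
        Fin.ext (by simp [mul_comm, add_comm]), Equiv.symm_apply_apply, hc]
    let L := (List.finRange (k + 1) ×ˢ List.finRange (p + (q - p))).map f
    have hL : ∀ e, e ∈ L ↔ e ∈ Finset.univ.biUnion fun i : Fin (k + 1) =>
        K.image fun e => (finProdFinEquiv (i, e.1), finProdFinEquiv (i, e.2)) := fun e => by
      simp only [L, K, f, List.mem_map, Finset.mem_biUnion, Finset.mem_image, Prod.exists,
        Finset.mem_univ, true_and]
      constructor
      · rintro ⟨i, l, -, rfl⟩
        exact ⟨i, _, _, ⟨l, rfl⟩, rfl⟩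
      · rintro ⟨i, _, _, ⟨l, hl⟩, rfl⟩
        exact ⟨i, l, List.pair_mem_product.2 ⟨List.mem_finRange i, List.mem_finRange l⟩,
          by rw [hl]⟩
    have hlen : L.length = (k + 1) * (p + (q - p)) := by
      simp [L, List.length_product]
    have hwords : ((List.range (k + 1)).flatMap fun b => (List.range (p + (q - p))).flatMap fun l =>
        linkWords r p q b l) = L.flatMap fun e => [(e.1 : ℕ), (e.2 : ℕ)] := by
      simp only [L, SProd.sprod, List.product, List.flatMap_assoc, List.flatMap_map, hrange,
        List.map_flatMap, List.map_map]
      refine congrArg₂ _ (funext fun i => congrArg₂ _ (funext fun l => ?_) rfl) rfl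
      simp [linkWords, f, link, mul_comm]
    refine ⟨L, ((List.nodup_finRange _).product (List.nodup_finRange _)).map hf, hL, ?_⟩
    rw [outputWords, ← hofFn act a fun _ => rfl, ← hofFn sens b fun _ => rfl, hwords, ← hlen]
    rfl

/-- The system digraph contains the state digraph. -/
theorem add_length_le_digraphSize (hE : ListsEdges PA E) (D : Design n) :
    n + E.length ≤ digraphSize (D.digraph PA) := by
  refine Nat.add_le_add (by simp) ?_
  rw [← List.toFinset_card_of_nodup hE.1, ← Set.ncard_coe_finset]
  refine Set.ncard_le_ncard_of_injOn (fun e => (Sum.inl e.1, Sum.inl e.2)) (fun e he => ?_)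
    (fun e _ e' _ h => ?_) (Set.toFinite _)
  · exact (hE.2 e.1 e.2).1 (by simpa using he)
  · simp only [Prod.mk.injEq, Sum.inl.injEq] at h
    exact Prod.ext h.1 h.2

/-- The program computes a solution within the stated time; the search and the greedy matching are
linear in the size of the state digraph, and the output takes `k + 1` rounds. -/
theorem exists_solution_computedBy_designProgram (hn : 0 < n) (hPA : HasPerfectMatching PA)
    (hE : ListsEdges PA E) (k : ℕ) : ∃ (D : Design n) (t : ℕ), D.IsSolution PA k ∧
      ComputesDesign designProgram E k D t ∧
      t ≤ 20040 * ((k + 1) * digraphSize (D.digraph PA)) := by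
  obtain ⟨s, t, p, q, r, a, b, he, ht, hb, hs⟩ := exec_designProgram E k
  obtain ⟨D, hD, hw⟩ := exists_solution_of_isPairedBases hn hPA hE.2 hb k
  refine ⟨D, t, hD, ⟨s, _, he, hw, hs⟩, ht.trans ?_⟩
  have := add_length_le_digraphSize hE D
  rw [show 20040 * ((k + 1) * digraphSize (D.digraph PA)) =
    10020 * ((k + 1) * (2 * digraphSize (D.digraph PA))) by ring]
  exact Nat.mul_le_mul_left _ (Nat.mul_le_mul_left _ (by omega))

end PairedBases

end ResilientDesign

/-- First part: the union of `k + 1` minimum collections of dedicated actuators and sensors, with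
the union of their pairing patterns, almost never has nonzero resilient fixed modes under at most
`k` failures, and it solves the co-design problem for stabilization if the state bipartite graph
has a perfect matching. Second part: under the latter assumption, a fixed random access machine
program computes a solution within the stated time. -/
theorem corollary2 :
    (∀ (n k p m : ℕ) (PA : Matrix (Fin n) (Fin n) Bool)
      (act : Fin ((k + 1) * p) → Fin n) (sens : Fin ((k + 1) * m) → Fin n)
      (K : Fin (k + 1) → Finset (Fin m × Fin p)),
      (∀ i, ResilientDesign.IsMinimumActuation PA (ResilientDesign.block act i)) →
      (∀ i, ResilientDesign.IsMinimumSensing PA (ResilientDesign.block sens i)) →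
      (∀ i, ResilientDesign.IsPairingPattern PA (ResilientDesign.block act i)
        (ResilientDesign.block sens i) (K i)) →
      (ResilientDesign.unionDesign act sens K).GenericallyFeasible PA k ∧
      (ResilientDesign.HasPerfectMatching PA →
        (ResilientDesign.unionDesign act sens K).IsSolution PA k)) ∧
    (∃ (prog : ResilientDesign.RAM.Cmd) (c : ℝ),
      ∀ (n k : ℕ) (PA : Matrix (Fin n) (Fin n) Bool) (E : List (Fin n × Fin n)),
        0 < n → ResilientDesign.HasPerfectMatching PA → ResilientDesign.ListsEdges PA E →
        ∃ (D : ResilientDesign.Design n) (t : ℕ),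
          D.IsSolution PA k ∧ ResilientDesign.ComputesDesign prog E k D t ∧
          (t : ℝ) ≤ c * ((k + 1 : ℝ) *
            max (ResilientDesign.digraphSize (D.digraph PA) : ℝ)
              (((D.numAct : ℝ) + (D.numSens : ℝ)) ^ (5 / 2 : ℝ)))) := by
  refine ⟨fun n k p m PA act sens K hact hsens hK =>
    ResilientDesign.unionDesign_genericallyFeasible_and_isSolution hact hsens hK,
    ResilientDesign.RAM.designProgram, 20040, fun n k PA E hn hPA hE => ?_⟩
  obtain ⟨D, t, hD, hc, ht⟩ :=
    ResilientDesign.exists_solution_computedBy_designProgram hn hPA hE k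
  refine ⟨D, t, hD, hc, ?_⟩
  calc (t : ℝ) ≤ 20040 * ((k + 1) * ResilientDesign.digraphSize (D.digraph PA)) := by
        exact_mod_cast ht
    _ ≤ _ := by
        gcongr
        exact le_max_left _ _
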